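/- **Corollary (limit ratios, patch).** Let $n\ge 1$, let $\mathcal S\subset\mathbb R^{n+1}$ be a smooth embedded hypersurface with the induced metric, let $p\in\mathcal S$, and let $\mathbf N$ be a smooth unit normal field of $\mathcal S$ near $p$. Let $\kappa_1,\dots,\kappa_n$ be the principal curvatures at $p$ (the eigenvalues of $x\mapsto-\bar\nabla_x\mathbf N$ on $T_p\mathcal S$, with respect to an orthonormal basis of principal directions), $H=\sum_{\mu=1}^n\kappa_\mu$ the mean curvature, and $\mathcal R$ the scalar curvature of $\mathcal S$ at $p$. For $\varepsilon>0$ let $D_p(\varepsilon)=\mathcal S\cap\{X:\|X-p\|\le\varepsilon\}$, let $\mathrm{dVol}$ be the $n$-dimensional Riemannian volume measure of $\mathcal S$, let $$\mathbf s=\frac1{\mathrm{Vol}(D_p(\varepsilon))}\int_{D_p(\varepsilon)}X\,\mathrm{dVol},\qquad C(D_p(\varepsilon))=\int_{D_p(\varepsilon)}(X-\mathbf s)\otimes(X-\mathbf s)^T\,\mathrm{dVol}$$ be the barycenter and the (unnormalized) covariance matrix, and let $V_n(\varepsilon)$ be the volume of the $n$-dimensional Euclidean ball of radius $\varepsilon$.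 For all sufficiently small $\varepsilon>0$, $0<\mathrm{Vol}(D_p(\varepsilon))<\infty$ and the $n$ largest eigenvalues (with multiplicity) of $C(D_p(\varepsilon))$ are positive. Let $\lambda_{n+1}(\varepsilon)$ be the smallest eigenvalue. The $n$ largest ones can be labelled $\lambda_1(\varepsilon),\dots,\lambda_n(\varepsilon)$, in such a way that their decreasing order is given by one permutation of $\{1,\dots,n\}$ independent of $\varepsilon$ and that $\lambda_\mu$ precedes $\lambda_\nu$ in this order whenever $H\kappa_\mu<H\kappa_\nu$, so that for all $\mu,\nu\in\{1,\dots,n\}$ $$\lim_{\varepsilon\to0^+}V_n(\varepsilon)\,\frac{\lambda_\mu(\varepsilon)-\lambda_\nu(\varepsilon)}{\lambda_\mu(\varepsilon)\lambda_\nu(\varepsilon)}=\frac{n+2}{2(n+4)}\,(\kappa_\nu-\kappa_\mu)\,H ,$$ $$\lim_{\varepsilon\to0^+}V_n(\varepsilon)\,\frac{\lambda_{n+1}(\varepsilon)}{\lambda_\mu(\varepsilon)\lambda_\nu(\varepsilon)}=\frac{n+2}{2(n+4)}\left(\frac{n+1}{n+2}\,H^2-\mathcal R\right).$$ -/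

import Mathlib

open Set Filter Topology MeasureTheory
open scoped ContDiff InnerProductSpace

namespace PatchPCA

noncomputable section

/-- Euclidean space of dimension `d`. -/
abbrev Euc (d : ℕ) : Type := EuclideanSpace ℝ (Fin d)

/-! ### Smooth hypersurfaces -/

/-- `S` is a smooth embedded hypersurface (without boundary, not necessarily closed or connected):
near each of its points it is a regular level set of a smooth function. -/
def IsSmoothHypersurface {n : ℕ} (S : Set (Euc (n + 1))) : Prop :=
  ∀ p ∈ S, ∃ (W : Set (Euc (n + 1))) (f : Euc (n + 1) → ℝ), IsOpen W ∧ p ∈ W ∧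
    ContDiffOn ℝ ∞ f W ∧ (∀ q ∈ W, fderiv ℝ f q ≠ 0) ∧ S ∩ W = {q ∈ W | f q = 0}

/-- The tangent vectors of `S` at `q`: velocities at `q` of smooth curves lying in `S`. -/
def tangentVectors {n : ℕ} (S : Set (Euc (n + 1))) (q : Euc (n + 1)) : Set (Euc (n + 1)) :=
  {v | ∃ γ : ℝ → Euc (n + 1), ContDiffAt ℝ ∞ γ 0 ∧ γ 0 = q ∧ (∀ᶠ t in 𝓝 (0 : ℝ), γ t ∈ S) ∧
    HasDerivAt γ v 0}

/-- `N` is a smooth unit normal vector field of `S` around `p`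
(its values off `S` are those of an arbitrary smooth extension). -/
def IsUnitNormalNear {n : ℕ} (S : Set (Euc (n + 1))) (p : Euc (n + 1))
    (N : Euc (n + 1) → Euc (n + 1)) : Prop :=
  ∃ W : Set (Euc (n + 1)), IsOpen W ∧ p ∈ W ∧ ContDiffOn ℝ ∞ N W ∧
    ∀ q ∈ S ∩ W, ‖N q‖ = 1 ∧ ∀ v ∈ tangentVectors S q, ⟪N q, v⟫_ℝ = 0

/-! ### Extrinsic curvature -/

/-- The Weingarten map `x ↦ -∇̄_x N` at `p`; it is to be evaluated at tangent vectors only. -/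
def shapeOperator {n : ℕ} (N : Euc (n + 1) → Euc (n + 1)) (p : Euc (n + 1)) :
    Euc (n + 1) →L[ℝ] Euc (n + 1) :=
  -fderiv ℝ N p

/-- `e` is an orthonormal basis of the tangent space of `S` at `p` made of principal directions,
and `κ` lists the corresponding principal curvatures. -/
def IsPrincipalFrame {n : ℕ} (S : Set (Euc (n + 1))) (N : Euc (n + 1) → Euc (n + 1))
    (p : Euc (n + 1)) (e : Fin n → Euc (n + 1)) (κ : Fin n → ℝ) : Prop :=
  Orthonormal ℝ e ∧ ∀ μ, e μ ∈ tangentVectors S p ∧ shapeOperator N p (e μ) = κ μ • e μ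

/-- Mean curvature, the trace of the Weingarten map: `H = κ₁ + ⋯ + κₙ`. -/
def meanCurvature {n : ℕ} (κ : Fin n → ℝ) : ℝ := ∑ μ, κ μ

/-! ### Intrinsic curvature -/

/-- The component of `v` orthogonal to `N q`, that is, the tangential part of `v` at `q`. -/
def tangentialPart {n : ℕ} (N : Euc (n + 1) → Euc (n + 1)) (q v : Euc (n + 1)) : Euc (n + 1) :=
  v - ⟪N q, v⟫_ℝ • N q

/-- The Levi-Civita connection of the induced metric: the tangential part of the directional
derivative of `Y` along `X`. -/
def covDeriv {n : ℕ} (N X Y : Euc (n + 1) → Euc (n + 1)) : Euc (n + 1) → Euc (n + 1) :=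
  fun q => tangentialPart N q (fderiv ℝ Y q (X q))

/-- `R(X, Y) Z = ∇_X ∇_Y Z - ∇_Y ∇_X Z - ∇_[X,Y] Z` for tangent vector fields. -/
def riemannField {n : ℕ} (N X Y Z : Euc (n + 1) → Euc (n + 1)) : Euc (n + 1) → Euc (n + 1) :=
  fun q => covDeriv N X (covDeriv N Y Z) q - covDeriv N Y (covDeriv N X Z) q
    - covDeriv N (VectorField.lieBracket ℝ X Y) Z q

/-- The Riemann curvature tensor `R(x, y) z` of the induced metric at `p`. The tangent vectors
`x`, `y`, `z` at `p` are extended to the tangent vector fields `q ↦ tangentialPart N q x`, etc.;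
by tensoriality the value does not depend on the extension. -/
def riemann {n : ℕ} (N : Euc (n + 1) → Euc (n + 1)) (p x y z : Euc (n + 1)) : Euc (n + 1) :=
  riemannField N (fun q => tangentialPart N q x) (fun q => tangentialPart N q y)
    (fun q => tangentialPart N q z) p

/-- `Ric(x, y) = ∑_μ ⟨R(e_μ, x) y, e_μ⟩` for an orthonormal tangent frame `e` at `p`. -/
def ricci {n : ℕ} (N : Euc (n + 1) → Euc (n + 1)) (p : Euc (n + 1)) (e : Fin n → Euc (n + 1))
    (x y : Euc (n + 1)) : ℝ :=
  ∑ μ, ⟪riemann N p (e μ) x y, e μ⟫_ℝ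

/-- Scalar curvature `∑_ν Ric(e_ν, e_ν)` for an orthonormal tangent frame `e` at `p`. -/
def scalarCurvature {n : ℕ} (N : Euc (n + 1) → Euc (n + 1)) (p : Euc (n + 1))
    (e : Fin n → Euc (n + 1)) : ℝ :=
  ∑ ν, ricci N p e (e ν) (e ν)

/-! ### The Riemannian volume measure -/

/-- `φ` is a smooth regular local parametrization of `S` with domain the open set `U ⊆ ℝⁿ`. -/
def IsLocalParametrization {n : ℕ} (S : Set (Euc (n + 1))) (U : Set (Euc n))
    (φ : Euc n → Euc (n + 1)) : Prop :=
  IsOpen U ∧ ContDiffOn ℝ ∞ φ U ∧ (∀ x ∈ U, Function.Injective (fderiv ℝ φ x)) ∧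
    IsEmbedding (U.domRestrict φ) ∧ ∃ W : Set (Euc (n + 1)), IsOpen W ∧ φ '' U = S ∩ W

/-- The metric coefficients `g_μν = ⟨∂_μ φ, ∂_ν φ⟩`. -/
def metricMatrix {n : ℕ} (φ : Euc n → Euc (n + 1)) (x : Euc n) : Matrix (Fin n) (Fin n) ℝ :=
  Matrix.of fun μ ν => ⟪fderiv ℝ φ x (EuclideanSpace.single μ 1),
    fderiv ℝ φ x (EuclideanSpace.single ν 1)⟫_ℝ

/-- The measure `√(det g) dx` carried to the hypersurface by a parametrization `φ` on `U`. -/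
def chartVolume {n : ℕ} (U : Set (Euc n)) (φ : Euc n → Euc (n + 1)) : Measure (Euc (n + 1)) :=
  Measure.map φ ((volume.restrict U).withDensity
    fun x => ENNReal.ofReal (Real.sqrt (metricMatrix φ x).det))

/-- The `n`-dimensional Riemannian volume measure of `S`, as a measure on the ambient space
concentrated on `S`. The measures `√(det g) dx` of the local parametrizations agree on overlaps;
the volume measure glues them, hence it is the least measure dominating all of them. -/
def hypersurfaceVolume {n : ℕ} (S : Set (Euc (n + 1))) : Measure (Euc (n + 1)) :=
  sSup {m | ∃ (U : Set (Euc n)) (φ : Euc n → Euc (n + 1)),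
    IsLocalParametrization S U φ ∧ m = chartVolume U φ}

/-! ### Integral invariants -/

/-- The barycenter of `D` with respect to the measure `σ`. -/
def barycenter {d : ℕ} (σ : Measure (Euc d)) (D : Set (Euc d)) : Euc d :=
  (σ.real D)⁻¹ • ∫ X in D, X ∂σ

/-- The (unnormalized) covariance matrix `∫_D (X - s) ⊗ (X - s)ᵀ dVol`. -/
def covarianceMatrix {d : ℕ} (σ : Measure (Euc d)) (D : Set (Euc d)) :
    Matrix (Fin d) (Fin d) ℝ :=
  Matrix.of fun i j => ∫ X in D, (X i - barycenter σ D i) * (X j - barycenter σ D j) ∂σ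

theorem covarianceMatrix_isHermitian {d : ℕ} (σ : Measure (Euc d)) (D : Set (Euc d)) :
    (covarianceMatrix σ D).IsHermitian := by
  ext i j
  simp [covarianceMatrix, mul_comm]

/-- The eigenvalues of the covariance matrix, with multiplicity, in decreasing order. -/
def covarianceEigenvalue {d : ℕ} (σ : Measure (Euc d)) (D : Set (Euc d)) (k : Fin d) : ℝ :=
  (covarianceMatrix_isHermitian σ D).eigenvalues₀ (Fin.cast (Fintype.card_fin d).symm k)

/-- The hypersurface patch `D_p(ε) = S ∩ B_p(ε)`. -/
def patch {n : ℕ} (S : Set (Euc (n + 1))) (p : Euc (n + 1)) (ε : ℝ) : Set (Euc (n + 1)) :=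
  S ∩ Metric.closedBall p ε

/-- The `k`-th largest eigenvalue of the covariance matrix of the patch `D_p(ε)`. -/
def patchEigenvalue {n : ℕ} (S : Set (Euc (n + 1))) (p : Euc (n + 1)) (ε : ℝ)
    (k : Fin (n + 1)) : ℝ :=
  covarianceEigenvalue (hypersurfaceVolume S) (patch S p ε) k

/-- `V_n(ε)`, the volume of the `n`-dimensional Euclidean ball of radius `ε`. -/
def ballVolume (n : ℕ) (ε : ℝ) : ℝ := volume.real (Metric.closedBall (0 : Euc n) ε)

end

end PatchPCA

/-!
Near `p` the hypersurface is the graph of a function `h` over its tangent hyperplane, with the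
principal directions as coordinate axes of that hyperplane. Then
`h x = ½ ∑ κ i * x i ^ 2 + o(‖x‖ ^ 2)`, and the volume density is
`√(1 + ‖∇h‖ ^ 2) = 1 + ½ ∑ κ i ^ 2 * x i ^ 2 + o(‖x‖ ^ 2)`: this is `fderiv_graph_function` (the
Hessian of `h` is read off by differentiating the orthogonality of `N` to the graph) together with
`sub_diagForm_isLittleO` and `sqrt_det_isLittleO`. The supremum of measures that defines the
hypersurface volume reduces to this one chart, because the area formula bounds the contribution of
any other parametrization by that of the graph (`setIntegral_patch`).

The projection of the patch to the hyperplane is `{x | ‖x‖ ^ 2 + h x ^ 2 ≤ ε ^ 2}`. Rescaled by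
`ε⁻¹` it is the unit ball up to a shell of thickness `ε ^ 2 * (h₂ θ) ^ 2 / 2` in the direction `θ`,
where `h₂` is the quadratic part of `h`. Blowing up the shell in polar coordinates gives the second
order expansion of all integrals in terms of moments of the ball and of the sphere
(`IsGraphData.tendsto_setIntegral_density`). The moments come from Gaussian integration by parts.

With `V` the volume of the unit ball and `H = ∑ κ i`, the covariance matrix in the adapted basis
therefore has

* tangential block `V / (n + 2) * ε ^ (n + 2)` times the identity, plus a diagonal matrix of order
  `ε ^ (n + 4)` that depends on `μ` through `-4 * H * κ μ` only, plus `o(ε ^ (n + 4))`;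
* normal entry of order `ε ^ (n + 4)` with a known coefficient;
* mixed entries of order `o(ε ^ (n + 3))`.

Expansions of the eigenvalues follow from the Courant–Fischer principle
(`tendsto_eigenvalues_of_block`). The mixed entries are not assumed small relative to the smallest
eigenvalue; their effect is bounded by the weighted inequality
`2 * |s * y * z| ≤ δ * y ^ 2 + s ^ 2 / δ * z ^ 2`, in which `δ` is adapted to the eigenvalue under
consideration. Sorting the frame so that `H * κ` increases makes the tangential coefficients
decrease, so that the ordered eigenvalues match the frame. The scalar curvature enters through the
Gauss equation, which gives `H ^ 2 - ∑ κ i ^ 2` (`scalarCurvature_eq`).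
-/

namespace PatchPCA

/-! ### Eigenvalues of nearly block diagonal symmetric operators -/

section Eigenvalues

variable {E : Type*} [NormedAddCommGroup E] [InnerProductSpace ℝ E] [FiniteDimensional ℝ E]
  {T : E →ₗ[ℝ] E}

theorem inner_map_self_eq_sum_eigenvalues (hT : T.IsSymmetric) {d : ℕ}
    (hd : Module.finrank ℝ E = d) (x : E) :
    ⟪x, T x⟫_ℝ = ∑ i, hT.eigenvalues hd i * ⟪hT.eigenvectorBasis hd i, x⟫_ℝ ^ 2 := by
  rw [← (hT.eigenvectorBasis hd).sum_inner_mul_inner x (T x)]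
  refine Finset.sum_congr rfl fun i _ => ?_
  have : ⟪hT.eigenvectorBasis hd i, T x⟫_ℝ
      = hT.eigenvalues hd i * ⟪hT.eigenvectorBasis hd i, x⟫_ℝ := by
    rw [← hT, hT.apply_eigenvectorBasis, real_inner_smul_left]
    rfl
  rw [this, real_inner_comm]; ring

theorem exists_ne_zero_mem_inf {W W' : Submodule ℝ E}
    (h : Module.finrank ℝ E < Module.finrank ℝ W + Module.finrank ℝ W') :
    ∃ x ∈ W, x ∈ W' ∧ x ≠ 0 := by
  have h1 := Submodule.finrank_sup_add_finrank_inf_eq W W'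
  have h2 : Module.finrank ℝ (W ⊔ W' : Submodule ℝ E) ≤ Module.finrank ℝ E :=
    Submodule.finrank_le _
  have h3 : W ⊓ W' ≠ ⊥ := by
    intro h0
    rw [h0, finrank_bot] at h1
    omega
  obtain ⟨x, hx, hx0⟩ := Submodule.exists_mem_ne_zero_of_ne_bot h3
  exact ⟨x, hx.1, hx.2, hx0⟩

omit [FiniteDimensional ℝ E] in
theorem finrank_span_image_orthonormalBasis {ι : Type*} [Fintype ι] (b : OrthonormalBasis ι ℝ E)
    (s : Finset ι) : Module.finrank ℝ (Submodule.span ℝ (b '' s)) = s.card := by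
  classical
  have hli : LinearIndependent ℝ (fun i : s => b i) :=
    b.orthonormal.linearIndependent.comp _ Subtype.val_injective
  have := finrank_span_eq_card hli
  rw [Fintype.card_coe] at this
  rw [← this, image_eq_range]
  rfl

omit [FiniteDimensional ℝ E] in
theorem inner_eq_zero_of_mem_span_image {ι : Type*} [Fintype ι] (b : OrthonormalBasis ι ℝ E)
    {s : Set ι} {x : E} (hx : x ∈ Submodule.span ℝ (b '' s)) {i : ι} (hi : i ∉ s) :
    ⟪b i, x⟫_ℝ = 0 := by
  have : Submodule.span ℝ (b '' s) ≤ LinearMap.ker (innerₛₗ ℝ (b i)) := by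
    rw [Submodule.span_le]
    rintro _ ⟨j, hj, rfl⟩
    have hij : i ≠ j := fun h => hi (h ▸ hj)
    simpa using b.orthonormal.2 hij
  simpa using this hx

omit [FiniteDimensional ℝ E] in
theorem sum_inner_sq_eq {ι : Type*} [Fintype ι] (b : OrthonormalBasis ι ℝ E) (x : E) :
    ∑ i, ⟪b i, x⟫_ℝ ^ 2 = ‖x‖ ^ 2 := by
  have := b.sum_sq_norm_inner_right x
  simpa using this

/-- One half of the Courant–Fischer principle: a quadratic form dominated by a diagonal one with
decreasing coefficients has eigenvalues dominated by these coefficients. -/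
theorem eigenvalues_le_of_inner_le (hT : T.IsSymmetric) {d : ℕ} (hd : Module.finrank ℝ E = d)
    (b : OrthonormalBasis (Fin d) ℝ E) {c : Fin d → ℝ} (hc : Antitone c)
    (h : ∀ x, ⟪x, T x⟫_ℝ ≤ ∑ i, c i * ⟪b i, x⟫_ℝ ^ 2) (k : Fin d) :
    hT.eigenvalues hd k ≤ c k := by
  -- the spans of `b i` for `k ≤ i` and of the first `k + 1` eigenvectors meet for dimension reasons
  obtain ⟨x, hx, hx', hx0⟩ := exists_ne_zero_mem_inf (E := E)
    (W := Submodule.span ℝ (b '' (Finset.Ici k : Finset (Fin d))))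
    (W' := Submodule.span ℝ (hT.eigenvectorBasis hd '' (Finset.Iic k : Finset (Fin d)))) (by
      rw [finrank_span_image_orthonormalBasis, finrank_span_image_orthonormalBasis, hd,
        Fin.card_Ici, Fin.card_Iic]
      omega)
  have hpos : 0 < ‖x‖ ^ 2 := by positivity
  have h1 : hT.eigenvalues hd k * ‖x‖ ^ 2 ≤ ⟪x, T x⟫_ℝ := by
    rw [inner_map_self_eq_sum_eigenvalues hT hd, ← sum_inner_sq_eq (hT.eigenvectorBasis hd) x,
      Finset.mul_sum]
    refine Finset.sum_le_sum fun i _ => ?_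
    by_cases hi : i ≤ k
    · exact mul_le_mul_of_nonneg_right (hT.eigenvalues_antitone hd hi) (sq_nonneg _)
    · rw [inner_eq_zero_of_mem_span_image _ hx' (by simpa using hi)]; simp
  have h2 : ∑ i, c i * ⟪b i, x⟫_ℝ ^ 2 ≤ c k * ‖x‖ ^ 2 := by
    rw [← sum_inner_sq_eq b x, Finset.mul_sum]
    refine Finset.sum_le_sum fun i _ => ?_
    by_cases hi : k ≤ i
    · exact mul_le_mul_of_nonneg_right (hc hi) (sq_nonneg _)
    · rw [inner_eq_zero_of_mem_span_image _ hx (by simpa using hi)]; simp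
  exact le_of_mul_le_mul_right (h1.trans ((h x).trans h2)) hpos

/-- The other half of the Courant–Fischer principle. -/
theorem le_eigenvalues_of_le_inner (hT : T.IsSymmetric) {d : ℕ} (hd : Module.finrank ℝ E = d)
    (b : OrthonormalBasis (Fin d) ℝ E) {c : Fin d → ℝ} (hc : Antitone c)
    (h : ∀ x, ∑ i, c i * ⟪b i, x⟫_ℝ ^ 2 ≤ ⟪x, T x⟫_ℝ) (k : Fin d) :
    c k ≤ hT.eigenvalues hd k := by
  obtain ⟨x, hx, hx', hx0⟩ := exists_ne_zero_mem_inf (E := E)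
    (W := Submodule.span ℝ (b '' (Finset.Iic k : Finset (Fin d))))
    (W' := Submodule.span ℝ (hT.eigenvectorBasis hd '' (Finset.Ici k : Finset (Fin d)))) (by
      rw [finrank_span_image_orthonormalBasis, finrank_span_image_orthonormalBasis, hd,
        Fin.card_Ici, Fin.card_Iic]
      omega)
  have hpos : 0 < ‖x‖ ^ 2 := by positivity
  have h1 : ⟪x, T x⟫_ℝ ≤ hT.eigenvalues hd k * ‖x‖ ^ 2 := by
    rw [inner_map_self_eq_sum_eigenvalues hT hd, ← sum_inner_sq_eq (hT.eigenvectorBasis hd) x,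
      Finset.mul_sum]
    refine Finset.sum_le_sum fun i _ => ?_
    by_cases hi : k ≤ i
    · exact mul_le_mul_of_nonneg_right (hT.eigenvalues_antitone hd hi) (sq_nonneg _)
    · rw [inner_eq_zero_of_mem_span_image _ hx' (by simpa using hi)]; simp
  have h2 : c k * ‖x‖ ^ 2 ≤ ∑ i, c i * ⟪b i, x⟫_ℝ ^ 2 := by
    rw [← sum_inner_sq_eq b x, Finset.mul_sum]
    refine Finset.sum_le_sum fun i _ => ?_
    by_cases hi : i ≤ k
    · exact mul_le_mul_of_nonneg_right (hc hi) (sq_nonneg _)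
    · rw [inner_eq_zero_of_mem_span_image _ hx (by simpa using hi)]; simp
  exact le_of_mul_le_mul_right (h2.trans ((h x).trans h1)) hpos

omit [FiniteDimensional ℝ E] in
/-- The quadratic form of `T` in an orthonormal basis. -/
theorem inner_map_self_eq_sum_sum {ι : Type*} [Fintype ι] (b : OrthonormalBasis ι ℝ E) (x : E) :
    ⟪x, T x⟫_ℝ = ∑ i, ∑ j, ⟪b i, T (b j)⟫_ℝ * ⟪b i, x⟫_ℝ * ⟪b j, x⟫_ℝ := by
  conv_lhs => rw [← b.sum_repr' x]
  simp only [map_sum, map_smul, sum_inner, inner_sum, real_inner_smul_left, real_inner_smul_right]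
  rw [Finset.sum_comm]
  refine Finset.sum_congr rfl fun i _ => Finset.sum_congr rfl fun j _ => by ring

omit [FiniteDimensional ℝ E] in
/-- A quadratic form that is diagonal up to `η` on the first block and whose coupling with the last
basis vector is at most `ρ`. The parameter `δ` distributes the coupling over the two blocks. -/
theorem abs_inner_map_self_sub_le (hT : T.IsSymmetric) {n : ℕ}
    (b : OrthonormalBasis (Fin (n + 1)) ℝ E) {β : Fin n → ℝ} {η ρ δ : ℝ} (hδ : 0 < δ)
    (h1 : ∀ μ ν : Fin n,
      |⟪b μ.castSucc, T (b ν.castSucc)⟫_ℝ - if μ = ν then β μ else 0| ≤ η)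
    (h2 : ∀ μ : Fin n, |⟪b μ.castSucc, T (b (Fin.last n))⟫_ℝ| ≤ ρ) (x : E) :
    |⟪x, T x⟫_ℝ - (∑ μ : Fin n, β μ * ⟪b μ.castSucc, x⟫_ℝ ^ 2
      + ⟪b (Fin.last n), T (b (Fin.last n))⟫_ℝ * ⟪b (Fin.last n), x⟫_ℝ ^ 2)| ≤
    ∑ μ : Fin n, (n * η + δ) * ⟪b μ.castSucc, x⟫_ℝ ^ 2
      + n * ρ ^ 2 / δ * ⟪b (Fin.last n), x⟫_ℝ ^ 2 := by
  set y : Fin n → ℝ := fun μ => ⟪b μ.castSucc, x⟫_ℝ with hy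
  set z := ⟪b (Fin.last n), x⟫_ℝ
  set t : Fin n → Fin n → ℝ := fun μ ν => ⟪b μ.castSucc, T (b ν.castSucc)⟫_ℝ with ht
  set s : Fin n → ℝ := fun μ => ⟪b μ.castSucc, T (b (Fin.last n))⟫_ℝ with hs
  have hsym : ∀ μ : Fin n, ⟪b (Fin.last n), T (b μ.castSucc)⟫_ℝ = s μ := fun μ => by
    rw [hs, ← hT, real_inner_comm]
  have key : ⟪x, T x⟫_ℝ - (∑ μ, β μ * y μ ^ 2
      + ⟪b (Fin.last n), T (b (Fin.last n))⟫_ℝ * z ^ 2) =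
      ∑ μ, ∑ ν, (t μ ν - if μ = ν then β μ else 0) * (y μ * y ν) + ∑ μ, 2 * (s μ * y μ * z) := by
    rw [inner_map_self_eq_sum_sum b x]
    simp only [Fin.sum_univ_castSucc, hsym, sub_mul, ite_mul, zero_mul, Finset.sum_sub_distrib,
      Finset.sum_ite_eq, Finset.mem_univ, if_true, Finset.sum_add_distrib]
    have e1 : ∑ μ, 2 * (s μ * y μ * z) = ∑ μ, s μ * y μ * z + ∑ μ, s μ * z * y μ := by
      rw [← Finset.sum_add_distrib]; exact Finset.sum_congr rfl fun i _ => by ring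
    rw [e1]
    have e2 : ∀ μ ν, t μ ν * (y μ * y ν) = t μ ν * y μ * y ν := fun μ ν => by ring
    have e3 : ∀ μ, β μ * (y μ * y μ) = β μ * y μ ^ 2 := fun μ => by ring
    simp only [e2, e3]
    ring
  rw [key]
  -- off-diagonal errors: `|y μ * y ν| ≤ (y μ ^ 2 + y ν ^ 2) / 2`
  have b1 : |∑ μ, ∑ ν, (t μ ν - if μ = ν then β μ else 0) * (y μ * y ν)|
      ≤ ∑ μ, ∑ ν, η * ((y μ ^ 2 + y ν ^ 2) / 2) := by
    refine (Finset.abs_sum_le_sum_abs _ _).trans (Finset.sum_le_sum fun μ _ => ?_)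
    refine (Finset.abs_sum_le_sum_abs _ _).trans (Finset.sum_le_sum fun ν _ => ?_)
    rw [abs_mul]
    refine mul_le_mul (h1 μ ν) ?_ (abs_nonneg _) ((abs_nonneg _).trans (h1 μ ν))
    rw [abs_le]
    constructor <;> nlinarith [sq_nonneg (y μ + y ν), sq_nonneg (y μ - y ν)]
  have b1' : ∑ μ, ∑ ν, η * ((y μ ^ 2 + y ν ^ 2) / 2) = ∑ μ : Fin n, n * η * y μ ^ 2 := by
    have : ∀ μ ν, η * ((y μ ^ 2 + y ν ^ 2) / 2) = η / 2 * y μ ^ 2 + η / 2 * y ν ^ 2 :=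
      fun μ ν => by ring
    simp only [this, Finset.sum_add_distrib, Finset.sum_const, Finset.card_univ, Fintype.card_fin,
      nsmul_eq_mul, ← Finset.mul_sum]
    ring
  -- coupling: `2 * ρ * |y| * |z| ≤ δ * y ^ 2 + ρ ^ 2 / δ * z ^ 2`
  have b2 : |∑ μ, 2 * (s μ * y μ * z)| ≤ ∑ μ, (δ * y μ ^ 2 + ρ ^ 2 / δ * z ^ 2) := by
    refine (Finset.abs_sum_le_sum_abs _ _).trans (Finset.sum_le_sum fun μ _ => ?_)
    have hr := h2 μ
    have e : δ * y μ ^ 2 + ρ ^ 2 / δ * z ^ 2 - 2 * (ρ * (|y μ| * |z|))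
        = (δ * |y μ| - ρ * |z|) ^ 2 / δ := by
      rw [← sq_abs (y μ), ← sq_abs z]; field_simp; ring
    have e' : 0 ≤ (δ * |y μ| - ρ * |z|) ^ 2 / δ := by positivity
    rw [abs_mul, abs_mul, abs_mul, abs_two, mul_assoc]
    have : |s μ| * (|y μ| * |z|) ≤ ρ * (|y μ| * |z|) :=
      mul_le_mul_of_nonneg_right hr (by positivity)
    linarith
  refine (abs_add_le _ _).trans ((add_le_add b1 b2).trans (le_of_eq ?_))
  rw [b1']
  simp only [Finset.sum_add_distrib, Finset.sum_const, Finset.card_univ, Fintype.card_fin,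
      nsmul_eq_mul, add_mul]
  ring

theorem antitone_snoc {n : ℕ} {β : Fin n → ℝ} (hβ : Antitone β) {γ : ℝ} (h : ∀ μ, γ ≤ β μ) :
    Antitone (Fin.snoc β γ : Fin (n + 1) → ℝ) := by
  intro i j hij
  induction i using Fin.lastCases with
  | last =>
    have : j = Fin.last n := le_antisymm (Fin.le_last j) hij
    simp [this]
  | cast i =>
    induction j using Fin.lastCases with
    | last => simpa using h i
    | cast j => simpa using hβ (by simpa using hij)

/-- Eigenvalue bounds obtained from `abs_inner_map_self_sub_le`. The hypothesis `h3` is a spectral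
gap: it keeps the comparison coefficients in decreasing order with the last one below the rest. -/
theorem eigenvalues_bounds_of_block (hT : T.IsSymmetric) {n : ℕ}
    (hd : Module.finrank ℝ E = n + 1)
    (b : OrthonormalBasis (Fin (n + 1)) ℝ E) {β : Fin n → ℝ} (hβ : Antitone β)
    {η ρ δ : ℝ} (hδ : 0 < δ)
    (h1 : ∀ μ ν : Fin n,
      |⟪b μ.castSucc, T (b ν.castSucc)⟫_ℝ - if μ = ν then β μ else 0| ≤ η)
    (h2 : ∀ μ : Fin n, |⟪b μ.castSucc, T (b (Fin.last n))⟫_ℝ| ≤ ρ)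
    (h3 : ∀ μ, ⟪b (Fin.last n), T (b (Fin.last n))⟫_ℝ + n * ρ ^ 2 / δ ≤ β μ - (n * η + δ)) :
    (∀ μ : Fin n, |hT.eigenvalues hd μ.castSucc - β μ| ≤ n * η + δ) ∧
    |hT.eigenvalues hd (Fin.last n) - ⟪b (Fin.last n), T (b (Fin.last n))⟫_ℝ| ≤
      n * ρ ^ 2 / δ := by
  set γ := ⟪b (Fin.last n), T (b (Fin.last n))⟫_ℝ
  have hq := abs_inner_map_self_sub_le hT b hδ h1 h2
  have hr : 0 ≤ n * ρ ^ 2 / δ := by positivity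
  have up := eigenvalues_le_of_inner_le hT hd b
    (c := Fin.snoc (fun μ => β μ + (n * η + δ)) (γ + n * ρ ^ 2 / δ))
    (antitone_snoc (fun i j hij => by simpa using hβ hij) (fun μ => by
      have hη : 0 ≤ η := (abs_nonneg _).trans (h1 μ μ)
      have : 0 ≤ n * η := by positivity
      linarith [h3 μ])) (fun x => by
        have := (abs_le.1 (hq x)).2
        simp only [Fin.sum_univ_castSucc, Fin.snoc_castSucc, Fin.snoc_last, add_mul,
          Finset.sum_add_distrib] at this ⊢
        linarith)
  have lo := le_eigenvalues_of_le_inner hT hd b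
    (c := Fin.snoc (fun μ => β μ - (n * η + δ)) (γ - n * ρ ^ 2 / δ))
    (antitone_snoc (fun i j hij => by simpa using hβ hij) (fun μ => by linarith [h3 μ]))
      (fun x => by
        have := (abs_le.1 (hq x)).1
        simp only [Fin.sum_univ_castSucc, Fin.snoc_castSucc, Fin.snoc_last, add_mul, sub_mul,
          Finset.sum_add_distrib, Finset.sum_sub_distrib] at this ⊢
        linarith)
  refine ⟨fun μ => abs_le.2 ⟨?_, ?_⟩, abs_le.2 ⟨?_, ?_⟩⟩
  · have := lo μ.castSucc
    simp only [Fin.snoc_castSucc] at this; linarith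
  · have := up μ.castSucc
    simp only [Fin.snoc_castSucc] at this; linarith
  · have := lo (Fin.last n)
    simp only [Fin.snoc_last] at this; linarith
  · have := up (Fin.last n)
    simp only [Fin.snoc_last] at this; linarith

/-- Asymptotics of the eigenvalues of symmetric operators whose first block is
`a ε ^ (n + 2) + d ε ^ (n + 4)` up to `o(ε ^ (n + 4))`, whose last diagonal entry is of order
`ε ^ (n + 4)`, and whose coupling is `o(ε ^ (n + 3))`. The weight `δ` of the coupling is chosen of
order `ε ^ (n + 4)` for the large eigenvalues and of order `ε ^ (n + 2)` for the smallest one. -/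
theorem tendsto_eigenvalues_of_block {n : ℕ} {T : ℝ → E →ₗ[ℝ] E} (hT : ∀ ε, (T ε).IsSymmetric)
    (hd : Module.finrank ℝ E = n + 1) (b : OrthonormalBasis (Fin (n + 1)) ℝ E)
    {a c : ℝ} (ha : 0 < a) {d : Fin n → ℝ} (hda : Antitone d)
    (h1 : ∀ μ ν : Fin n, Tendsto (fun ε => (⟪b μ.castSucc, T ε (b ν.castSucc)⟫_ℝ
      - if μ = ν then a * ε ^ (n + 2) else 0) / ε ^ (n + 4)) (𝓝[>] 0)
      (𝓝 (if μ = ν then d μ else 0)))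
    (h2 : ∀ μ : Fin n, Tendsto (fun ε => ⟪b μ.castSucc, T ε (b (Fin.last n))⟫_ℝ / ε ^ (n + 3))
      (𝓝[>] 0) (𝓝 0))
    (h3 : Tendsto (fun ε => ⟪b (Fin.last n), T ε (b (Fin.last n))⟫_ℝ / ε ^ (n + 4))
      (𝓝[>] 0) (𝓝 c)) :
    (∀ μ : Fin n, Tendsto (fun ε => ((hT ε).eigenvalues hd μ.castSucc - a * ε ^ (n + 2))
      / ε ^ (n + 4)) (𝓝[>] 0) (𝓝 (d μ))) ∧
    Tendsto (fun ε => (hT ε).eigenvalues hd (Fin.last n) / ε ^ (n + 4)) (𝓝[>] 0) (𝓝 c) := by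
  have hpos : ∀ᶠ ε : ℝ in 𝓝[>] 0, 0 < ε := eventually_mem_nhdsWithin
  have H1 : ∀ η > 0, ∀ᶠ ε in 𝓝[>] 0, ∀ μ ν : Fin n,
      |⟪b μ.castSucc, T ε (b ν.castSucc)⟫_ℝ
        - if μ = ν then a * ε ^ (n + 2) + d μ * ε ^ (n + 4) else 0| ≤ η * ε ^ (n + 4) := by
    intro η hη
    rw [eventually_all]; intro μ
    rw [eventually_all]; intro ν
    filter_upwards [(Metric.tendsto_nhds.1 (h1 μ ν)) η hη, hpos] with ε h hε
    rw [Real.dist_eq] at h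
    have hp : 0 < ε ^ (n + 4) := by positivity
    rw [← div_le_iff₀ hp]
    conv_lhs => rhs; rw [← abs_of_pos hp]
    rw [← abs_div]
    refine le_trans (le_of_eq ?_) h.le
    congr 1
    split_ifs <;> field_simp <;> ring
  have H2 : ∀ η > 0, ∀ᶠ ε in 𝓝[>] 0, ∀ μ : Fin n,
      |⟪b μ.castSucc, T ε (b (Fin.last n))⟫_ℝ| ≤ η * ε ^ (n + 3) := by
    intro η hη
    rw [eventually_all]; intro μ
    filter_upwards [(Metric.tendsto_nhds.1 (h2 μ)) η hη, hpos] with ε h hε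
    rw [Real.dist_eq, sub_zero, abs_div, abs_of_pos (by positivity : 0 < ε ^ (n + 3)),
      div_lt_iff₀ (by positivity)] at h
    exact h.le
  have H3 : ∀ᶠ ε in 𝓝[>] 0,
      ⟪b (Fin.last n), T ε (b (Fin.last n))⟫_ℝ ≤ (c + 1) * ε ^ (n + 4) := by
    filter_upwards [h3.eventually_lt_const (lt_add_one c), hpos] with ε h hε
    rw [div_lt_iff₀ (by positivity)] at h
    exact h.le
  have small : ∀ K u : ℝ, 0 < u → ∀ᶠ ε : ℝ in 𝓝[>] 0, K * ε ^ 2 ≤ u := by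
    intro K u hu
    have : Tendsto (fun ε : ℝ => K * ε ^ 2) (𝓝[>] 0) (𝓝 0) := by
      refine tendsto_nhdsWithin_of_tendsto_nhds ?_
      have : ContinuousAt (fun ε : ℝ => K * ε ^ 2) 0 := by fun_prop
      simpa [ContinuousAt] using this
    filter_upwards [this.eventually_lt_const hu] with ε h using h.le
  have hanti : ∀ ε : ℝ, 0 < ε → Antitone fun μ => a * ε ^ (n + 2) + d μ * ε ^ (n + 4) := by
    intro ε hε i j hij
    have := mul_le_mul_of_nonneg_right (hda hij) (by positivity : 0 ≤ ε ^ (n + 4))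
    simpa using this
  constructor
  · intro μ
    rw [Metric.tendsto_nhds]
    intro r hr
    -- with `δ = η ε ^ (n + 4)` the error `(n + 1) η ε ^ (n + 4)` stays below `r ε ^ (n + 4)`, and
    -- the last coefficient is at most `n η ε ^ (n + 2) + O(ε ^ (n + 4))`, so the gap persists
    obtain ⟨η, hη, hη1, hη2⟩ : ∃ η > 0, (n + 1 : ℝ) * η < r ∧ (n : ℝ) * η < a / 2 := by
      refine ⟨min (r / (n + 2)) (a / 2 / (n + 1)), by positivity, ?_, ?_⟩
      · have : min (r / (n + 2)) (a / 2 / (n + 1)) ≤ r / (n + 2) := min_le_left _ _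
        rw [le_div_iff₀ (by positivity)] at this
        have h0 : 0 < min (r / (n + 2)) (a / 2 / (n + 1)) := by positivity
        nlinarith
      · have : min (r / (n + 2)) (a / 2 / (n + 1)) ≤ a / 2 / (n + 1) := min_le_right _ _
        rw [le_div_iff₀ (by positivity)] at this
        have h0 : 0 < min (r / (n + 2)) (a / 2 / (n + 1)) := by positivity
        nlinarith
    have hs : ∀ᶠ ε : ℝ in 𝓝[>] 0, ∀ μ, (c + 1 - d μ + (n + 1) * η) * ε ^ 2 ≤ a / 2 := by
      rw [eventually_all]; exact fun μ => small _ _ (by positivity)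
    filter_upwards [H1 η hη, H2 η hη, H3, hpos, hs] with ε g1 g2 g3 hε gs
    have hp : 0 < ε ^ (n + 4) := by positivity
    have hp2 : 0 < ε ^ (n + 2) := by positivity
    have := (eigenvalues_bounds_of_block (hT ε) hd b (hanti ε hε)
      (δ := η * ε ^ (n + 4)) (by positivity) g1 g2 (fun ν => by
        have e : n * (η * ε ^ (n + 3)) ^ 2 / (η * ε ^ (n + 4)) = n * η * ε ^ (n + 2) := by
          field_simp; ring
        rw [e]
        have := mul_le_mul_of_nonneg_right (gs ν) hp2.le
        have := mul_lt_mul_of_pos_right hη2 hp2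
        have : ε ^ (n + 4) = ε ^ 2 * ε ^ (n + 2) := by ring
        rw [this] at g3 ⊢
        nlinarith)).1 μ
    rw [Real.dist_eq]
    have e : ((hT ε).eigenvalues hd μ.castSucc - a * ε ^ (n + 2)) / ε ^ (n + 4) - d μ
        = ((hT ε).eigenvalues hd μ.castSucc - (a * ε ^ (n + 2) + d μ * ε ^ (n + 4)))
          / ε ^ (n + 4) := by field_simp; ring
    rw [e, abs_div, abs_of_pos hp, div_lt_iff₀ hp]
    refine this.trans_lt ?_
    have := mul_lt_mul_of_pos_right hη1 hp
    linarith
  · have hlast : Tendsto (fun ε => ((hT ε).eigenvalues hd (Fin.last n)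
        - ⟪b (Fin.last n), T ε (b (Fin.last n))⟫_ℝ) / ε ^ (n + 4)) (𝓝[>] 0) (𝓝 0) := by
      rw [Metric.tendsto_nhds]
      intro r hr
      -- with `δ = (a / 2) ε ^ (n + 2)` the smallest eigenvalue moves by at most
      -- `2 n η ^ 2 / a * ε ^ (n + 4)`
      obtain ⟨η, hη, hη1, hη2⟩ : ∃ η > 0, 2 * n * η ^ 2 / a < r ∧ 2 * n * η ^ 2 / a ≤ 1 := by
        have : Tendsto (fun η : ℝ => 2 * n * η ^ 2 / a) (𝓝[>] 0) (𝓝 0) := by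
          refine tendsto_nhdsWithin_of_tendsto_nhds ?_
          have : ContinuousAt (fun η : ℝ => 2 * n * η ^ 2 / a) 0 := by fun_prop
          simpa [ContinuousAt] using this
        obtain ⟨η, h1, h2, h3⟩ := ((this.eventually_lt_const hr).and
          ((this.eventually_lt_const one_pos).and hpos)).exists
        exact ⟨η, h3, h1, h2.le⟩
      have hs : ∀ᶠ ε : ℝ in 𝓝[>] 0, ∀ μ, (c + 1 - d μ + n * η + 1) * ε ^ 2 ≤ a / 2 := by
        rw [eventually_all]; exact fun μ => small _ _ (by positivity)
      filter_upwards [H1 η hη, H2 η hη, H3, hpos, hs] with ε g1 g2 g3 hε gs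
      have hp : 0 < ε ^ (n + 4) := by positivity
      have hp2 : 0 < ε ^ (n + 2) := by positivity
      have e : n * (η * ε ^ (n + 3)) ^ 2 / (a / 2 * ε ^ (n + 2))
          = 2 * n * η ^ 2 / a * ε ^ (n + 4) := by
        field_simp; ring
      have := (eigenvalues_bounds_of_block (hT ε) hd b (hanti ε hε)
        (δ := a / 2 * ε ^ (n + 2)) (by positivity) g1 g2 (fun ν => by
          rw [e]
          have k1 := mul_le_mul_of_nonneg_right (gs ν) hp2.le
          have k2 := mul_le_mul_of_nonneg_right hη2 hp.le
          have e4 : ε ^ (n + 4) = ε ^ 2 * ε ^ (n + 2) := by ring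
          rw [e4] at g3 k2 ⊢
          linarith)).2
      rw [e] at this
      rw [Real.dist_eq, sub_zero, abs_div, abs_of_pos hp, div_lt_iff₀ hp]
      exact this.trans_lt (mul_lt_mul_of_pos_right hη1 hp)
    refine (hlast.add h3).congr' ?_ |>.trans (by simp)
    filter_upwards with ε
    ring

end Eigenvalues

/-! ### The Gauss equation at the base point -/

section Curvature

variable {n : ℕ} {N : Euc (n + 1) → Euc (n + 1)} {p : Euc (n + 1)}

theorem fderiv_tangentialPart {q : Euc (n + 1)} (hN : DifferentiableAt ℝ N q)
    (z w : Euc (n + 1)) :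
    fderiv ℝ (fun q => tangentialPart N q z) q w =
      -(⟪fderiv ℝ N q w, z⟫_ℝ • N q + ⟪N q, z⟫_ℝ • fderiv ℝ N q w) := by
  have h1 : HasFDerivAt (fun q => ⟪N q, z⟫_ℝ) ((innerSL ℝ z).comp (fderiv ℝ N q)) q := by
    have := (innerSL ℝ z).hasFDerivAt.comp q hN.hasFDerivAt
    refine this.congr_of_eventuallyEq (Eventually.of_forall fun x => ?_)
    simp [real_inner_comm]
  have h2 := (h1.smul hN.hasFDerivAt).const_sub z
  have : (fun q => tangentialPart N q z) = fun q => z - ((fun q => ⟪N q, z⟫_ℝ) • N) q := rfl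
  rw [this, h2.fderiv]
  simp [real_inner_comm, add_comm]

/-- The covariant derivative of a field `q ↦ tangentialPart N q z`. The factor `1 - ‖N q‖ ^ 2`
vanishes on the hypersurface but not off it. -/
theorem covDeriv_tangentialPart {q : Euc (n + 1)} (hN : DifferentiableAt ℝ N q)
    (Y : Euc (n + 1) → Euc (n + 1)) (z : Euc (n + 1)) :
    covDeriv N Y (fun q => tangentialPart N q z) q =
      -((⟪fderiv ℝ N q (Y q), z⟫_ℝ * (1 - ‖N q‖ ^ 2)) • N q
        + ⟪N q, z⟫_ℝ • (fderiv ℝ N q (Y q) - ⟪N q, fderiv ℝ N q (Y q)⟫_ℝ • N q)) := by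
  rw [covDeriv, fderiv_tangentialPart hN, tangentialPart]
  simp only [inner_neg_right, inner_add_right, real_inner_smul_right, real_inner_self_eq_norm_sq]
  module

/-- The second covariant derivative of a tangential field at a point where the normal field has
unit length to first order in the direction `x`. -/
theorem covDeriv_covDeriv_tangentialPart (hN : ContDiffAt ℝ ∞ N p) (hunit : ‖N p‖ = 1)
    {x y z : Euc (n + 1)} (hx : ⟪N p, x⟫_ℝ = 0) (hy : ⟪N p, y⟫_ℝ = 0) (hz : ⟪N p, z⟫_ℝ = 0)
    (hAx : ⟪N p, fderiv ℝ N p x⟫_ℝ = 0) (hAy : ⟪N p, fderiv ℝ N p y⟫_ℝ = 0) :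
    covDeriv N (fun q => tangentialPart N q x)
      (covDeriv N (fun q => tangentialPart N q y) (fun q => tangentialPart N q z)) p =
      -(⟪fderiv ℝ N p x, z⟫_ℝ • fderiv ℝ N p y) := by
  have hd : ∀ᶠ q in 𝓝 p, DifferentiableAt ℝ N q := by
    have : ∀ᶠ q in 𝓝 p, ContDiffAt ℝ 1 N q :=
      (hN.of_le (by exact_mod_cast le_top)).eventually (by simp)
    filter_upwards [this] with q hq using hq.differentiableAt (by simp)
  have hNp := hd.self_of_nhds
  have hDN : DifferentiableAt ℝ (fderiv ℝ N) p :=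
    (hN.fderiv_right (m := 1) (by
      rw [one_add_one_eq_two]; exact WithTop.coe_le_coe.2 (le_top : (2 : ℕ∞) ≤ ⊤))).differentiableAt
      (by simp)
  have htp : tangentialPart N p x = x := by simp [tangentialPart, hx]
  have htp' : tangentialPart N p y = y := by simp [tangentialPart, hy]
  set Y : Euc (n + 1) → Euc (n + 1) := fun q => tangentialPart N q y with hY
  have hev : covDeriv N Y (fun q => tangentialPart N q z) =ᶠ[𝓝 p] fun q =>
      -((⟪fderiv ℝ N q (Y q), z⟫_ℝ * (1 - ‖N q‖ ^ 2)) • N q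
        + ⟪N q, z⟫_ℝ • (fderiv ℝ N q (Y q) - ⟪N q, fderiv ℝ N q (Y q)⟫_ℝ • N q)) := by
    filter_upwards [hd] with q hq using covDeriv_tangentialPart hq Y z
  have hYp : Y p = y := htp'
  have hYd : DifferentiableAt ℝ Y p := by
    simp only [hY, tangentialPart]
    exact (differentiableAt_const _).sub ((hNp.inner ℝ (differentiableAt_const _)).smul hNp)
  have hL : DifferentiableAt ℝ (fun q => fderiv ℝ N q (Y q)) p := hDN.clm_apply hYd
  -- both summands are products of two factors, one of which vanishes at `p`
  have hf : HasFDerivAt (fun q => ⟪fderiv ℝ N q (Y q), z⟫_ℝ * (1 - ‖N q‖ ^ 2))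
      (⟪fderiv ℝ N p y, z⟫_ℝ •
        (-((2 : ℕ) • (innerSL ℝ (N p)).comp (fderiv ℝ N p)) : Euc (n + 1) →L[ℝ] ℝ)) p := by
    have h1 := (hL.inner ℝ (differentiableAt_const z)).hasFDerivAt
    have h2 := (hNp.hasFDerivAt.norm_sq).const_sub 1
    refine (h1.mul h2).congr_fderiv ?_
    simp [hunit, hY, htp']
  have hg : HasFDerivAt (fun q => ⟪N q, z⟫_ℝ) ((innerSL ℝ z).comp (fderiv ℝ N p)) p := by
    have := (innerSL ℝ z).hasFDerivAt.comp p hNp.hasFDerivAt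
    refine this.congr_of_eventuallyEq (Eventually.of_forall fun x => ?_)
    simp [real_inner_comm]
  have hk : DifferentiableAt ℝ
      (fun q => fderiv ℝ N q (Y q) - ⟪N q, fderiv ℝ N q (Y q)⟫_ℝ • N q) p :=
    hL.sub ((hNp.inner ℝ hL).smul hNp)
  have htot := ((hf.smul hNp.hasFDerivAt).add (hg.smul hk.hasFDerivAt)).neg
  have hc := HasFDerivAt.congr_of_eventuallyEq htot hev
  rw [covDeriv, hc.fderiv, htp]
  simp [hunit, hz, hAx, hYp, hAy, tangentialPart, real_inner_comm z, inner_smul_right]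

/-- The Gauss equation `R(x, y) z = ⟨S y, z⟩ S x - ⟨S x, z⟩ S y` with `S = -fderiv ℝ N p`. The term
with the Lie bracket vanishes: the covariant derivatives of `q ↦ tangentialPart N q z` at `p` are
zero for tangent `z`. -/
theorem riemann_eq (hN : ContDiffAt ℝ ∞ N p) (hunit : ‖N p‖ = 1)
    {x y z : Euc (n + 1)} (hx : ⟪N p, x⟫_ℝ = 0) (hy : ⟪N p, y⟫_ℝ = 0) (hz : ⟪N p, z⟫_ℝ = 0)
    (hAx : ⟪N p, fderiv ℝ N p x⟫_ℝ = 0) (hAy : ⟪N p, fderiv ℝ N p y⟫_ℝ = 0) :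
    riemann N p x y z =
      ⟪fderiv ℝ N p y, z⟫_ℝ • fderiv ℝ N p x - ⟪fderiv ℝ N p x, z⟫_ℝ • fderiv ℝ N p y := by
  rw [riemann, riemannField, covDeriv_covDeriv_tangentialPart hN hunit hx hy hz hAx hAy,
    covDeriv_covDeriv_tangentialPart hN hunit hy hx hz hAy hAx,
    covDeriv_tangentialPart (hN.differentiableAt (by simp))]
  simp only [hunit, hz]
  module

/-- The scalar curvature is `H ^ 2 - ∑ κ ^ 2`. -/
theorem scalarCurvature_eq (hN : ContDiffAt ℝ ∞ N p) (hunit : ‖N p‖ = 1)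
    {e : Fin n → Euc (n + 1)} {κ : Fin n → ℝ} (he : Orthonormal ℝ e)
    (hNe : ∀ μ, ⟪N p, e μ⟫_ℝ = 0) (hκ : ∀ μ, fderiv ℝ N p (e μ) = -(κ μ • e μ)) :
    scalarCurvature N p e = meanCurvature κ ^ 2 - ∑ μ, κ μ ^ 2 := by
  have hAe : ∀ μ, ⟪N p, fderiv ℝ N p (e μ)⟫_ℝ = 0 := fun μ => by
    rw [hκ, inner_neg_right, real_inner_smul_right, hNe]; simp
  have hee : ∀ μ ν, ⟪e μ, e ν⟫_ℝ = if μ = ν then 1 else 0 := orthonormal_iff_ite.1 he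
  have : ∀ μ ν, ⟪riemann N p (e μ) (e ν) (e ν), e μ⟫_ℝ
      = κ μ * κ ν - if μ = ν then κ μ ^ 2 else 0 := by
    intro μ ν
    rw [riemann_eq hN hunit (hNe μ) (hNe ν) (hNe ν) (hAe μ) (hAe ν)]
    simp only [hκ, inner_sub_left, real_inner_smul_left, inner_neg_left, hee, smul_neg]
    by_cases h : μ = ν
    · subst h; simp; ring
    · simp [h, mul_comm]
  simp only [scalarCurvature, ricci, this, meanCurvature, Finset.sum_sub_distrib,
    Finset.sum_ite_eq', Finset.mem_univ, if_true, pow_two, Finset.sum_mul_sum]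
  simp [mul_comm]

end Curvature

/-! ### Graphs over a hyperplane -/

section Graph

variable {n : ℕ} (b : OrthonormalBasis (Fin (n + 1)) ℝ (Euc (n + 1)))

/-- The isometric inclusion of `ℝⁿ` spanned by the first `n` vectors of an orthonormal basis. -/
noncomputable def hyperIncl : Euc n →L[ℝ] Euc (n + 1) :=
  ∑ i : Fin n, (EuclideanSpace.proj i : Euc n →L[ℝ] ℝ).smulRight (b i.castSucc)

/-- The first `n` coordinates in an orthonormal basis. -/
noncomputable def hyperProj : Euc (n + 1) →L[ℝ] Euc n :=
  (EuclideanSpace.equiv (Fin n) ℝ).symm.toContinuousLinearMap.comp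
    (ContinuousLinearMap.pi fun i : Fin n => innerSL ℝ (b i.castSucc))

theorem hyperIncl_apply (x : Euc n) : hyperIncl b x = ∑ i : Fin n, x i • b i.castSucc := by
  simp [hyperIncl]

@[simp] theorem hyperProj_apply (X : Euc (n + 1)) (i : Fin n) :
    hyperProj b X i = ⟪b i.castSucc, X⟫_ℝ := rfl

theorem inner_basis (i j : Fin (n + 1)) : ⟪b i, b j⟫_ℝ = if i = j then 1 else 0 :=
  orthonormal_iff_ite.1 b.orthonormal i j

@[simp] theorem inner_castSucc_hyperIncl (i : Fin n) (x : Euc n) :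
    ⟪b i.castSucc, hyperIncl b x⟫_ℝ = x i := by
  simp [hyperIncl_apply, inner_sum, real_inner_smul_right, inner_basis]

@[simp] theorem inner_last_hyperIncl (x : Euc n) : ⟪b (Fin.last n), hyperIncl b x⟫_ℝ = 0 := by
  simp [hyperIncl_apply, inner_sum, real_inner_smul_right, (Fin.castSucc_lt_last _).ne']

theorem hyperProj_hyperIncl (x : Euc n) : hyperProj b (hyperIncl b x) = x := by
  ext i; simp

theorem hyperProj_last : hyperProj b (b (Fin.last n)) = 0 := by
  ext i; simp [(Fin.castSucc_lt_last i).ne]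

theorem hyperIncl_hyperProj_add (X : Euc (n + 1)) :
    hyperIncl b (hyperProj b X) + ⟪b (Fin.last n), X⟫_ℝ • b (Fin.last n) = X := by
  conv_rhs => rw [← b.sum_repr' X, Fin.sum_univ_castSucc]
  simp [hyperIncl_apply]

theorem inner_hyperIncl (x : Euc n) (X : Euc (n + 1)) :
    ⟪hyperIncl b x, X⟫_ℝ = ⟪x, hyperProj b X⟫_ℝ := by
  rw [hyperIncl_apply, sum_inner, PiLp.inner_apply]
  exact Finset.sum_congr rfl fun i _ => by
    rw [real_inner_smul_left, hyperProj_apply]; simp [mul_comm]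

theorem inner_graph_vectors (x y : Euc n) (s t : ℝ) :
    ⟪hyperIncl b x + s • b (Fin.last n), hyperIncl b y + t • b (Fin.last n)⟫_ℝ
      = ⟪x, y⟫_ℝ + s * t := by
  have h : ∀ z, ⟪hyperIncl b z, b (Fin.last n)⟫_ℝ = 0 := fun z => by
    rw [real_inner_comm, inner_last_hyperIncl]
  simp only [inner_add_left, inner_add_right, real_inner_smul_left, real_inner_smul_right,
    inner_last_hyperIncl, h, inner_hyperIncl, hyperProj_hyperIncl, inner_basis]
  simp [mul_comm]

/-- The graph of `h` over the hyperplane through `p` spanned by the first `n` basis vectors. -/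
noncomputable def graphMap (p : Euc (n + 1)) (h : Euc n → ℝ) (x : Euc n) : Euc (n + 1) :=
  p + hyperIncl b x + h x • b (Fin.last n)

variable {p : Euc (n + 1)} {h : Euc n → ℝ} {U : Set (Euc n)}

theorem graphMap_sub (x : Euc n) :
    graphMap b p h x - p = hyperIncl b x + h x • b (Fin.last n) := by
  simp [graphMap, add_assoc]

theorem norm_graphMap_sub_sq (x : Euc n) : ‖graphMap b p h x - p‖ ^ 2 = ‖x‖ ^ 2 + h x ^ 2 := by
  rw [← real_inner_self_eq_norm_sq, graphMap_sub, inner_graph_vectors,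
    real_inner_self_eq_norm_sq, pow_two (h x)]

theorem hyperProj_graphMap_sub (x : Euc n) : hyperProj b (graphMap b p h x - p) = x := by
  rw [graphMap_sub, map_add, map_smul, hyperProj_hyperIncl, hyperProj_last]; simp

theorem hasFDerivAt_graphMap {x : Euc n} (hx : DifferentiableAt ℝ h x) :
    HasFDerivAt (graphMap b p h) (hyperIncl b + (fderiv ℝ h x).smulRight (b (Fin.last n))) x :=
  ((hyperIncl b).hasFDerivAt.const_add p).add
    (hx.hasFDerivAt.smul_const (b (Fin.last n)))

theorem contDiffOn_graphMap (hh : ContDiffOn ℝ ∞ h U) : ContDiffOn ℝ ∞ (graphMap b p h) U :=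
  (contDiffOn_const.add (hyperIncl b).contDiff.contDiffOn).add (hh.smul contDiffOn_const)

theorem isLocalParametrization_graphMap {S W : Set (Euc (n + 1))} (hU : IsOpen U)
    (hh : ContDiffOn ℝ ∞ h U) (hW : IsOpen W) (hSW : graphMap b p h '' U = S ∩ W) :
    IsLocalParametrization S U (graphMap b p h) := by
  refine ⟨hU, contDiffOn_graphMap b hh, fun x hx => ?_, ?_, W, hW, hSW⟩
  · have hd : DifferentiableAt ℝ h x :=
      (hh.contDiffAt (hU.mem_nhds hx)).differentiableAt (by simp)
    rw [(hasFDerivAt_graphMap b hd).fderiv]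
    refine Function.LeftInverse.injective (g := hyperProj b) fun v => ?_
    simp [hyperProj_hyperIncl, hyperProj_last]
  · refine IsEmbedding.of_comp (contDiffOn_graphMap b hh).continuousOn.domRestrict
      (g := fun X => hyperProj b (X - p)) (by fun_prop) ?_
    have : (fun X => hyperProj b (X - p)) ∘ U.domRestrict (graphMap b p h) = Subtype.val := by
      ext1 x; exact hyperProj_graphMap_sub b _
    rw [this]; exact IsEmbedding.subtypeVal

/-- The implicit function theorem: if the differential of `F` at `p` is nonzero and its kernel is
spanned by the first `n` basis vectors, then the zero set of `F` near `p` is the graph of a smooth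
function. -/
theorem exists_graphMap_image_eq {F : Euc (n + 1) → ℝ} {W : Set (Euc (n + 1))} (hW : IsOpen W)
    (hpW : p ∈ W) (hF : ContDiffOn ℝ ∞ F W) (hFp : F p = 0)
    (htan : ∀ x, fderiv ℝ F p (hyperIncl b x) = 0) (hne : fderiv ℝ F p ≠ 0) :
    ∃ (U : Set (Euc n)) (W' : Set (Euc (n + 1))) (h : Euc n → ℝ), IsOpen U ∧ 0 ∈ U ∧
      IsOpen W' ∧ p ∈ W' ∧ W' ⊆ W ∧ ContDiffOn ℝ ∞ h U ∧ h 0 = 0 ∧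
      graphMap b p h '' U = {X ∈ W' | F X = 0} := by
  set ν := b (Fin.last n) with hν
  have hFd : ∀ X ∈ W, DifferentiableAt ℝ F X := fun X hX =>
    (hF.contDiffAt (hW.mem_nhds hX)).differentiableAt (by simp)
  have hpν : fderiv ℝ F p ν ≠ 0 := by
    intro h0
    refine hne (ContinuousLinearMap.ext fun v => ?_)
    rw [← hyperIncl_hyperProj_add b v, map_add, htan, map_smul, ← hν, h0]; simp
  -- the chart `X ↦ (tangential coordinates of X - p, F X)`
  set Φ : Euc (n + 1) → Euc n × ℝ := fun X => (hyperProj b (X - p), F X) with hΦ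
  have hΦc : ContDiffOn ℝ ∞ Φ W :=
    ((hyperProj b).contDiff.comp (contDiff_id.sub contDiff_const)).contDiffOn.prodMk hF
  have hΦd : ∀ X ∈ W, HasFDerivAt Φ ((hyperProj b).prod (fderiv ℝ F X)) X := fun X hX =>
    ((hyperProj b).hasFDerivAt.comp X ((hasFDerivAt_id X).sub_const p)).prodMk
      (hFd X hX).hasFDerivAt
  have hequiv : ∀ X ∈ W, fderiv ℝ F X ν ≠ 0 →
      ∃ L : Euc (n + 1) ≃L[ℝ] Euc n × ℝ, HasFDerivAt Φ (L : Euc (n + 1) →L[ℝ] Euc n × ℝ) X := by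
    intro X hX hXν
    have hinj : Function.Injective ((hyperProj b).prod (fderiv ℝ F X)).toLinearMap := by
      rw [← LinearMap.ker_eq_bot, LinearMap.ker_eq_bot']
      intro v hv
      have h1 : hyperProj b v = 0 := congrArg Prod.fst hv
      have h2 : fderiv ℝ F X v = 0 := congrArg Prod.snd hv
      have h3 := hyperIncl_hyperProj_add b v
      rw [h1, map_zero, zero_add] at h3
      rw [← h3, map_smul, smul_eq_mul, mul_eq_zero] at h2
      rw [← h3, h2.resolve_right hXν, zero_smul]
    let L := (LinearEquiv.ofInjectiveOfFinrankEq ((hyperProj b).prod (fderiv ℝ F X)).toLinearMap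
      hinj (by simp)).toContinuousLinearEquiv
    refine ⟨L, ?_⟩
    have : (L : Euc (n + 1) →L[ℝ] Euc n × ℝ) = (hyperProj b).prod (fderiv ℝ F X) := by
      ext1 v; rfl
    rw [this]; exact hΦd X hX
  obtain ⟨L, hL⟩ := hequiv p hpW hpν
  have hΦp : ContDiffAt ℝ ∞ Φ p := hΦc.contDiffAt (hW.mem_nhds hpW)
  set Ψ₀ := hΦp.toOpenPartialHomeomorph Φ hL (by simp)
  have hdF : ContinuousOn (fun X => fderiv ℝ F X ν) W :=
    (hF.continuousOn_fderiv_of_isOpen hW (by simp)).clm_apply continuousOn_const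
  -- restricting to `O` makes the inverse smooth on the whole target, not only at `Φ p`
  set O := W ∩ (fun X => fderiv ℝ F X ν) ⁻¹' {0}ᶜ
  have hO : IsOpen O := hdF.isOpen_inter_preimage hW isOpen_compl_singleton
  set Ψ := Ψ₀.restrOpen O hO
  have hΨ : ∀ X, Ψ X = Φ X := fun X => rfl
  have hsrc : Ψ.source ⊆ O := fun X hX => by
    rw [OpenPartialHomeomorph.restrOpen_source] at hX; exact hX.2
  have hpsrc : p ∈ Ψ.source := by
    rw [OpenPartialHomeomorph.restrOpen_source]
    exact ⟨hΦp.mem_toOpenPartialHomeomorph_source hL (by simp), hpW, hpν⟩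
  have hΦp0 : Φ p = (0, 0) := by simp [hΦ, hFp]
  have hsymm0 : Ψ.symm (0, 0) = p := by
    rw [← hΦp0, ← hΨ]; exact Ψ.left_inv hpsrc
  have h0t : ((0 : Euc n), (0 : ℝ)) ∈ Ψ.target := by
    rw [← hΦp0, ← hΨ]; exact Ψ.map_source hpsrc
  set j : Euc n → Euc n × ℝ := fun x => (x, 0)
  have hj : Continuous j := by fun_prop
  set h : Euc n → ℝ := fun x => ⟪ν, Ψ.symm (j x) - p⟫_ℝ with hh
  have hcd : ∀ x ∈ j ⁻¹' Ψ.target, ContDiffAt ℝ ∞ Ψ.symm (j x) := by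
    intro x hx
    have hs := hsrc (Ψ.map_target hx)
    obtain ⟨L', hL'⟩ := hequiv _ hs.1 hs.2
    exact Ψ.contDiffAt_symm hx hL' (hΦc.contDiffAt (hW.mem_nhds hs.1))
  have hgr : ∀ x ∈ j ⁻¹' Ψ.target, graphMap b p h x = Ψ.symm (j x) := by
    intro x hx
    have h1 : Φ (Ψ.symm (j x)) = j x := Ψ.right_inv hx
    have h2 : hyperProj b (Ψ.symm (j x) - p) = x := congrArg Prod.fst h1
    have h3 := hyperIncl_hyperProj_add b (Ψ.symm (j x) - p)
    rw [h2] at h3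
    rw [← sub_left_inj (a := p), graphMap_sub]
    exact h3
  refine ⟨j ⁻¹' Ψ.target, Ψ.source, h, Ψ.open_target.preimage hj, h0t, Ψ.open_source, hpsrc,
    fun X hX => (hsrc hX).1, ?_, ?_, ?_⟩
  · intro x hx
    refine ContDiffAt.contDiffWithinAt ?_
    have : ContDiffAt ℝ ∞ (fun x => Ψ.symm (j x)) x :=
      (hcd x hx).comp x (contDiffAt_id.prodMk contDiffAt_const)
    exact contDiffAt_const.inner ℝ (this.sub contDiffAt_const)
  · simp only [hh, j, hsymm0]; simp
  · ext X
    constructor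
    · rintro ⟨x, hx, rfl⟩
      rw [hgr x hx]
      exact ⟨Ψ.map_target hx, congrArg Prod.snd (Ψ.right_inv hx : Φ (Ψ.symm (j x)) = j x)⟩
    · rintro ⟨hX, hFX⟩
      have h1 : j (hyperProj b (X - p)) = Ψ X := by
        rw [hΨ]; simp [hΦ, j, hFX]
      have h2 : hyperProj b (X - p) ∈ j ⁻¹' Ψ.target := by
        rw [mem_preimage, h1]; exact Ψ.map_source hX
      exact ⟨_, h2, by rw [hgr _ h2, h1, Ψ.left_inv hX]⟩

theorem fderiv_eq_zero_of_mem_tangentVectors {S W : Set (Euc (n + 1))} {F : Euc (n + 1) → ℝ}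
    (hW : W ∈ 𝓝 p) (hF : DifferentiableAt ℝ F p) (hS : ∀ q ∈ S ∩ W, F q = 0) {v : Euc (n + 1)}
    (hv : v ∈ tangentVectors S p) : fderiv ℝ F p v = 0 := by
  obtain ⟨γ, -, hγ0, hγS, hγ'⟩ := hv
  subst hγ0
  have h1 := hF.hasFDerivAt.comp_hasDerivAt 0 hγ'
  have h2 : F ∘ γ =ᶠ[𝓝 0] fun _ => 0 := by
    filter_upwards [hγS, hγ'.continuousAt hW] with t ht ht' using hS _ ⟨ht, ht'⟩
  exact (h1.congr_of_eventuallyEq h2.symm).unique (hasDerivAt_const _ _)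

/-- The partial derivatives of a graph parametrization are tangent vectors. -/
theorem graph_vector_mem_tangentVectors {S : Set (Euc (n + 1))} (hU : IsOpen U)
    (hh : ContDiffOn ℝ ∞ h U) (hS : ∀ x ∈ U, graphMap b p h x ∈ S) {x : Euc n} (hx : x ∈ U)
    (v : Euc n) :
    hyperIncl b v + fderiv ℝ h x v • b (Fin.last n) ∈ tangentVectors S (graphMap b p h x) := by
  have hl : HasDerivAt (fun t : ℝ => x + t • v) v 0 := by
    simpa using ((hasDerivAt_id (0 : ℝ)).smul_const v).const_add x
  have hlx : (fun t : ℝ => x + t • v) 0 = x := by simp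
  have hUx : U ∈ 𝓝 ((fun t : ℝ => x + t • v) 0) := by rw [hlx]; exact hU.mem_nhds hx
  refine ⟨fun t => graphMap b p h (x + t • v), ?_, by simp, ?_, ?_⟩
  · exact ContDiffAt.comp (g := graphMap b p h) (0 : ℝ)
      ((contDiffOn_graphMap b hh).contDiffAt hUx) (by fun_prop)
  · filter_upwards [hl.continuousAt hUx] with t ht using hS _ ht
  · have hd : DifferentiableAt ℝ h x :=
      (hh.contDiffAt (hU.mem_nhds hx)).differentiableAt (by simp)
    have := HasFDerivAt.comp_hasDerivAt_of_eq (0 : ℝ) (hasFDerivAt_graphMap b (p := p) hd) hl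
      hlx.symm
    exact this.congr_deriv (by simp)

/-- The second fundamental form of a graph that is horizontal at the origin is the Hessian. It is
obtained by differentiating `⟪N, ∂ᵥ(graphMap)⟫ = 0`. -/
theorem fderiv_graph_function {S : Set (Euc (n + 1))} {N : Euc (n + 1) → Euc (n + 1)}
    (hN : IsUnitNormalNear S p N) (hbN : b (Fin.last n) = N p) {κ : Fin n → ℝ}
    (hκ : ∀ i : Fin n, fderiv ℝ N p (b i.castSucc) = -(κ i • b i.castSucc))
    (hU : IsOpen U) (h0U : 0 ∈ U)
    (hh : ContDiffOn ℝ ∞ h U) (h0 : h 0 = 0) (hS : ∀ x ∈ U, graphMap b p h x ∈ S) :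
    fderiv ℝ h 0 = 0 ∧
      ∀ v, HasFDerivAt (fun x => fderiv ℝ h x v)
        (∑ i, (κ i * v i) • (EuclideanSpace.proj i : Euc n →L[ℝ] ℝ)) 0 := by
  obtain ⟨W, hW, hpW, hNW, hperp⟩ := hN
  have hg0 : graphMap b p h 0 = p := by simp [graphMap, h0]
  have hNd : DifferentiableAt ℝ N p := (hNW.contDiffAt (hW.mem_nhds hpW)).differentiableAt (by simp)
  have hh0 : ContDiffAt ℝ ∞ h 0 := hh.contDiffAt (hU.mem_nhds h0U)
  have hhd := hh0.differentiableAt (by simp)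
  have hgd := hasFDerivAt_graphMap b (p := p) hhd
  -- orthogonality of the normal to the tangent vectors of the graph
  have horth : ∀ v, ∀ᶠ x in 𝓝 (0 : Euc n), ⟪N (graphMap b p h x), hyperIncl b v⟫_ℝ
      + fderiv ℝ h x v * ⟪N (graphMap b p h x), b (Fin.last n)⟫_ℝ = 0 := by
    intro v
    have hc : ∀ᶠ x in 𝓝 (0 : Euc n), graphMap b p h x ∈ W :=
      hgd.continuousAt.eventually (by rw [hg0]; exact hW.mem_nhds hpW)
    filter_upwards [hc, hU.mem_nhds h0U] with x hxW hxU
    have := (hperp _ ⟨hS x hxU, hxW⟩).2 _ (graph_vector_mem_tangentVectors b hU hh hS hxU v)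
    rwa [inner_add_right, real_inner_smul_right] at this
  have hD0 : fderiv ℝ h 0 = 0 := by
    ext1 v
    have := (horth v).self_of_nhds
    rw [hg0, ← hbN] at this
    simpa using this
  refine ⟨hD0, fun v => ?_⟩
  rw [hD0] at hgd
  have hgd' : HasFDerivAt (graphMap b p h) (hyperIncl b) 0 := hgd.congr_fderiv (by ext1; simp)
  have hNg : HasFDerivAt (fun x => N (graphMap b p h x)) ((fderiv ℝ N p).comp (hyperIncl b)) 0 := by
    have : HasFDerivAt N (fderiv ℝ N p) (graphMap b p h 0) := by rw [hg0]; exact hNd.hasFDerivAt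
    exact this.comp 0 hgd'
  have hA : ∀ w, ⟪fderiv ℝ N p (hyperIncl b w), hyperIncl b v⟫_ℝ = -∑ i, κ i * v i * w i := by
    intro w
    simp only [hyperIncl_apply b w, map_sum, map_smul, hκ, sum_inner, inner_neg_left,
      smul_neg, real_inner_smul_left, inner_castSucc_hyperIncl, Finset.sum_neg_distrib]
    exact congrArg _ (Finset.sum_congr rfl fun i _ => by ring)
  have hden : HasFDerivAt (fun x => ⟪N (graphMap b p h x), b (Fin.last n)⟫_ℝ)
      ((innerSL ℝ (b (Fin.last n))).comp ((fderiv ℝ N p).comp (hyperIncl b))) 0 := by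
    have := (innerSL ℝ (b (Fin.last n))).hasFDerivAt.comp (0 : Euc n) hNg
    refine this.congr_of_eventuallyEq (Eventually.of_forall fun x => ?_)
    simp [real_inner_comm]
  have hnum : HasFDerivAt (fun x => ⟪N (graphMap b p h x), hyperIncl b v⟫_ℝ)
      ((innerSL ℝ (hyperIncl b v)).comp ((fderiv ℝ N p).comp (hyperIncl b))) 0 := by
    have := (innerSL ℝ (hyperIncl b v)).hasFDerivAt.comp (0 : Euc n) hNg
    refine this.congr_of_eventuallyEq (Eventually.of_forall fun x => ?_)
    simp [real_inner_comm]
  have hden0 : ⟪N (graphMap b p h 0), b (Fin.last n)⟫_ℝ = 1 := by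
    rw [hg0, ← hbN]; simp
  have hdd : DifferentiableAt ℝ (fun x => fderiv ℝ h x v) 0 := by
    have : DifferentiableAt ℝ (fderiv ℝ h) 0 :=
      (hh0.fderiv_right (m := 1) (by
        rw [one_add_one_eq_two]; exact WithTop.coe_le_coe.2
          (le_top : (2 : ℕ∞) ≤ ⊤))).differentiableAt (by simp)
    exact this.clm_apply (differentiableAt_const v)
  -- the derivative at `0` of the identity `horth v`
  have hsum := hnum.add (hdd.hasFDerivAt.mul hden)
  have hzero := (HasFDerivAt.congr_of_eventuallyEq (hasFDerivAt_const (0 : ℝ) (0 : Euc n))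
    (horth v)).unique hsum
  refine hdd.hasFDerivAt.congr_fderiv ?_
  ext1 w
  have := congrArg (fun L => L w) hzero
  simp only [hD0, hden0, _root_.add_apply, ContinuousLinearMap.comp_apply,
    innerSL_apply_apply, zero_smul, one_smul,
    _root_.zero_apply] at this
  rw [real_inner_comm, hA] at this
  simp only [_root_.sum_apply, _root_.smul_apply, smul_eq_mul,
    PiLp.proj_apply]
  linarith

/-- The metric of a graph is a rank one perturbation of the identity. -/
theorem metricMatrix_graphMap {x : Euc n} (hx : DifferentiableAt ℝ h x) :
    metricMatrix (graphMap b p h) x = 1 +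
      Matrix.replicateCol Unit (fun i => fderiv ℝ h x (EuclideanSpace.single i 1)) *
      Matrix.replicateRow Unit (fun i => fderiv ℝ h x (EuclideanSpace.single i 1)) := by
  ext i j
  rw [metricMatrix, Matrix.of_apply, (hasFDerivAt_graphMap b hx).fderiv]
  have := inner_graph_vectors b (EuclideanSpace.single i 1) (EuclideanSpace.single j 1)
    (fderiv ℝ h x (EuclideanSpace.single i 1)) (fderiv ℝ h x (EuclideanSpace.single j 1))
  simp only [_root_.add_apply, ContinuousLinearMap.smulRight_apply, this]
  simp [Matrix.mul_apply, Matrix.one_apply, EuclideanSpace.inner_single_left]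

theorem det_metricMatrix_graphMap {x : Euc n} (hx : DifferentiableAt ℝ h x) :
    (metricMatrix (graphMap b p h) x).det
      = 1 + ∑ i, fderiv ℝ h x (EuclideanSpace.single i 1) ^ 2 := by
  rw [metricMatrix_graphMap b hx, Matrix.det_one_add_replicateCol_mul_replicateRow]
  simp [dotProduct, pow_two]

end Graph

/-- The diagonal quadratic form with coefficients `κ`. -/
def diagForm {n : ℕ} (κ : Fin n → ℝ) (x : Euc n) : ℝ := ∑ i, κ i * x i ^ 2

section Taylor

variable {n : ℕ} {h : Euc n → ℝ} {κ : Fin n → ℝ}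

theorem hasFDerivAt_diagForm (κ : Fin n → ℝ) (x : Euc n) :
    HasFDerivAt (diagForm κ)
      (∑ i, (2 * κ i * x i) • (EuclideanSpace.proj i : Euc n →L[ℝ] ℝ)) x := by
  have : ∀ i ∈ Finset.univ, HasFDerivAt (fun x : Euc n => κ i * x i ^ 2)
      ((2 * κ i * x i) • (EuclideanSpace.proj i : Euc n →L[ℝ] ℝ)) x := fun i _ => by
    have := ((EuclideanSpace.proj i : Euc n →L[ℝ] ℝ).hasFDerivAt (x := x)).pow 2 |>.const_mul (κ i)
    refine this.congr_fderiv ?_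
    ext1 v
    simp; ring
  exact HasFDerivAt.fun_sum this

theorem fderiv_sub_isLittleO (h1 : fderiv ℝ h 0 = 0)
    (h2 : ∀ v, HasFDerivAt (fun x => fderiv ℝ h x v)
        (∑ i, (κ i * v i) • (EuclideanSpace.proj i : Euc n →L[ℝ] ℝ)) 0) (i : Fin n) :
    (fun x => fderiv ℝ h x (EuclideanSpace.single i 1) - κ i * x i) =o[𝓝 0] fun x : Euc n => x := by
  have := (h2 (EuclideanSpace.single i 1)).isLittleO
  simpa [h1, Finset.sum_apply, Pi.single_apply] using this

/-- Second order Taylor expansion of the height function. It needs the first derivative near the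
origin and the second one at the origin only. -/
theorem sub_diagForm_isLittleO (hd : ∀ᶠ x in 𝓝 0, DifferentiableAt ℝ h x)
    (h0 : h 0 = 0) (h1 : fderiv ℝ h 0 = 0)
    (h2 : ∀ v, HasFDerivAt (fun x => fderiv ℝ h x v)
        (∑ i, (κ i * v i) • (EuclideanSpace.proj i : Euc n →L[ℝ] ℝ)) 0) :
    (fun x => h x - diagForm κ x / 2) =o[𝓝 0] fun x : Euc n => ‖x‖ ^ 2 := by
  set g : Euc n → ℝ := fun x => h x - diagForm κ x / 2 with hg
  have hgd : ∀ᶠ x in 𝓝 (0 : Euc n), HasFDerivAt g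
      (∑ i, (fderiv ℝ h x (EuclideanSpace.single i 1) - κ i * x i) •
        (EuclideanSpace.proj i : Euc n →L[ℝ] ℝ)) x := by
    filter_upwards [hd] with x hx
    refine (hx.hasFDerivAt.sub ((hasFDerivAt_diagForm κ x).mul_const 2⁻¹)).congr_fderiv ?_
    ext1 v
    have hv : v = ∑ i, v i • EuclideanSpace.single i (1 : ℝ) := by
      ext j; simp [Pi.single_apply]
    conv_lhs => rw [hv]
    simp only [map_sum, map_smul, _root_.sub_apply, _root_.smul_apply, _root_.sum_apply,
      smul_eq_mul]
    refine Finset.sum_congr rfl fun i _ => ?_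
    simp; ring
  have ho : (fun x : Euc n => ∑ i, (fderiv ℝ h x (EuclideanSpace.single i 1) - κ i * x i) •
        (EuclideanSpace.proj i : Euc n →L[ℝ] ℝ)) =o[𝓝 0] fun x : Euc n => x := by
    refine Asymptotics.IsLittleO.fun_sum fun i _ => ?_
    refine Asymptotics.IsBigO.trans_isLittleO (Asymptotics.isBigO_of_le' (c :=
      ‖(EuclideanSpace.proj i : Euc n →L[ℝ] ℝ)‖) _ fun x => ?_) (fderiv_sub_isLittleO h1 h2 i)
    rw [norm_smul, mul_comm]
  rw [Asymptotics.isLittleO_iff]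
  intro c hc
  have hc' := (Asymptotics.isLittleO_iff.1 ho) hc
  obtain ⟨r, hr, hball⟩ := Metric.eventually_nhds_iff_ball.1 (hgd.and hc')
  filter_upwards [Metric.ball_mem_nhds (0 : Euc n) hr] with x hx
  have hx' : ‖x‖ < r := by simpa using hx
  have hsub : Metric.closedBall (0 : Euc n) ‖x‖ ⊆ Metric.ball 0 r :=
    Metric.closedBall_subset_ball hx'
  -- the mean value inequality on the ball of radius `‖x‖`, where the derivative of `g` is bounded
  -- by `c * ‖x‖`
  have := (convex_closedBall (0 : Euc n) ‖x‖).norm_image_sub_le_of_norm_hasFDerivWithin_le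
    (f := g) (C := c * ‖x‖) (x := 0) (y := x)
    (fun y hy => ((hball y (hsub hy)).1).hasFDerivWithinAt)
    (fun y hy => ((hball y (hsub hy)).2).trans (by
      have : ‖y‖ ≤ ‖x‖ := by simpa using hy
      gcongr)) (by simp) (by simp)
  have hg0 : g 0 = 0 := by simp [hg, h0, diagForm]
  rw [hg0, sub_zero, sub_zero] at this
  calc ‖g x‖ ≤ c * ‖x‖ * ‖x‖ := this
    _ = c * ‖‖x‖ ^ 2‖ := by rw [norm_pow, norm_norm]; ring

/-- Second order Taylor expansion of the volume density of a graph. -/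
theorem sqrt_det_isLittleO (h1 : fderiv ℝ h 0 = 0)
    (h2 : ∀ v, HasFDerivAt (fun x => fderiv ℝ h x v)
        (∑ i, (κ i * v i) • (EuclideanSpace.proj i : Euc n →L[ℝ] ℝ)) 0) :
    (fun x => Real.sqrt (1 + ∑ i, fderiv ℝ h x (EuclideanSpace.single i 1) ^ 2) - 1
      - diagForm (fun i => κ i ^ 2) x / 2) =o[𝓝 0] fun x : Euc n => ‖x‖ ^ 2 := by
  set s : Euc n → ℝ := fun x => ∑ i, fderiv ℝ h x (EuclideanSpace.single i 1) ^ 2 with hs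
  have hx : ∀ i, (fun x : Euc n => κ i * x i) =O[𝓝 0] fun x : Euc n => ‖x‖ := fun i =>
    (Asymptotics.IsBigO.of_bound 1 (Eventually.of_forall fun x => by
      simpa using PiLp.norm_apply_le x i)).const_mul_left _
  have hs1 : (fun x => s x - diagForm (fun i => κ i ^ 2) x) =o[𝓝 0] fun x : Euc n => ‖x‖ ^ 2 := by
    simp only [hs, diagForm, ← Finset.sum_sub_distrib]
    refine Asymptotics.IsLittleO.fun_sum fun i _ => ?_
    have a1 := (fderiv_sub_isLittleO h1 h2 i).norm_right
    have a2 : (fun x => fderiv ℝ h x (EuclideanSpace.single i 1) + κ i * x i) =O[𝓝 0]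
        fun x : Euc n => ‖x‖ := by
      refine (a1.isBigO.add ((hx i).const_mul_left 2)).congr_left fun x => by ring
    refine (a1.mul_isBigO a2).congr (fun x => by ring) fun x => by ring
  have hs2 : s =O[𝓝 0] fun x : Euc n => ‖x‖ ^ 2 := by
    have : diagForm (fun i => κ i ^ 2) =O[𝓝 0] fun x : Euc n => ‖x‖ ^ 2 := by
      unfold diagForm
      refine Asymptotics.IsBigO.fun_sum fun i _ => ?_
      exact ((hx i).pow 2).congr_left fun x => by ring
    exact (hs1.isBigO.add this).congr_left fun x => by ring
  have hs0 : Tendsto s (𝓝 0) (𝓝 0) := by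
    refine hs2.trans_tendsto ?_
    have : Continuous fun x : Euc n => ‖x‖ ^ 2 := by fun_prop
    simpa using this.tendsto 0
  have hq : (fun t : ℝ => Real.sqrt (1 + t) - 1 - t / 2) =o[𝓝 0] fun t => t := by
    have : HasDerivAt (fun t : ℝ => Real.sqrt (1 + t)) (1 / 2) 0 := by
      have := ((hasDerivAt_id (0 : ℝ)).const_add 1).sqrt (by simp)
      simpa using this
    have := this.isLittleO
    refine this.congr (fun t => ?_) fun t => by simp
    simp; ring
  have h3 := (hq.comp_tendsto hs0).trans_isBigO hs2
  exact (h3.add (hs1.const_mul_left (1 / 2))).congr_left fun x => by simp; ring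

end Taylor

/-! ### The volume measure near a point of a graph -/

section Volume

variable {n : ℕ} {U : Set (Euc n)} {φ : Euc n → Euc (n + 1)}

theorem chartVolume_apply (hU : MeasurableSet U) (hφ : ContinuousOn φ U) {A : Set (Euc (n + 1))}
    (hA : MeasurableSet A) :
    chartVolume U φ A =
      ∫⁻ x in φ ⁻¹' A ∩ U, ENNReal.ofReal (Real.sqrt (metricMatrix φ x).det) := by
  rw [chartVolume, Measure.map_apply_of_aemeasurable
    ((hφ.aemeasurable hU).mono_ac (withDensity_absolutelyContinuous _ _)) hA, withDensity_apply',
    Measure.restrict_restrict' hU]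

theorem measurableSet_preimage_inter_of_continuousOn (hU : MeasurableSet U)
    (hφ : ContinuousOn φ U) {A : Set (Euc (n + 1))} (hA : MeasurableSet A) :
    MeasurableSet (φ ⁻¹' A ∩ U) := by
  have h1 : MeasurableSet (U.domRestrict φ ⁻¹' A) := hφ.domRestrict.measurable hA
  have h2 := (MeasurableEmbedding.subtype_coe hU).measurableSet_image.2 h1
  convert h2 using 1
  ext x; simp [and_comm]

/-- The metric is the Gram matrix `Jᵀ J` of the Jacobian. -/
theorem metricMatrix_eq_transpose_mul (φ : Euc n → Euc (n + 1)) (x : Euc n) :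
    metricMatrix φ x =
      (LinearMap.toMatrix (EuclideanSpace.basisFun (Fin n) ℝ).toBasis
        (EuclideanSpace.basisFun (Fin (n + 1)) ℝ).toBasis (fderiv ℝ φ x).toLinearMap).transpose *
      LinearMap.toMatrix (EuclideanSpace.basisFun (Fin n) ℝ).toBasis
        (EuclideanSpace.basisFun (Fin (n + 1)) ℝ).toBasis (fderiv ℝ φ x).toLinearMap := by
  ext i j
  simp [metricMatrix, Matrix.mul_apply, LinearMap.toMatrix_apply, PiLp.inner_apply, mul_comm]

/-- Transformation rule of the Gram determinant under a change of coordinates. -/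
theorem det_metricMatrix_of_comp {φ₀ : Euc n → Euc (n + 1)} {x y : Euc n} {L : Euc n →L[ℝ] Euc n}
    (h : fderiv ℝ φ x = (fderiv ℝ φ₀ y).comp L) :
    (metricMatrix φ x).det = L.det ^ 2 * (metricMatrix φ₀ y).det := by
  rw [metricMatrix_eq_transpose_mul φ, metricMatrix_eq_transpose_mul φ₀, h,
    ContinuousLinearMap.toLinearMap_comp, LinearMap.toMatrix_comp _
      (EuclideanSpace.basisFun (Fin n) ℝ).toBasis, Matrix.transpose_mul,
      Matrix.mul_assoc, ← Matrix.mul_assoc (Matrix.transpose _) (LinearMap.toMatrix _ _ _),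
      Matrix.det_mul, Matrix.det_mul, Matrix.det_transpose, LinearMap.det_toMatrix,
      ContinuousLinearMap.det]
  ring

variable (b : OrthonormalBasis (Fin (n + 1)) ℝ (Euc (n + 1))) {S W₀ : Set (Euc (n + 1))}
  {U₀ : Set (Euc n)} {p : Euc (n + 1)} {h : Euc n → ℝ}

/-- A parametrization contributes at most the volume computed in a graph chart; the transition map
is the composition of the parametrization with the projection onto the hyperplane. -/
theorem chartVolume_le_graph (hU₀ : IsOpen U₀) (hh : ContDiffOn ℝ ∞ h U₀)
    (hW₀ : IsOpen W₀) (hSW : graphMap b p h '' U₀ = S ∩ W₀) (hφ : IsLocalParametrization S U φ)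
    {A : Set (Euc (n + 1))} (hA : MeasurableSet A) (hAW : A ⊆ W₀) :
    chartVolume U φ A ≤ chartVolume U₀ (graphMap b p h) A := by
  obtain ⟨hU, hφs, -, hemb, W, -, hW⟩ := hφ
  have hφc := hφs.continuousOn
  have hg₀ := contDiffOn_graphMap b (p := p) hh
  rw [chartVolume_apply hU.measurableSet hφc hA,
    chartVolume_apply hU₀.measurableSet hg₀.continuousOn hA]
  set B := φ ⁻¹' A ∩ U with hB
  set ψ : Euc n → Euc n := fun x => hyperProj b (φ x - p) with hψ
  have hBm : MeasurableSet B := measurableSet_preimage_inter_of_continuousOn hU.measurableSet hφc hA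
  have hlift : ∀ x ∈ U, φ x ∈ W₀ → ψ x ∈ U₀ ∧ graphMap b p h (ψ x) = φ x := by
    intro x hx hxW
    have hS : φ x ∈ S := (hW ▸ mem_image_of_mem φ hx : φ x ∈ S ∩ W).1
    obtain ⟨y, hy, hyx⟩ := hSW.symm.subset ⟨hS, hxW⟩
    have : ψ x = y := by rw [hψ]; simp only [← hyx]; exact hyperProj_graphMap_sub b y
    rw [this]; exact ⟨hy, hyx⟩
  have hφd : ∀ x ∈ U, DifferentiableAt ℝ φ x := fun x hx =>
    (hφs.contDiffAt (hU.mem_nhds hx)).differentiableAt (by simp)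
  have hψd : ∀ x ∈ U, HasFDerivAt ψ ((hyperProj b).comp (fderiv ℝ φ x)) x := fun x hx =>
    (hyperProj b).hasFDerivAt.comp x ((hφd x hx).hasFDerivAt.sub_const p)
  have hinj : InjOn ψ B := by
    intro x hx y hy hxy
    have h1 := (hlift x hx.2 (hAW hx.1)).2
    have h2 := (hlift y hy.2 (hAW hy.1)).2
    have h3 : φ x = φ y := by rw [← h1, ← h2, hxy]
    have := hemb.injective (a₁ := ⟨x, hx.2⟩) (a₂ := ⟨y, hy.2⟩) h3
    simpa using this
  have hchain : ∀ x ∈ B, (metricMatrix φ x).det =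
      ((hyperProj b).comp (fderiv ℝ φ x)).det ^ 2
        * (metricMatrix (graphMap b p h) (ψ x)).det := by
    intro x hx
    refine det_metricMatrix_of_comp ?_
    have hev : (fun y => graphMap b p h (ψ y)) =ᶠ[𝓝 x] φ := by
      have : ∀ᶠ y in 𝓝 x, φ y ∈ W₀ :=
        (hφd x hx.2).continuousAt.eventually (hW₀.mem_nhds (hAW hx.1))
      filter_upwards [this, hU.mem_nhds hx.2] with y hy hyU using (hlift y hyU hy).2
    have hg : HasFDerivAt (graphMap b p h) (fderiv ℝ (graphMap b p h) (ψ x)) (ψ x) :=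
      ((hg₀.contDiffAt (hU₀.mem_nhds (hlift x hx.2 (hAW hx.1)).1)).differentiableAt
        (by simp)).hasFDerivAt
    exact ((hg.comp x (hψd x hx.2)).congr_of_eventuallyEq hev.symm).fderiv
  have hsub : ψ '' B ⊆ graphMap b p h ⁻¹' A ∩ U₀ := by
    rintro _ ⟨x, hx, rfl⟩
    have := hlift x hx.2 (hAW hx.1)
    exact ⟨by rw [mem_preimage, this.2]; exact hx.1, this.1⟩
  calc ∫⁻ x in B, ENNReal.ofReal (Real.sqrt (metricMatrix φ x).det)
      = ∫⁻ x in B, ENNReal.ofReal |((hyperProj b).comp (fderiv ℝ φ x)).det| *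
          ENNReal.ofReal (Real.sqrt (metricMatrix (graphMap b p h) (ψ x)).det) := by
        refine setLIntegral_congr_fun hBm fun x hx => ?_
        simp only
        rw [hchain x hx, Real.sqrt_mul (sq_nonneg _), Real.sqrt_sq_eq_abs,
          ENNReal.ofReal_mul (abs_nonneg _)]
    _ = ∫⁻ x in ψ '' B, ENNReal.ofReal (Real.sqrt (metricMatrix (graphMap b p h) x).det) :=
        (lintegral_image_eq_lintegral_abs_det_fderiv_mul volume hBm
          (fun x hx => (hψd x hx.2).hasFDerivWithinAt) hinj fun x =>
            ENNReal.ofReal (Real.sqrt (metricMatrix (graphMap b p h) x).det)).symm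
    _ ≤ _ := lintegral_mono_set hsub

/-- Inside `W₀` the volume measure is that of the graph chart. -/
theorem hypersurfaceVolume_apply_eq (hU₀ : IsOpen U₀) (hh : ContDiffOn ℝ ∞ h U₀)
    (hW₀ : IsOpen W₀) (hSW : graphMap b p h '' U₀ = S ∩ W₀)
    {A : Set (Euc (n + 1))} (hA : MeasurableSet A) (hAW : A ⊆ W₀) :
    hypersurfaceVolume S A = chartVolume U₀ (graphMap b p h) A := by
  refine le_antisymm ?_ ?_
  · -- the right side dominates every `chartVolume`: by `chartVolume_le_graph` inside `W₀`, and
    -- because it is infinite on nonempty sets outside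
    have : hypersurfaceVolume S ≤
        chartVolume U₀ (graphMap b p h) + (⊤ : Measure (Euc (n + 1))).restrict W₀ᶜ := by
      refine sSup_le ?_
      rintro m ⟨U, φ, hφ, rfl⟩
      refine Measure.le_iff.2 fun A hA => ?_
      rw [← measure_inter_add_sdiff A hW₀.measurableSet, Measure.add_apply,
        Measure.restrict_apply hA]
      refine add_le_add ?_ ?_
      · exact (chartVolume_le_graph b hU₀ hh hW₀ hSW hφ (hA.inter hW₀.measurableSet)
          inter_subset_right).trans (measure_mono inter_subset_left)
      · exact (le_top : chartVolume U φ ≤ ⊤) _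
    refine (this A).trans ?_
    rw [Measure.add_apply, Measure.restrict_apply hA, ← sdiff_eq, sdiff_eq_bot_iff.2 hAW]
    simp
  · have : chartVolume U₀ (graphMap b p h) ≤ hypersurfaceVolume S :=
      le_sSup ⟨U₀, _, isLocalParametrization_graphMap b hU₀ hh hW₀ hSW, rfl⟩
    exact this A

/-- Integrals over a small patch in the graph chart. -/
theorem setIntegral_patch (hU₀ : IsOpen U₀) (hh : ContDiffOn ℝ ∞ h U₀)
    (hW₀ : IsOpen W₀) (hSW : graphMap b p h '' U₀ = S ∩ W₀) {ε : ℝ} (hε : 0 ≤ ε)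
    (hball : Metric.closedBall p ε ⊆ W₀) {F : Euc (n + 1) → ℝ} (hF : Continuous F) :
    ∫ X in patch S p ε, F X ∂hypersurfaceVolume S =
      ∫ x in {x ∈ U₀ | ‖x‖ ^ 2 + h x ^ 2 ≤ ε ^ 2}, F (graphMap b p h x) *
        Real.sqrt (1 + ∑ i, fderiv ℝ h x (EuclideanSpace.single i 1) ^ 2) := by
  set g := graphMap b p h with hg
  have hgc : ContinuousOn g U₀ := (contDiffOn_graphMap b hh).continuousOn
  have hginj : InjOn g U₀ := fun x _ y _ hxy => by
    rw [← hyperProj_graphMap_sub b (p := p) (h := h) x, ← hyperProj_graphMap_sub b (p := p)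
      (h := h) y]
    simp only [← hg, hxy]
  have hSm : MeasurableSet (S ∩ W₀) :=
    hSW ▸ hU₀.measurableSet.image_of_continuousOn_injOn hgc hginj
  have hpatch : patch S p ε = S ∩ W₀ ∩ Metric.closedBall p ε := by
    rw [patch, inter_assoc, inter_eq_right.2 hball]
  have hpm : MeasurableSet (patch S p ε) := hpatch ▸ hSm.inter measurableSet_closedBall
  have hpW : patch S p ε ⊆ W₀ := inter_subset_right.trans hball
  have hres : (hypersurfaceVolume S).restrict (patch S p ε)
      = (chartVolume U₀ g).restrict (patch S p ε) := by
    ext A hA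
    rw [Measure.restrict_apply hA, Measure.restrict_apply hA]
    exact hypersurfaceVolume_apply_eq b hU₀ hh hW₀ hSW (hA.inter hpm)
      (inter_subset_right.trans hpW)
  have hdet : ∀ x ∈ U₀, (metricMatrix g x).det
      = 1 + ∑ i, fderiv ℝ h x (EuclideanSpace.single i 1) ^ 2 := fun x hx =>
    det_metricMatrix_graphMap b
      ((hh.contDiffAt (hU₀.mem_nhds hx)).differentiableAt (by simp))
  have hdc : ContinuousOn (fun x => (metricMatrix g x).det) U₀ := by
    refine ContinuousOn.congr ?_ hdet
    have := hh.continuousOn_fderiv_of_isOpen hU₀ (by simp)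
    exact continuousOn_const.add (continuousOn_finsetSum _ fun i _ =>
      (this.clm_apply continuousOn_const).pow 2)
  have hdm : AEMeasurable (fun x => ENNReal.ofReal (Real.sqrt (metricMatrix g x).det))
      (volume.restrict U₀) :=
    ((hdc.aemeasurable hU₀.measurableSet).sqrt).ennreal_ofReal
  have hDm : MeasurableSet (g ⁻¹' (patch S p ε) ∩ U₀) :=
    measurableSet_preimage_inter_of_continuousOn hU₀.measurableSet hgc hpm
  have hD : g ⁻¹' (patch S p ε) ∩ U₀ = {x ∈ U₀ | ‖x‖ ^ 2 + h x ^ 2 ≤ ε ^ 2} := by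
    ext x
    simp only [mem_inter_iff, mem_preimage, mem_ofPred_eq, patch, mem_closedBall_iff_norm]
    rw [← norm_graphMap_sub_sq b (p := p), sq_le_sq₀ (norm_nonneg _) hε]
    constructor
    · rintro ⟨⟨-, h1⟩, h2⟩; exact ⟨h2, h1⟩
    · rintro ⟨h2, h1⟩
      exact ⟨⟨(hSW ▸ mem_image_of_mem g h2 : g x ∈ S ∩ W₀).1, h1⟩, h2⟩
  rw [hres, ← integral_indicator hpm, chartVolume, integral_map
    ((hgc.aemeasurable hU₀.measurableSet).mono_ac (withDensity_absolutelyContinuous _ _))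
    (hF.aestronglyMeasurable.indicator hpm),
    integral_withDensity_eq_integral_toReal_smul₀ hdm (Eventually.of_forall fun x => by simp),
    ← hD, ← integral_indicator hU₀.measurableSet, ← integral_indicator hDm]
  refine integral_congr_ae (Eventually.of_forall fun x => ?_)
  by_cases hx : x ∈ U₀
  · by_cases hx' : g x ∈ patch S p ε
    · simp [hx, hx', hdet x hx, mul_comm, Real.sqrt_nonneg]
    · simp [hx, hx']
  · simp [hx]

end Volume

/-! ### Gaussian moments -/

section Moments

variable {n : ℕ}

/-- The unnormalized standard Gaussian density. -/
noncomputable def gauss (x : Euc n) : ℝ := Real.exp (-(1 / 2) * ‖x‖ ^ 2)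

theorem integrable_mul_gauss {P : Euc n → ℝ} (hP : P.HasTemperateGrowth) :
    Integrable fun x => P x * gauss x := by
  have hG : Integrable fun x : Euc n => Real.exp (-(1 / 4) * ‖x‖ ^ 2) := by
    refine Integrable.of_integral_ne_zero ?_
    rw [GaussianFourier.integral_rexp_neg_mul_sq_norm (by norm_num)]
    positivity
  obtain ⟨k, C, hC⟩ := hP.2 0
  have hC0 : 0 ≤ C := by
    have := (norm_nonneg _).trans (hC 0)
    simpa using this
  refine (hG.const_mul (C * (k.factorial * Real.exp 2))).mono' ?_ (Eventually.of_forall fun x => ?_)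
  · have : Continuous P := hP.1.continuous
    unfold gauss
    exact (by fun_prop :
      Continuous fun x => P x * Real.exp (-(1 / 2) * ‖x‖ ^ 2)).aestronglyMeasurable
  · have h1 := hC x
    rw [norm_iteratedFDeriv_zero] at h1
    have h2 : (1 + ‖x‖) ^ k ≤ k.factorial * Real.exp (1 + ‖x‖) := by
      have := Real.pow_div_factorial_le_exp (1 + ‖x‖) (by positivity) k
      rw [div_le_iff₀ (by positivity)] at this
      linarith
    have h3 : Real.exp (1 + ‖x‖) * gauss x ≤ Real.exp 2 * Real.exp (-(1 / 4) * ‖x‖ ^ 2) := by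
      rw [gauss, ← Real.exp_add, ← Real.exp_add, Real.exp_le_exp]
      nlinarith [sq_nonneg (‖x‖ / 2 - 1)]
    have hg : 0 < gauss x := Real.exp_pos _
    rw [norm_mul, Real.norm_of_nonneg hg.le]
    calc ‖P x‖ * gauss x ≤ C * (k.factorial * Real.exp (1 + ‖x‖)) * gauss x := by
          gcongr; exact h1.trans (by gcongr)
      _ = C * k.factorial * (Real.exp (1 + ‖x‖) * gauss x) := by ring
      _ ≤ C * k.factorial * (Real.exp 2 * Real.exp (-(1 / 4) * ‖x‖ ^ 2)) := by gcongr
      _ = _ := by ring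

theorem hasFDerivAt_gauss (x : Euc n) :
    HasFDerivAt (gauss (n := n)) (-(gauss x • innerSL ℝ x)) x := by
  have := ((hasFDerivAt_id x).norm_sq.const_mul (-(1 / 2) : ℝ)).exp
  refine this.congr_fderiv ?_
  ext1 v
  simp [gauss]

theorem hasTemperateGrowth_fderiv {P : Euc n → ℝ} (hP : P.HasTemperateGrowth) :
    (fderiv ℝ P).HasTemperateGrowth := by
  refine ⟨hP.1.fderiv_right (m := ∞) (by simp), fun k => ?_⟩
  obtain ⟨l, C, hC⟩ := hP.2 (k + 1)
  exact ⟨l, C, fun x => by rw [norm_iteratedFDeriv_fderiv]; exact hC x⟩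

/-- Gaussian integration by parts. -/
theorem integral_inner_mul_gauss {P : Euc n → ℝ} (hP : P.HasTemperateGrowth) (v : Euc n) :
    ∫ x, ⟪x, v⟫_ℝ * P x * gauss x = ∫ x, fderiv ℝ P x v * gauss x := by
  have hP' : (fun x => fderiv ℝ P x v).HasTemperateGrowth := by
    exact (ContinuousLinearMap.apply ℝ ℝ (_ : Euc n)).hasTemperateGrowth.comp
      (hasTemperateGrowth_fderiv hP)
  have hg : ∀ x : Euc n, fderiv ℝ gauss x v = -(⟪x, v⟫_ℝ * gauss x) := fun x => by
    rw [(hasFDerivAt_gauss x).fderiv]; simp [mul_comm]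
  have key := integral_mul_fderiv_eq_neg_fderiv_mul_of_integrable (μ := volume) (f := P)
    (g := gauss (n := n)) (v := v) (integrable_mul_gauss hP')
    (by
      have := (integrable_mul_gauss (P := fun x => ⟪x, v⟫_ℝ * P x) (by fun_prop)).neg
      refine this.congr (Eventually.of_forall fun x => ?_)
      simp only [hg, Pi.neg_apply]; ring)
    (integrable_mul_gauss hP) (fun x _ => hP.1.differentiable (by simp) x)
    (fun x _ => (hasFDerivAt_gauss x).differentiableAt)
  rw [← neg_inj, ← key, ← integral_neg]
  refine integral_congr_ae (Eventually.of_forall fun x => ?_)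
  simp only [hg]; ring

theorem diagForm_hasTemperateGrowth (κ : Fin n → ℝ) : (diagForm κ).HasTemperateGrowth := by
  have h : ∀ i, (fun x : Euc n => x i).HasTemperateGrowth := fun i =>
    (EuclideanSpace.proj i : Euc n →L[ℝ] ℝ).hasTemperateGrowth
  unfold diagForm
  exact Function.HasTemperateGrowth.sum fun i _ => by have := h i; fun_prop

theorem coord_hasTemperateGrowth (i : Fin n) : (fun x : Euc n => x i).HasTemperateGrowth :=
  (EuclideanSpace.proj i : Euc n →L[ℝ] ℝ).hasTemperateGrowth

theorem fderiv_coord_mul {P : Euc n → ℝ} (hP : P.HasTemperateGrowth) (x : Euc n) (μ ν : Fin n) :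
    fderiv ℝ (fun x : Euc n => x ν * P x) x (EuclideanSpace.single μ 1) =
      (if μ = ν then P x else 0) + x ν * fderiv ℝ P x (EuclideanSpace.single μ 1) := by
  have h1 : HasFDerivAt (fun x : Euc n => x ν) (EuclideanSpace.proj ν : Euc n →L[ℝ] ℝ) x :=
    (EuclideanSpace.proj ν : Euc n →L[ℝ] ℝ).hasFDerivAt
  have h2 := h1.mul (hP.1.differentiable (by simp) x).hasFDerivAt
  have h3 : fderiv ℝ (fun x : Euc n => x ν * P x) x = _ := h2.fderiv
  rw [h3]
  simp only [_root_.add_apply, _root_.smul_apply, PiLp.proj_apply, smul_eq_mul,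
    PiLp.single_apply]
  by_cases h : μ = ν
  · simp [h]; ring
  · simp [h, Ne.symm h]

/-- One step of the Wick recursion. -/
theorem integral_coord_mul_coord_mul_gauss {P : Euc n → ℝ} (hP : P.HasTemperateGrowth)
    (μ ν : Fin n) :
    ∫ x, x μ * x ν * P x * gauss x = (if μ = ν then ∫ x, P x * gauss x else 0)
      + ∫ x, x ν * fderiv ℝ P x (EuclideanSpace.single μ 1) * gauss x := by
  have hν := coord_hasTemperateGrowth ν
  have hP' : (fun x => fderiv ℝ P x (EuclideanSpace.single μ 1)).HasTemperateGrowth := by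
    exact (ContinuousLinearMap.apply ℝ ℝ (_ : Euc n)).hasTemperateGrowth.comp
      (hasTemperateGrowth_fderiv hP)
  have h1 := integral_inner_mul_gauss (P := fun x : Euc n => x ν * P x) (by fun_prop)
    (EuclideanSpace.single μ 1)
  simp only [fderiv_coord_mul hP, EuclideanSpace.inner_single_right, one_mul, add_mul] at h1
  rw [integral_add] at h1
  · simp only [ite_mul, zero_mul] at h1
    simp only [conj_trivial, ← mul_assoc] at h1
    rw [h1]
    split_ifs <;> simp
  · by_cases h : μ = ν
    · simpa [h] using integrable_mul_gauss hP
    · simp [h]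
  · exact integrable_mul_gauss (P := fun x => x ν * fderiv ℝ P x _) (by fun_prop)

theorem integral_coord_mul_coord_gauss (μ ν : Fin n) :
    ∫ x, x μ * x ν * gauss x = if μ = ν then ∫ x : Euc n, gauss x else 0 := by
  have := integral_coord_mul_coord_mul_gauss (P := fun _ : Euc n => 1) (by fun_prop) μ ν
  simpa using this

theorem fderiv_diagForm (κ : Fin n → ℝ) (x : Euc n) (μ : Fin n) :
    fderiv ℝ (diagForm κ) x (EuclideanSpace.single μ 1) = 2 * κ μ * x μ := by
  rw [(hasFDerivAt_diagForm κ x).fderiv]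
  simp

theorem integral_diagForm_mul_gauss (κ : Fin n → ℝ) {P : Euc n → ℝ} (hP : P.HasTemperateGrowth) :
    ∫ x, diagForm κ x * P x * gauss x = ∑ i, κ i * ∫ x, x i * x i * P x * gauss x := by
  have : ∀ x : Euc n, diagForm κ x * P x * gauss x
      = ∑ i, κ i * (x i * x i * P x * gauss x) := fun x => by
    rw [diagForm, Finset.sum_mul, Finset.sum_mul]
    exact Finset.sum_congr rfl fun i _ => by ring
  simp only [this]
  rw [integral_finsetSum]
  · simp only [integral_const_mul]
  · intro i _
    have hi := coord_hasTemperateGrowth i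
    exact (integrable_mul_gauss (P := fun x => x i * x i * P x) (by fun_prop)).const_mul _

theorem integral_diagForm_gauss (κ : Fin n → ℝ) :
    ∫ x, diagForm κ x * gauss x = (∑ i, κ i) * ∫ x : Euc n, gauss x := by
  have := integral_diagForm_mul_gauss κ (P := fun _ : Euc n => 1) (by fun_prop)
  simp only [mul_one, integral_coord_mul_coord_gauss, if_true] at this
  rw [this, Finset.sum_mul]

theorem integral_coord_mul_coord_mul_diagForm_gauss (κ : Fin n → ℝ) (μ ν : Fin n) :
    ∫ x, x μ * x ν * diagForm κ x * gauss x =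
      if μ = ν then (∑ i, κ i + 2 * κ μ) * ∫ x : Euc n, gauss x else 0 := by
  rw [integral_coord_mul_coord_mul_gauss (diagForm_hasTemperateGrowth κ), integral_diagForm_gauss]
  have : ∀ x : Euc n, x ν * fderiv ℝ (diagForm κ) x (EuclideanSpace.single μ 1) * gauss x
      = 2 * κ μ * (x μ * x ν * gauss x) := fun x => by rw [fderiv_diagForm]; ring
  simp only [this, integral_const_mul, integral_coord_mul_coord_gauss]
  split_ifs <;> ring

theorem integral_diagForm_sq_gauss (κ : Fin n → ℝ) :
    ∫ x, diagForm κ x ^ 2 * gauss x =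
      ((∑ i, κ i) ^ 2 + 2 * ∑ i, κ i ^ 2) * ∫ x : Euc n, gauss x := by
  have := integral_diagForm_mul_gauss κ (diagForm_hasTemperateGrowth κ)
  simp only [pow_two (diagForm κ _), this, integral_coord_mul_coord_mul_diagForm_gauss, if_true]
  have : ∀ i, κ i * ((∑ j, κ j + 2 * κ i) * ∫ x : Euc n, gauss x)
      = ((∑ j, κ j) * κ i + 2 * κ i ^ 2) * ∫ x : Euc n, gauss x := fun i => by ring
  simp only [this, ← Finset.sum_mul, Finset.sum_add_distrib, ← Finset.mul_sum]
  ring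

theorem integral_coord_mul_coord_mul_diagForm_sq_gauss (κ : Fin n → ℝ) (μ ν : Fin n) :
    ∫ x, x μ * x ν * diagForm κ x ^ 2 * gauss x =
      if μ = ν then ((∑ i, κ i) ^ 2 + 2 * ∑ i, κ i ^ 2 + 4 * κ μ * (∑ i, κ i + 2 * κ μ)) *
        ∫ x : Euc n, gauss x else 0 := by
  have hQ := diagForm_hasTemperateGrowth κ
  rw [integral_coord_mul_coord_mul_gauss (P := fun x => diagForm κ x ^ 2) (by fun_prop),
    integral_diagForm_sq_gauss]
  have hd : ∀ x : Euc n, fderiv ℝ (fun x => diagForm κ x ^ 2) x (EuclideanSpace.single μ 1)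
      = 4 * κ μ * x μ * diagForm κ x := fun x => by
    have := ((hasFDerivAt_diagForm κ x).pow 2).fderiv
    rw [this, _root_.smul_apply, ← (hasFDerivAt_diagForm κ x).fderiv, fderiv_diagForm]
    simp; ring
  have : ∀ x : Euc n, x ν * fderiv ℝ (fun x => diagForm κ x ^ 2) x (EuclideanSpace.single μ 1)
      * gauss x = 4 * κ μ * (x μ * x ν * diagForm κ x * gauss x) := fun x => by rw [hd]; ring
  simp only [this, integral_const_mul, integral_coord_mul_coord_mul_diagForm_gauss]
  split_ifs <;> ring

/-! ### Polar coordinates -/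

/-- The surface measure of the unit sphere. -/
noncomputable abbrev sphereMeasure (n : ℕ) : Measure (Metric.sphere (0 : Euc n) 1) :=
  (volume : Measure (Euc n)).toSphere

theorem integral_polar (hn : 1 ≤ n) (f : Euc n → ℝ) :
    ∫ x, f x = ∫ z, f ((z.2 : ℝ) • (z.1 : Euc n))
      ∂((sphereMeasure n).prod (Measure.volumeIoiPow (n - 1))) := by
  have : Nonempty (Fin n) := ⟨⟨0, hn⟩⟩
  have h1 : ∫ x, f x =
      ∫ x : ({(0)}ᶜ : Set (Euc n)), f x ∂((volume : Measure (Euc n)).comap Subtype.val) := by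
    rw [integral_subtype_comap (measurableSet_singleton _).compl f, restrict_compl_singleton]
  have h2 := (volume : Measure (Euc n)).measurePreserving_homeomorphUnitSphereProd.integral_comp
    (Homeomorph.measurableEmbedding _) (fun z => f ((z.2 : ℝ) • (z.1 : Euc n)))
  rw [finrank_euclideanSpace_fin] at h2
  rw [h1, ← h2]
  refine integral_congr_ae (Eventually.of_forall fun x => ?_)
  have hx : ‖(x : Euc n)‖ ≠ 0 := norm_ne_zero_iff.2 x.2
  simp [smul_smul, hx]

theorem integral_volumeIoiPow (k : ℕ) (f : ℝ → ℝ) :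
    ∫ r : Ioi (0 : ℝ), f r ∂Measure.volumeIoiPow k = ∫ r in Ioi (0 : ℝ), r ^ k * f r := by
  simp only [Measure.volumeIoiPow, ENNReal.ofReal]
  rw [integral_withDensity_eq_integral_smul,
    integral_subtype_comap measurableSet_Ioi fun a => Real.toNNReal (a ^ k) • f a,
    setIntegral_congr_fun measurableSet_Ioi fun x hx => ?_]
  · rw [NNReal.smul_def, Real.coe_toNNReal _ (pow_nonneg hx.out.le _), smul_eq_mul]
  · exact (measurable_subtype_coe.pow_const _).real_toNNReal

/-- Polar coordinates for a function homogeneous of degree `k` times a radial one. -/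
theorem integral_homogeneous_mul_radial (hn : 1 ≤ n) {P : Euc n → ℝ} {k : ℕ}
    (hP : ∀ (r : ℝ) x, P (r • x) = r ^ k * P x) (f : ℝ → ℝ) :
    ∫ x, P x * f ‖x‖ =
      (∫ θ, P θ ∂sphereMeasure n) * ∫ r in Ioi (0 : ℝ), r ^ (n - 1 + k) * f r := by
  rw [integral_polar hn]
  have : ∀ z : Metric.sphere (0 : Euc n) 1 × Ioi (0 : ℝ),
      P ((z.2 : ℝ) • (z.1 : Euc n)) * f ‖(z.2 : ℝ) • (z.1 : Euc n)‖
        = P z.1 * ((z.2 : ℝ) ^ k * f z.2) := by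
    rintro ⟨θ, r, hr⟩
    have hr' : 0 < r := hr
    simp only [hP, norm_smul, norm_eq_of_mem_sphere, mul_one, Real.norm_of_nonneg hr'.le]
    ring
  simp only [this]
  rw [integral_prod_mul (fun θ : Metric.sphere (0 : Euc n) 1 => P θ)
    (fun r : Ioi (0 : ℝ) => (r : ℝ) ^ k * f r), integral_volumeIoiPow _ fun r => r ^ k * f r]
  congr 2
  ext r; rw [pow_add]; ring

theorem integral_closedBall_homogeneous (hn : 1 ≤ n) {P : Euc n → ℝ} {k : ℕ}
    (hP : ∀ (r : ℝ) x, P (r • x) = r ^ k * P x) :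
    ∫ x in Metric.closedBall 0 1, P x = (∫ θ, P θ ∂sphereMeasure n) / (n + k) := by
  have h1 := integral_homogeneous_mul_radial hn hP (Iic 1 |>.indicator 1)
  have h2 : ∫ x in Metric.closedBall 0 1, P x
      = ∫ x, P x * (Iic (1 : ℝ) |>.indicator 1) ‖x‖ := by
    rw [← integral_indicator measurableSet_closedBall]
    refine integral_congr_ae (Eventually.of_forall fun x => ?_)
    by_cases hx : ‖x‖ ≤ 1 <;> simp [indicator, hx]
  have h3 : ∫ r in Ioi (0 : ℝ), r ^ (n - 1 + k) * (Iic (1 : ℝ) |>.indicator 1) r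
      = 1 / (n + k) := by
    have : ∀ r : ℝ, r ^ (n - 1 + k) * (Iic (1 : ℝ) |>.indicator 1) r
        = (Iic (1 : ℝ)).indicator (fun r => r ^ (n - 1 + k)) r := fun r => by
      by_cases hr : r ≤ 1 <;> simp [indicator, hr]
    simp only [this]
    rw [setIntegral_indicator measurableSet_Iic, Ioi_inter_Iic,
      ← intervalIntegral.integral_of_le zero_le_one, integral_pow]
    have : ((n - 1 : ℕ) : ℝ) = n - 1 := by push_cast [Nat.cast_sub hn]; ring
    push_cast [this]
    simp
    ring
  rw [h2, h1, h3]; ring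

/-- The radial Gaussian moments. For `1 ≤ n` the exponent is `n + k - 1`. -/
noncomputable def radialMoment (n k : ℕ) : ℝ :=
  ∫ r in Ioi (0 : ℝ), r ^ (n - 1 + k) * Real.exp (-(1 / 2) * r ^ 2)

theorem radialMoment_eq (hn : 1 ≤ n) (k : ℕ) :
    radialMoment n k =
      (1 / 2 : ℝ) ^ (-((n + k : ℝ) / 2)) * (1 / 2) * Real.Gamma ((n + k) / 2) := by
  have := integral_rpow_mul_exp_neg_mul_rpow (p := 2) (q := n + k - 1) (b := 1 / 2) (by norm_num)
    (by
      have : (1 : ℝ) ≤ n := by exact_mod_cast hn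
      have : (0 : ℝ) ≤ k := by positivity
      linarith) (by norm_num)
  rw [sub_add_cancel, neg_div] at this
  rw [← this, radialMoment]
  refine setIntegral_congr_fun measurableSet_Ioi fun r hr => ?_
  have hr' : 0 < r := hr
  have : (n + k - 1 : ℝ) = ((n - 1 + k : ℕ) : ℝ) := by push_cast [Nat.cast_sub hn]; ring
  rw [this, Real.rpow_natCast, Real.rpow_two]

theorem radialMoment_pos (hn : 1 ≤ n) (k : ℕ) : 0 < radialMoment n k := by
  rw [radialMoment_eq hn]
  have : (0 : ℝ) < n := by exact_mod_cast hn
  have := Real.Gamma_pos_of_pos (s := (n + k) / 2) (by positivity)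
  positivity

theorem radialMoment_add_two (hn : 1 ≤ n) (k : ℕ) :
    radialMoment n (k + 2) = (n + k) * radialMoment n k := by
  have hn' : (0 : ℝ) < n := by exact_mod_cast hn
  rw [radialMoment_eq hn, radialMoment_eq hn]
  have e1 : ((n : ℝ) + (k + 2 : ℕ)) / 2 = (n + k) / 2 + 1 := by push_cast; ring
  rw [e1, Real.Gamma_add_one (by positivity), neg_add, Real.rpow_add (by norm_num),
    Real.rpow_neg_one]
  ring

theorem integral_homogeneous_mul_gauss (hn : 1 ≤ n) {P : Euc n → ℝ} {k : ℕ}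
    (hP : ∀ (r : ℝ) x, P (r • x) = r ^ k * P x) :
    ∫ x, P x * gauss x = (∫ θ, P θ ∂sphereMeasure n) * radialMoment n k :=
  integral_homogeneous_mul_radial hn hP fun r => Real.exp (-(1 / 2) * r ^ 2)

/-! ### Moments of the sphere and of the ball -/

/-- The volume of the unit ball of `ℝⁿ`. -/
noncomputable def unitVol (n : ℕ) : ℝ := volume.real (Metric.closedBall (0 : Euc n) 1)

theorem unitVol_pos : 0 < unitVol n :=
  ENNReal.toReal_pos (Metric.measure_closedBall_pos _ _ one_pos).ne'
    measure_closedBall_lt_top.ne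

theorem integral_gauss (hn : 1 ≤ n) :
    ∫ x : Euc n, gauss x = n * unitVol n * radialMoment n 0 := by
  have h1 := integral_homogeneous_mul_gauss hn (P := fun _ : Euc n => 1) (k := 0) (by simp)
  have h2 := integral_closedBall_homogeneous hn (P := fun _ : Euc n => 1) (k := 0) (by simp)
  have hn' : (0 : ℝ) < n := by exact_mod_cast hn
  simp only [one_mul (gauss _)] at h1
  rw [h1]
  have h3 : ∫ x in Metric.closedBall (0 : Euc n) 1, (1 : ℝ) = unitVol n := by simp [unitVol]
  rw [h3] at h2
  rw [h2]; field_simp; simp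

/-- Sphere moments in terms of Gaussian moments: dividing by the integral of the Gaussian, that is
by the case `P = 1`, leaves only ratios of radial moments. -/
theorem integral_sphere_of_gauss (hn : 1 ≤ n) {P : Euc n → ℝ} {k : ℕ}
    (hP : ∀ (r : ℝ) x, P (r • x) = r ^ k * P x) {c : ℝ}
    (hc : ∫ x, P x * gauss x = c * ∫ x : Euc n, gauss x) :
    ∫ θ, P θ ∂sphereMeasure n = c * n * unitVol n * (radialMoment n 0 / radialMoment n k) := by
  rw [integral_homogeneous_mul_gauss hn hP, integral_gauss hn] at hc
  have := (radialMoment_pos hn k).ne'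
  field_simp
  linarith

theorem diagForm_smul (κ : Fin n → ℝ) (r : ℝ) (x : Euc n) :
    diagForm κ (r • x) = r ^ 2 * diagForm κ x := by
  simp only [diagForm, Finset.mul_sum, PiLp.smul_apply, smul_eq_mul]
  exact Finset.sum_congr rfl fun i _ => by ring

theorem radialMoment_ratio (hn : 1 ≤ n) :
    radialMoment n 0 / radialMoment n 2 = 1 / n ∧
    radialMoment n 0 / radialMoment n 4 = 1 / (n * (n + 2)) ∧
    radialMoment n 0 / radialMoment n 6 = 1 / (n * (n + 2) * (n + 4)) := by
  have hn' : (0 : ℝ) < n := by exact_mod_cast hn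
  have h0 := (radialMoment_pos hn 0).ne'
  have h2 := radialMoment_add_two hn 0
  have h4 := radialMoment_add_two hn 2
  have h6 := radialMoment_add_two hn 4
  norm_num at h2 h4 h6
  rw [h6, h4, h2]
  refine ⟨?_, ?_, ?_⟩ <;> field_simp

theorem sphere_moment_two (hn : 1 ≤ n) (μ ν : Fin n) :
    ∫ θ, (θ : Euc n) μ * (θ : Euc n) ν ∂sphereMeasure n = if μ = ν then unitVol n else 0 := by
  have hn' : (0 : ℝ) < n := by exact_mod_cast hn
  rw [integral_sphere_of_gauss hn (P := fun x => x μ * x ν) (k := 2)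
    (c := if μ = ν then 1 else 0) (fun r x => by simp; ring)
    (by rw [integral_coord_mul_coord_gauss]; split_ifs <;> simp), (radialMoment_ratio hn).1]
  split_ifs
  · field_simp
  · simp

theorem sphere_moment_four (hn : 1 ≤ n) (κ : Fin n → ℝ) (μ ν : Fin n) :
    ∫ θ, (θ : Euc n) μ * (θ : Euc n) ν * diagForm κ θ ∂sphereMeasure n =
      if μ = ν then (∑ i, κ i + 2 * κ μ) * (unitVol n / (n + 2)) else 0 := by
  have hn' : (0 : ℝ) < n := by exact_mod_cast hn
  rw [integral_sphere_of_gauss hn (P := fun x => x μ * x ν * diagForm κ x) (k := 4)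
    (c := if μ = ν then (∑ i, κ i + 2 * κ μ) else 0)
    (fun r x => by simp [diagForm_smul]; ring)
    (by rw [integral_coord_mul_coord_mul_diagForm_gauss]; split_ifs <;> simp),
    (radialMoment_ratio hn).2.1]
  split_ifs
  · field_simp
  · simp

theorem sphere_moment_six (hn : 1 ≤ n) (κ : Fin n → ℝ) (μ ν : Fin n) :
    ∫ θ, (θ : Euc n) μ * (θ : Euc n) ν * diagForm κ θ ^ 2 ∂sphereMeasure n =
      if μ = ν then ((∑ i, κ i) ^ 2 + 2 * ∑ i, κ i ^ 2 + 4 * κ μ * (∑ i, κ i + 2 * κ μ)) *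
        (unitVol n / ((n + 2) * (n + 4))) else 0 := by
  have hn' : (0 : ℝ) < n := by exact_mod_cast hn
  rw [integral_sphere_of_gauss hn (P := fun x => x μ * x ν * diagForm κ x ^ 2) (k := 6)
    (c := if μ = ν then ((∑ i, κ i) ^ 2 + 2 * ∑ i, κ i ^ 2 + 4 * κ μ * (∑ i, κ i + 2 * κ μ))
      else 0)
    (fun r x => by simp [diagForm_smul]; ring)
    (by rw [integral_coord_mul_coord_mul_diagForm_sq_gauss]; split_ifs <;> simp),
    (radialMoment_ratio hn).2.2]
  split_ifs
  · field_simp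
  · simp

theorem ball_moment_diagForm (hn : 1 ≤ n) (κ : Fin n → ℝ) :
    ∫ x in Metric.closedBall 0 1, diagForm κ x = (∑ i, κ i) * (unitVol n / (n + 2)) := by
  have hn' : (0 : ℝ) < n := by exact_mod_cast hn
  rw [integral_closedBall_homogeneous hn (diagForm_smul κ), integral_sphere_of_gauss hn
    (diagForm_smul κ) (integral_diagForm_gauss κ), (radialMoment_ratio hn).1]
  push_cast; field_simp

theorem ball_moment_diagForm_sq (hn : 1 ≤ n) (κ : Fin n → ℝ) :
    ∫ x in Metric.closedBall 0 1, diagForm κ x ^ 2 =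
      ((∑ i, κ i) ^ 2 + 2 * ∑ i, κ i ^ 2) * (unitVol n / ((n + 2) * (n + 4))) := by
  have hn' : (0 : ℝ) < n := by exact_mod_cast hn
  have hP : ∀ (r : ℝ) (x : Euc n), diagForm κ (r • x) ^ 2 = r ^ 4 * diagForm κ x ^ 2 :=
    fun r x => by rw [diagForm_smul]; ring
  rw [integral_closedBall_homogeneous hn hP, integral_sphere_of_gauss hn
    hP (integral_diagForm_sq_gauss κ), (radialMoment_ratio hn).2.1]
  push_cast; field_simp

theorem ball_moment_two (hn : 1 ≤ n) (μ ν : Fin n) :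
    ∫ x in Metric.closedBall 0 1, (x : Euc n) μ * x ν
      = if μ = ν then unitVol n / (n + 2) else 0 := by
  rw [integral_closedBall_homogeneous hn (P := fun x => x μ * x ν) (k := 2)
    (fun r x => by simp; ring), sphere_moment_two hn]
  push_cast
  split_ifs <;> simp

theorem ball_moment_four (hn : 1 ≤ n) (κ : Fin n → ℝ) (μ ν : Fin n) :
    ∫ x in Metric.closedBall 0 1, (x : Euc n) μ * x ν * diagForm κ x =
      if μ = ν then (∑ i, κ i + 2 * κ μ) * (unitVol n / ((n + 2) * (n + 4))) else 0 := by
  rw [integral_closedBall_homogeneous hn (P := fun x => x μ * x ν * diagForm κ x) (k := 4)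
    (fun r x => by simp [diagForm_smul]; ring), sphere_moment_four hn]
  push_cast
  split_ifs
  · field_simp
  · simp

theorem ball_odd_moment {P : Euc n → ℝ} (hP : ∀ x, P (-x) = -P x) :
    ∫ x in Metric.closedBall 0 1, P x = 0 := by
  have h : ∫ x in Metric.closedBall 0 1, P x = -∫ x in Metric.closedBall 0 1, P x := by
    rw [← integral_indicator measurableSet_closedBall, ← integral_neg,
      ← integral_neg_eq_self]
    refine integral_congr_ae (Eventually.of_forall fun x => ?_)
    by_cases hx : ‖x‖ ≤ 1 <;> simp [indicator, hx, hP]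
  linarith

end Moments

/-! ### Asymptotics of integrals over rescaled patches -/

section Asymptotics

variable {n : ℕ} {h w : Euc n → ℝ} {κ : Fin n → ℝ}

/-- The projection to the tangent hyperplane of the patch of radius `ε` of the graph of `h`. -/
def flatPatch (h : Euc n → ℝ) (ε : ℝ) : Set (Euc n) := {x | ‖x‖ ^ 2 + h x ^ 2 ≤ ε ^ 2}

/-- The set `flatPatch h ε` rescaled by `ε⁻¹`. -/
def scaledPatch (h : Euc n → ℝ) (ε : ℝ) : Set (Euc n) :=
  {y | ‖y‖ ^ 2 + (h (ε • y) / ε) ^ 2 ≤ 1}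

theorem smul_mem_flatPatch {ε : ℝ} (hε : 0 < ε) (y : Euc n) :
    ε • y ∈ flatPatch h ε ↔ y ∈ scaledPatch h ε := by
  simp only [flatPatch, scaledPatch, mem_ofPred_eq, norm_smul, Real.norm_of_nonneg hε.le]
  rw [← mul_le_mul_iff_right₀ (by positivity : 0 < ε ^ 2)]
  field_simp

theorem measurableSet_flatPatch (hh : Measurable h) (ε : ℝ) : MeasurableSet (flatPatch h ε) :=
  measurableSet_le (by fun_prop) measurable_const

theorem measurableSet_scaledPatch (hh : Measurable h) (ε : ℝ) :
    MeasurableSet (scaledPatch h ε) :=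
  measurableSet_le (by fun_prop) measurable_const

theorem scaledPatch_subset (h : Euc n → ℝ) (ε : ℝ) :
    scaledPatch h ε ⊆ Metric.closedBall 0 1 := by
  intro y hy
  have hy' : ‖y‖ ^ 2 + (h (ε • y) / ε) ^ 2 ≤ 1 := hy
  rw [mem_closedBall_zero_iff]
  nlinarith [sq_nonneg (h (ε • y) / ε), norm_nonneg y]

theorem setIntegral_flatPatch (hh : Measurable h) {ε : ℝ} (hε : 0 < ε) (F : Euc n → ℝ) :
    ∫ x in flatPatch h ε, F x = ε ^ n * ∫ y in scaledPatch h ε, F (ε • y) := by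
  rw [← integral_indicator (measurableSet_flatPatch hh ε),
    ← integral_indicator (measurableSet_scaledPatch hh ε)]
  have := Measure.integral_comp_smul volume ((flatPatch h ε).indicator F) ε
  rw [finrank_euclideanSpace_fin, abs_of_pos (by positivity), smul_eq_mul] at this
  have e : ∀ y, (scaledPatch h ε).indicator (fun y => F (ε • y)) y
      = (flatPatch h ε).indicator F (ε • y) := fun y => by
    by_cases hy : y ∈ scaledPatch h ε
    · rw [indicator_of_mem hy, indicator_of_mem ((smul_mem_flatPatch hε y).2 hy)]
    · rw [indicator_of_notMem hy, indicator_of_notMem (mt (smul_mem_flatPatch hε y).1 hy)]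
  simp only [e, this]
  field_simp

theorem eventually_pos : ∀ᶠ ε : ℝ in 𝓝[>] 0, 0 < ε := eventually_mem_nhdsWithin

theorem tendsto_id_nhdsGT : Tendsto (fun ε : ℝ => ε) (𝓝[>] 0) (𝓝 0) :=
  tendsto_nhdsWithin_of_tendsto_nhds tendsto_id

/-- Blow-up at the origin of a function with quadratic leading part `G`, along a convergent family
of points. -/
theorem tendsto_rescaled {f G : Euc n → ℝ} (hf : (fun x => f x - G x) =o[𝓝 0] fun x => ‖x‖ ^ 2)
    (hG : Continuous G) (hG2 : ∀ (r : ℝ) x, G (r • x) = r ^ 2 * G x) {y : Euc n} {z : ℝ → Euc n}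
    (hz : Tendsto z (𝓝[>] 0) (𝓝 y)) :
    Tendsto (fun ε => f (ε • z ε) / ε ^ 2) (𝓝[>] 0) (𝓝 (G y)) := by
  have h0 : Tendsto (fun ε => ε • z ε) (𝓝[>] 0) (𝓝 0) := by
    simpa using tendsto_id_nhdsGT.smul hz
  have h1 := hf.comp_tendsto h0
  have h2 : (fun ε => ‖ε • z ε‖ ^ 2) =O[𝓝[>] 0] fun ε : ℝ => ε ^ 2 := by
    have : (fun ε => ‖z ε‖ ^ 2) =O[𝓝[>] 0] fun _ : ℝ => (1 : ℝ) :=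
      (hz.norm.pow 2).isBigO_one ℝ
    refine ((Asymptotics.isBigO_refl (fun ε : ℝ => ε ^ 2) _).mul this).congr (fun ε => ?_)
      fun ε => by ring
    rw [norm_smul, mul_pow, Real.norm_eq_abs, sq_abs]
  have h3 := (h1.trans_isBigO h2).tendsto_div_nhds_zero
  have h4 := h3.add (hG.continuousAt.tendsto.comp hz)
  rw [zero_add] at h4
  refine h4.congr' ?_
  filter_upwards [eventually_pos] with ε hε
  simp only [Function.comp_apply, hG2]
  field_simp
  ring

/-- Uniform bound on the unit ball of the blow-up of a function that is `O(‖x‖ ^ 2)`. -/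
theorem rescaled_bounded {f : Euc n → ℝ} (hf : f =O[𝓝 0] fun x => ‖x‖ ^ 2) :
    ∃ C > 0, ∀ᶠ ε : ℝ in 𝓝[>] 0, ∀ y ∈ Metric.closedBall (0 : Euc n) 1,
      |f (ε • y) / ε ^ 2| ≤ C := by
  obtain ⟨C, hC, hb⟩ := hf.exists_pos
  obtain ⟨r, hr, hball⟩ := Metric.eventually_nhds_iff_ball.1 hb.bound
  refine ⟨C, hC, ?_⟩
  filter_upwards [eventually_pos, tendsto_id_nhdsGT.eventually_lt_const hr] with ε hε hεr y hy
  have hy1 : ‖y‖ ≤ 1 := by simpa using hy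
  have hn : ‖ε • y‖ ≤ ε := by
    rw [norm_smul, Real.norm_of_nonneg hε.le]; exact mul_le_of_le_one_right hε.le hy1
  have := hball (ε • y) (by simpa using hn.trans_lt hεr)
  rw [abs_div, abs_of_pos (by positivity : 0 < ε ^ 2), div_le_iff₀ (by positivity)]
  rw [Real.norm_eq_abs, norm_pow, norm_norm] at this
  exact this.trans (by gcongr)

theorem isBigO_of_sub_isLittleO {f G : Euc n → ℝ}
    (hf : (fun x => f x - G x) =o[𝓝 0] fun x => ‖x‖ ^ 2)
    (hG : G =O[𝓝 0] fun x => ‖x‖ ^ 2) : f =O[𝓝 0] fun x => ‖x‖ ^ 2 :=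
  (hf.isBigO.add hG).congr_left fun x => by ring

theorem diagForm_isBigO (κ : Fin n → ℝ) : diagForm κ =O[𝓝 0] fun x => ‖x‖ ^ 2 := by
  unfold diagForm
  refine Asymptotics.IsBigO.fun_sum fun i _ => Asymptotics.IsBigO.const_mul_left ?_ _
  have : (fun x : Euc n => x i) =O[𝓝 0] fun x : Euc n => ‖x‖ :=
    Asymptotics.IsBigO.of_bound 1 (Eventually.of_forall fun x => by
      simpa using PiLp.norm_apply_le x i)
  exact this.pow 2

@[fun_prop]
theorem continuous_diagForm (κ : Fin n → ℝ) : Continuous (diagForm κ) := by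
  unfold diagForm; fun_prop

/-- Hypotheses on the height function `h` of a hypersurface with principal curvatures `κ` and its
volume density `w`. -/
structure IsGraphData (κ : Fin n → ℝ) (h w : Euc n → ℝ) : Prop where
  measurable_height : Measurable h
  measurable_density : Measurable w
  height : (fun x => h x - diagForm κ x / 2) =o[𝓝 0] fun x => ‖x‖ ^ 2
  density : (fun x => w x - 1 - diagForm (fun i => κ i ^ 2) x / 2) =o[𝓝 0] fun x => ‖x‖ ^ 2

namespace IsGraphData

variable (H : IsGraphData κ h w)
include H

theorem tendsto_height {y : Euc n} {z : ℝ → Euc n} (hz : Tendsto z (𝓝[>] 0) (𝓝 y)) :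
    Tendsto (fun ε => h (ε • z ε) / ε ^ 2) (𝓝[>] 0) (𝓝 (diagForm κ y / 2)) :=
  tendsto_rescaled H.height (by fun_prop) (fun r x => by rw [diagForm_smul]; ring) hz

theorem tendsto_density_sub_one (y : Euc n) :
    Tendsto (fun ε : ℝ => (w (ε • y) - 1) / ε ^ 2) (𝓝[>] 0)
      (𝓝 (diagForm (fun i => κ i ^ 2) y / 2)) :=
  tendsto_rescaled (f := fun x => w x - 1) H.density (by fun_prop)
    (fun r x => by rw [diagForm_smul]; ring) (tendsto_const_nhds (x := y))

theorem tendsto_density (y : Euc n) :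
    Tendsto (fun ε : ℝ => w (ε • y)) (𝓝[>] 0) (𝓝 1) := by
  have := ((H.tendsto_density_sub_one y).mul (tendsto_id_nhdsGT.pow 2)).const_add 1
  rw [zero_pow two_ne_zero, mul_zero, add_zero] at this
  refine this.congr' ?_
  filter_upwards [eventually_pos] with ε hε
  field_simp; ring

theorem height_bounded :
    ∃ C > 0, ∀ᶠ ε : ℝ in 𝓝[>] 0, ∀ y ∈ Metric.closedBall (0 : Euc n) 1, |h (ε • y) / ε ^ 2| ≤ C :=
  rescaled_bounded (isBigO_of_sub_isLittleO H.height
    (((diagForm_isBigO κ).const_mul_left (1 / 2)).congr_left fun x => by ring))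

theorem density_sub_one_bounded :
    ∃ C > 0, ∀ᶠ ε : ℝ in 𝓝[>] 0, ∀ y ∈ Metric.closedBall (0 : Euc n) 1,
      |(w (ε • y) - 1) / ε ^ 2| ≤ C :=
  rescaled_bounded (f := fun x => w x - 1) (isBigO_of_sub_isLittleO H.density
    (((diagForm_isBigO fun i => κ i ^ 2).const_mul_left (1 / 2)).congr_left fun x => by ring))

theorem density_bounded :
    ∀ᶠ ε : ℝ in 𝓝[>] 0, ∀ y ∈ Metric.closedBall (0 : Euc n) 1, |w (ε • y)| ≤ 2 := by
  obtain ⟨C, hC, hb⟩ := H.density_sub_one_bounded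
  have : Tendsto (fun ε : ℝ => C * ε ^ 2) (𝓝[>] 0) (𝓝 0) := by
    simpa using (tendsto_id_nhdsGT.pow 2).const_mul C
  filter_upwards [hb, eventually_pos, this.eventually_lt_const one_pos] with ε h1 hε h2 y hy
  have := h1 y hy
  rw [abs_div, abs_of_pos (by positivity : 0 < ε ^ 2), div_le_iff₀ (by positivity)] at this
  have := (abs_le.1 (this.trans h2.le))
  rw [abs_le]; constructor <;> linarith

theorem eventually_mem_scaledPatch {y : Euc n} (hy : ‖y‖ < 1) :
    ∀ᶠ ε in 𝓝[>] 0, y ∈ scaledPatch h ε := by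
  have h1 := H.tendsto_height (tendsto_const_nhds (x := y))
  have h2 : Tendsto (fun ε => ‖y‖ ^ 2 + ε ^ 2 * (h (ε • y) / ε ^ 2) ^ 2) (𝓝[>] 0)
      (𝓝 (‖y‖ ^ 2)) := by
    simpa using ((tendsto_id_nhdsGT.pow 2).mul (h1.pow 2)).const_add (‖y‖ ^ 2)
  have h3 : ‖y‖ ^ 2 < 1 := by nlinarith [norm_nonneg y]
  filter_upwards [h2.eventually_lt_const h3, eventually_pos] with ε h4 hε
  refine le_trans (le_of_eq ?_) h4.le
  field_simp

/-- Limits of integrals over the rescaled patches, which converge to the unit ball. -/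
theorem tendsto_setIntegral {G : ℝ → Euc n → ℝ} {G₀ : Euc n → ℝ}
    (hm : ∀ ε, Measurable (G ε)) {M : ℝ}
    (hb : ∀ᶠ ε in 𝓝[>] 0, ∀ y ∈ Metric.closedBall (0 : Euc n) 1, |G ε y| ≤ M)
    (hl : ∀ y, Tendsto (fun ε => G ε y) (𝓝[>] 0) (𝓝 (G₀ y))) :
    Tendsto (fun ε => ∫ y in scaledPatch h ε, G ε y) (𝓝[>] 0)
      (𝓝 (∫ y in Metric.closedBall 0 1, G₀ y)) := by
  have hms := measurableSet_scaledPatch H.measurable_height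
  simp only [← integral_indicator (hms _), ← integral_indicator measurableSet_closedBall]
  refine tendsto_integral_filter_of_dominated_convergence
    ((Metric.closedBall (0 : Euc n) 1).indicator fun _ => M) ?_ ?_ ?_ ?_
  · exact Eventually.of_forall fun ε => ((hm ε).indicator (hms ε)).aestronglyMeasurable
  · filter_upwards [hb] with ε hε
    refine Eventually.of_forall fun y => ?_
    by_cases hy : y ∈ scaledPatch h ε
    · rw [indicator_of_mem hy, indicator_of_mem (scaledPatch_subset h ε hy)]
      exact hε y (scaledPatch_subset h ε hy)
    · rw [indicator_of_notMem hy, norm_zero]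
      refine indicator_nonneg (fun z hz => (abs_nonneg _).trans (hε z hz)) _
  · rw [integrable_indicator_iff measurableSet_closedBall]
    exact integrableOn_const measure_closedBall_lt_top.ne
  · rcases Nat.eq_zero_or_pos n with rfl | hn
    · refine Eventually.of_forall fun y => ?_
      have hy : ‖y‖ < 1 := by rw [Subsingleton.elim y 0]; simp
      rw [indicator_of_mem (by simpa using hy.le)]
      refine (hl y).congr' ?_
      filter_upwards [H.eventually_mem_scaledPatch hy] with ε hε
      rw [indicator_of_mem hε]
    have : Nonempty (Fin n) := ⟨⟨0, hn⟩⟩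
    -- points of the unit sphere, where the indicators need not converge, form a null set
    have hs : ∀ᵐ y : Euc n, y ∉ Metric.sphere (0 : Euc n) 1 :=
      compl_mem_ae_iff.2 (Measure.addHaar_sphere volume 0 1)
    filter_upwards [hs] with y hy
    rcases lt_or_gt_of_ne (by simpa using hy : ‖y‖ ≠ 1) with h1 | h1
    · rw [indicator_of_mem (by simpa using h1.le)]
      refine (hl y).congr' ?_
      filter_upwards [H.eventually_mem_scaledPatch h1] with ε hε
      rw [indicator_of_mem hε]
    · have h2 : y ∉ Metric.closedBall (0 : Euc n) 1 := by simpa using h1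
      rw [indicator_of_notMem h2]
      refine tendsto_const_nhds.congr fun ε => ?_
      rw [indicator_of_notMem fun h3 => h2 (scaledPatch_subset h ε h3)]

end IsGraphData

end Asymptotics

/-! ### The shell between the rescaled patch and the unit ball -/

section Shell

variable {n : ℕ} {h w : Euc n → ℝ} {κ : Fin n → ℝ}

/-- Polar coordinates as an iterated integral. -/
theorem integral_polar_iterated (hn : 1 ≤ n) {f : Euc n → ℝ} (hf : Integrable f) :
    ∫ x, f x = ∫ θ, ∫ r in Ioi (0 : ℝ), r ^ (n - 1) * f (r • (θ : Euc n)) ∂volume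
      ∂sphereMeasure n := by
  have h1 : Integrable (fun z : Metric.sphere (0 : Euc n) 1 × Ioi (0 : ℝ) =>
      f ((z.2 : ℝ) • (z.1 : Euc n)))
      ((sphereMeasure n).prod (Measure.volumeIoiPow (n - 1))) := by
    have := ((volume : Measure (Euc n)).measurePreserving_homeomorphUnitSphereProd).symm
      (homeomorphUnitSphereProd (Euc n)).toMeasurableEquiv
    rw [finrank_euclideanSpace_fin] at this
    have h2 : Integrable (fun x : ({(0)}ᶜ : Set (Euc n)) => f x)
        ((volume : Measure (Euc n)).comap Subtype.val) := by
      have := (integrableOn_iff_comap_subtypeVal (f := f) (μ := volume)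
        (measurableSet_singleton (0 : Euc n)).compl).1 hf.integrableOn
      exact this
    have h3 := (this.integrable_comp_emb (MeasurableEquiv.measurableEmbedding _)).2 h2
    refine h3.congr (Eventually.of_forall fun z => ?_)
    simp
  rw [integral_polar hn, integral_prod _ h1]
  refine integral_congr_ae (Eventually.of_forall fun θ => ?_)
  exact integral_volumeIoiPow (n - 1) fun r => f (r • (θ : Euc n))

/-- The substitution `r = 1 - c u`, which blows up a neighbourhood of the unit sphere. -/
theorem integral_comp_one_sub_mul (F : ℝ → ℝ) {c : ℝ} (hc : 0 < c) :
    ∫ u, F (1 - c * u) = c⁻¹ * ∫ r, F r := by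
  have := Measure.integral_comp_mul_left (fun v => F (1 - v)) c
  rw [integral_sub_left_eq_self F volume 1, abs_of_pos (by positivity), smul_eq_mul] at this
  exact this

/-- The integrand over the shell between the rescaled patch and the unit sphere, in the blown-up
radial variable `u`. -/
noncomputable def shellIntegrand (h g : Euc n → ℝ) (ε : ℝ) (θ : Euc n) (u : ℝ) : ℝ :=
  (Ioi (0 : ℝ)).indicator (fun r => r ^ (n - 1) *
    (Metric.closedBall 0 1 \ scaledPatch h ε).indicator g (r • θ)) (1 - ε ^ 2 * u)

theorem setIntegral_sub_eq_shell (hn : 1 ≤ n) (hh : Measurable h) {g : Euc n → ℝ}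
    (hg : Continuous g) {ε : ℝ} (hε : 0 < ε) :
    ((∫ y in Metric.closedBall 0 1, g y) - ∫ y in scaledPatch h ε, g y) / ε ^ 2 =
      ∫ θ, ∫ u, shellIntegrand h g ε (θ : Euc n) u ∂volume ∂sphereMeasure n := by
  have hms := measurableSet_scaledPatch hh ε
  have hgi : IntegrableOn g (Metric.closedBall 0 1) :=
    hg.continuousOn.integrableOn_compact (isCompact_closedBall 0 1)
  have hm : MeasurableSet (Metric.closedBall (0 : Euc n) 1 \ scaledPatch h ε) :=
    measurableSet_closedBall.diff hms
  rw [← setIntegral_sdiff hms hgi (scaledPatch_subset h ε),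
    ← integral_indicator hm, integral_polar_iterated hn
      ((integrable_indicator_iff hm).2 (hgi.mono_set sdiff_subset)), div_eq_inv_mul,
    ← integral_const_mul]
  refine integral_congr_ae (Eventually.of_forall fun θ => ?_)
  have := integral_comp_one_sub_mul ((Ioi (0 : ℝ)).indicator (fun r => r ^ (n - 1) *
    (Metric.closedBall 0 1 \ scaledPatch h ε).indicator g (r • (θ : Euc n))))
    (by positivity : 0 < ε ^ 2)
  rw [integral_indicator measurableSet_Ioi] at this
  exact this.symm

namespace IsGraphData

variable (H : IsGraphData κ h w)
include H

/-- In the limit the shell in the direction `θ` is the interval of `u` between `0` and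
`(diagForm κ θ / 2) ^ 2 / 2`. The two endpoints are excluded. -/
theorem tendsto_shellIntegrand {g : Euc n → ℝ} (hg : Continuous g) {θ : Euc n} (hθ : ‖θ‖ = 1)
    {u : ℝ} (hu0 : u ≠ 0) (hu : u ≠ (diagForm κ θ / 2) ^ 2 / 2) :
    Tendsto (fun ε => shellIntegrand h g ε θ u) (𝓝[>] 0)
      (𝓝 ((Icc 0 ((diagForm κ θ / 2) ^ 2 / 2)).indicator (fun _ => g θ) u)) := by
  set a := (diagForm κ θ / 2) ^ 2 with ha
  have hr : Tendsto (fun ε : ℝ => 1 - ε ^ 2 * u) (𝓝[>] 0) (𝓝 1) := by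
    simpa using ((tendsto_id_nhdsGT.pow 2).mul_const u).const_sub 1
  have hrθ : Tendsto (fun ε : ℝ => (1 - ε ^ 2 * u) • θ) (𝓝[>] 0) (𝓝 θ) := by
    simpa using hr.smul_const θ
  have hX := (H.tendsto_height hrθ).pow 2
  rw [← ha] at hX
  have hR : Tendsto (fun ε : ℝ => 2 * u - ε ^ 2 * u ^ 2) (𝓝[>] 0) (𝓝 (2 * u)) := by
    simpa using ((tendsto_id_nhdsGT.pow 2).mul_const (u ^ 2)).const_sub (2 * u)
  have hpos := hr.eventually_const_lt one_pos
  -- membership of `r θ` in the patch, with `r = 1 - ε² u`, in terms of `h (ε r θ) / ε²`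
  have hmem : ∀ ε : ℝ, 0 < ε → 0 < 1 - ε ^ 2 * u → ((1 - ε ^ 2 * u) • θ ∈ scaledPatch h ε ↔
      (h (ε • (1 - ε ^ 2 * u) • θ) / ε ^ 2) ^ 2 ≤ 2 * u - ε ^ 2 * u ^ 2) := by
    intro ε hε h1
    have e2 : 0 < ε ^ 2 := by positivity
    simp only [scaledPatch, mem_ofPred_eq, norm_smul, hθ, mul_one, Real.norm_of_nonneg h1.le]
    rw [← mul_le_mul_iff_right₀ e2 (b := (h (ε • (1 - ε ^ 2 * u) • θ) / ε ^ 2) ^ 2)]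
    have : ε ^ 2 * (h (ε • (1 - ε ^ 2 * u) • θ) / ε ^ 2) ^ 2
        = (h (ε • (1 - ε ^ 2 * u) • θ) / ε) ^ 2 := by field_simp
    rw [this]
    constructor <;> intro hh <;> nlinarith
  rcases lt_or_gt_of_ne hu0 with hneg | hupos
  · -- outside the unit ball
    rw [indicator_of_notMem (fun hh => absurd hh.1 (not_le.2 hneg))]
    refine tendsto_const_nhds.congr' ?_
    filter_upwards [hpos, eventually_pos] with ε h1 hε
    rw [shellIntegrand, indicator_of_mem (mem_Ioi.2 h1), indicator_of_notMem, mul_zero]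
    rintro ⟨hb, -⟩
    rw [mem_closedBall_zero_iff, norm_smul, hθ, mul_one, Real.norm_of_nonneg h1.le] at hb
    nlinarith [mul_neg_of_pos_of_neg (by positivity : 0 < ε ^ 2) hneg]
  · rcases lt_or_gt_of_ne hu with hlt | hgt
    · -- in the shell
      rw [indicator_of_mem (mem_Icc.2 ⟨hupos.le, hlt.le⟩)]
      have h3 : Tendsto (fun ε : ℝ => (1 - ε ^ 2 * u) ^ (n - 1) * g ((1 - ε ^ 2 * u) • θ))
          (𝓝[>] 0) (𝓝 (g θ)) := by
        simpa using (hr.pow (n - 1)).mul (hg.continuousAt.tendsto.comp hrθ)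
      refine h3.congr' ?_
      filter_upwards [hpos, eventually_pos, hR.eventually_lt hX (by linarith)] with ε h1 hε h2
      rw [shellIntegrand, indicator_of_mem (mem_Ioi.2 h1), indicator_of_mem]
      refine ⟨?_, fun hc => absurd ((hmem ε hε h1).1 hc) (not_le.2 h2)⟩
      rw [mem_closedBall_zero_iff, norm_smul, hθ, mul_one, Real.norm_of_nonneg h1.le]
      nlinarith [mul_pos (by positivity : 0 < ε ^ 2) hupos]
    · -- inside the patch
      rw [indicator_of_notMem (fun hh => absurd hh.2 (not_le.2 hgt))]
      refine tendsto_const_nhds.congr' ?_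
      filter_upwards [hpos, eventually_pos, hX.eventually_lt hR (by linarith)] with ε h1 hε h2
      rw [shellIntegrand, indicator_of_mem (mem_Ioi.2 h1), indicator_of_notMem, mul_zero]
      exact fun hc => hc.2 ((hmem ε hε h1).2 h2.le)

/-- The blown-up shells stay in a bounded region, uniformly in the direction. -/
theorem shellIntegrand_bounded {g : Euc n → ℝ} {M : ℝ}
    (hM : ∀ y ∈ Metric.closedBall (0 : Euc n) 1, |g y| ≤ M) :
    ∃ C : ℝ, ∀ᶠ ε : ℝ in 𝓝[>] 0, ∀ θ : Euc n, ‖θ‖ = 1 → ∀ u,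
      |shellIntegrand h g ε θ u| ≤ (Icc 0 C).indicator (fun _ => M) u := by
  obtain ⟨C, hC, hb⟩ := H.height_bounded
  have hM0 : 0 ≤ M := (abs_nonneg _).trans (hM 0 (by simp))
  refine ⟨C ^ 2, ?_⟩
  filter_upwards [hb, eventually_pos] with ε hε hpos θ hθ u
  have e2 : 0 < ε ^ 2 := by positivity
  have hnn : 0 ≤ (Icc 0 (C ^ 2)).indicator (fun _ => M) u := indicator_nonneg (fun _ _ => hM0) _
  by_cases h1 : 0 < 1 - ε ^ 2 * u
  · rw [shellIntegrand, indicator_of_mem (mem_Ioi.2 h1)]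
    by_cases h2 : (1 - ε ^ 2 * u) • θ ∈ Metric.closedBall 0 1 \ scaledPatch h ε
    · have h3 := h2.1
      have h4 := hε _ h2.1
      rw [mem_closedBall_zero_iff, norm_smul, hθ, mul_one, Real.norm_of_nonneg h1.le] at h3
      have h5 : ¬ _ := h2.2
      simp only [scaledPatch, mem_ofPred_eq, norm_smul, hθ, mul_one, Real.norm_of_nonneg h1.le,
        not_le] at h5
      have h6 : (h (ε • (1 - ε ^ 2 * u) • θ) / ε) ^ 2
          = ε ^ 2 * (h (ε • (1 - ε ^ 2 * u) • θ) / ε ^ 2) ^ 2 := by field_simp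
      have h7 : (h (ε • (1 - ε ^ 2 * u) • θ) / ε ^ 2) ^ 2 ≤ C ^ 2 := by
        rw [← sq_abs]; gcongr
      have hu0 : 0 ≤ u := by
        by_contra hc
        nlinarith [mul_neg_of_pos_of_neg e2 (not_le.1 hc)]
      have hu1 : u ≤ C ^ 2 := by
        rw [h6] at h5
        have : ε ^ 2 * u ≤ ε ^ 2 * C ^ 2 := by
          nlinarith [mul_nonneg e2.le hu0, mul_le_mul_of_nonneg_left h7 e2.le]
        exact le_of_mul_le_mul_left this e2
      rw [indicator_of_mem h2, indicator_of_mem (mem_Icc.2 ⟨hu0, hu1⟩), abs_mul,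
        abs_of_nonneg (by positivity)]
      calc (1 - ε ^ 2 * u) ^ (n - 1) * |g ((1 - ε ^ 2 * u) • θ)| ≤ 1 * M := by
            gcongr
            · exact pow_le_one₀ h1.le h3
            · exact hM _ h2.1
        _ = M := one_mul M
    · rw [indicator_of_notMem h2, mul_zero, abs_zero]; exact hnn
  · rw [shellIntegrand, indicator_of_notMem (by simpa using h1), abs_zero]; exact hnn

omit H in
theorem measurable_shellIntegrand (hh : Measurable h) {g : Euc n → ℝ} (hg : Continuous g) (ε : ℝ) :
    Measurable fun z : Metric.sphere (0 : Euc n) 1 × ℝ =>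
      shellIntegrand h g ε (z.1 : Euc n) z.2 := by
  have hm : MeasurableSet (Metric.closedBall (0 : Euc n) 1 \ scaledPatch h ε) :=
    measurableSet_closedBall.diff (measurableSet_scaledPatch hh ε)
  have h1 : Measurable ((Metric.closedBall 0 1 \ scaledPatch h ε).indicator g) :=
    hg.measurable.indicator hm
  have h2 : Measurable fun z : Metric.sphere (0 : Euc n) 1 × ℝ => 1 - ε ^ 2 * z.2 := by fun_prop
  have h3 : Measurable fun z : Metric.sphere (0 : Euc n) 1 × ℝ =>
      (1 - ε ^ 2 * z.2) • (z.1 : Euc n) := by fun_prop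
  have h4 : MeasurableSet ((fun z : Metric.sphere (0 : Euc n) 1 × ℝ => 1 - ε ^ 2 * z.2) ⁻¹'
      Ioi 0) := h2 measurableSet_Ioi
  exact ((h2.pow_const (n - 1)).mul (h1.comp h3)).indicator h4

/-- The shell between the rescaled patch and the unit sphere has thickness
`ε ^ 2 (diagForm κ θ / 2) ^ 2 / 2` to leading order in the direction `θ`. -/
theorem tendsto_shell (hn : 1 ≤ n) {g : Euc n → ℝ} (hg : Continuous g) :
    Tendsto (fun ε => ((∫ y in Metric.closedBall 0 1, g y) - ∫ y in scaledPatch h ε, g y) / ε ^ 2)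
      (𝓝[>] 0) (𝓝 ((∫ θ, g θ * diagForm κ θ ^ 2 ∂sphereMeasure n) / 8)) := by
  obtain ⟨M, hM⟩ := (isCompact_closedBall (0 : Euc n) 1).exists_bound_of_continuousOn
    hg.continuousOn
  obtain ⟨C, hC⟩ := H.shellIntegrand_bounded hM
  have hmeas := measurable_shellIntegrand H.measurable_height hg
  have hind : Integrable ((Icc 0 C).indicator fun _ : ℝ => M) := by
    rw [integrable_indicator_iff measurableSet_Icc]
    exact integrableOn_const measure_Icc_lt_top.ne
  have key : Tendsto (fun ε => ∫ θ, ∫ u, shellIntegrand h g ε (θ : Euc n) u ∂volume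
      ∂sphereMeasure n) (𝓝[>] 0) (𝓝 (∫ θ, (diagForm κ (θ : Euc n) / 2) ^ 2 / 2 * g θ
      ∂sphereMeasure n)) := by
    refine tendsto_integral_filter_of_dominated_convergence
      (fun _ => ∫ u, (Icc 0 C).indicator (fun _ => M) u) ?_ ?_ (integrable_const _) ?_
    · exact Eventually.of_forall fun ε =>
        (hmeas ε).stronglyMeasurable.integral_prod_right.aestronglyMeasurable
    · filter_upwards [hC] with ε hε
      refine Eventually.of_forall fun θ => ?_
      exact norm_integral_le_of_norm_le hind (Eventually.of_forall fun u =>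
        hε θ (norm_eq_of_mem_sphere θ) u)
    · refine Eventually.of_forall fun θ => ?_
      have hval : (diagForm κ (θ : Euc n) / 2) ^ 2 / 2 * g θ
          = ∫ u, (Icc 0 ((diagForm κ (θ : Euc n) / 2) ^ 2 / 2)).indicator (fun _ => g θ) u := by
        rw [integral_indicator measurableSet_Icc, setIntegral_const, smul_eq_mul, Measure.real,
          Real.volume_Icc, ENNReal.toReal_ofReal (by rw [sub_zero]; positivity), sub_zero]
      rw [hval]
      refine tendsto_integral_filter_of_dominated_convergence
        ((Icc 0 C).indicator fun _ => M) ?_ ?_ hind ?_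
      · exact Eventually.of_forall fun ε =>
          ((hmeas ε).comp measurable_prodMk_left).aestronglyMeasurable
      · filter_upwards [hC] with ε hε
        exact Eventually.of_forall fun u => hε θ (norm_eq_of_mem_sphere θ) u
      · have h1 : ∀ x : ℝ, ∀ᵐ u : ℝ, u ≠ x := fun x => compl_mem_ae_iff.2 (measure_singleton x)
        filter_upwards [h1 0, h1 ((diagForm κ (θ : Euc n) / 2) ^ 2 / 2)] with u hu0 hu
        exact H.tendsto_shellIntegrand hg (norm_eq_of_mem_sphere θ) hu0 hu
  have e : ∫ θ, (diagForm κ (θ : Euc n) / 2) ^ 2 / 2 * g θ ∂sphereMeasure n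
      = (∫ θ, g θ * diagForm κ θ ^ 2 ∂sphereMeasure n) / 8 := by
    rw [← integral_div]
    refine integral_congr_ae (Eventually.of_forall fun θ => ?_)
    simp only; ring
  rw [← e]
  refine key.congr' ?_
  filter_upwards [eventually_pos] with ε hε
  exact (setIntegral_sub_eq_shell hn H.measurable_height hg hε).symm

/-- Second order expansion of weighted integrals over the rescaled patches: the first term comes
from the volume density, the second one from the shell. -/
theorem tendsto_setIntegral_density (hn : 1 ≤ n) {g : Euc n → ℝ} (hg : Continuous g) :
    Tendsto (fun ε : ℝ => ((∫ y in scaledPatch h ε, g y * w (ε • y))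
        - ∫ y in Metric.closedBall 0 1, g y) / ε ^ 2) (𝓝[>] 0)
      (𝓝 ((∫ y in Metric.closedBall 0 1, g y * diagForm (fun i => κ i ^ 2) y) / 2
        - (∫ θ, g θ * diagForm κ θ ^ 2 ∂sphereMeasure n) / 8)) := by
  obtain ⟨M, hM⟩ := (isCompact_closedBall (0 : Euc n) 1).exists_bound_of_continuousOn
    hg.continuousOn
  have hM0 : 0 ≤ M := (norm_nonneg _).trans (hM 0 (by simp))
  obtain ⟨C, hC0, hC⟩ := H.density_sub_one_bounded
  have hwm : ∀ ε : ℝ, Measurable fun y => w (ε • y) := fun ε =>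
    H.measurable_density.comp (by fun_prop)
  have hGm : ∀ ε : ℝ, Measurable fun y => g y * ((w (ε • y) - 1) / ε ^ 2) := fun ε =>
    hg.measurable.mul (((hwm ε).sub_const 1).div_const _)
  have hGb : ∀ᶠ ε : ℝ in 𝓝[>] 0, ∀ y ∈ Metric.closedBall (0 : Euc n) 1,
      |g y * ((w (ε • y) - 1) / ε ^ 2)| ≤ M * C := by
    filter_upwards [hC] with ε hε y hy
    rw [abs_mul]
    exact mul_le_mul (hM y hy) (hε y hy) (abs_nonneg _) hM0
  have h1 := H.tendsto_setIntegral (G := fun ε y => g y * ((w (ε • y) - 1) / ε ^ 2)) hGm hGb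
    (fun y => (H.tendsto_density_sub_one y).const_mul (g y))
  have h2 := h1.sub (H.tendsto_shell hn hg)
  have e : ∫ y in Metric.closedBall 0 1, g y * (diagForm (fun i => κ i ^ 2) y / 2)
      = (∫ y in Metric.closedBall 0 1, g y * diagForm (fun i => κ i ^ 2) y) / 2 := by
    rw [← integral_div]
    refine integral_congr_ae (Eventually.of_forall fun θ => ?_)
    simp only; ring
  rw [e] at h2
  refine h2.congr' ?_
  filter_upwards [eventually_pos, hGb] with ε hε hb
  have hsub := scaledPatch_subset h ε
  have hgi : IntegrableOn g (scaledPatch h ε) :=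
    (hg.continuousOn.integrableOn_compact (isCompact_closedBall 0 1)).mono_set hsub
  have hGi : IntegrableOn (fun y => g y * ((w (ε • y) - 1) / ε ^ 2)) (scaledPatch h ε) := by
    refine Measure.integrableOn_of_bounded (M := M * C)
      ((measure_mono hsub).trans_lt measure_closedBall_lt_top).ne (hGm ε).aestronglyMeasurable ?_
    exact ae_restrict_of_forall_mem (measurableSet_scaledPatch H.measurable_height ε)
      fun y hy => hb y (hsub hy)
  have : ∫ y in scaledPatch h ε, g y * w (ε • y) = (∫ y in scaledPatch h ε, g y)
      + ε ^ 2 * ∫ y in scaledPatch h ε, g y * ((w (ε • y) - 1) / ε ^ 2) := by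
    rw [← integral_const_mul, ← integral_add hgi (hGi.const_mul _)]
    refine integral_congr_ae (Eventually.of_forall fun y => ?_)
    simp only; field_simp; ring
  rw [this]
  field_simp
  ring

end IsGraphData

end Shell

/-! ### Expansions of the moments of a patch -/

section PatchMoments

variable {n : ℕ} {h w : Euc n → ℝ} {κ : Fin n → ℝ}

namespace IsGraphData

variable (H : IsGraphData κ h w)
include H

/-- Leading order of weighted integrals of a function that is homogeneous of degree `k` to leading
order. -/
theorem tendsto_flatPatch {F F₀ : Euc n → ℝ} (hF : Measurable F) (k : ℕ) {M : ℝ}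
    (hb : ∀ᶠ ε in 𝓝[>] 0, ∀ y ∈ Metric.closedBall (0 : Euc n) 1, |F (ε • y) / ε ^ k| ≤ M)
    (hl : ∀ y, Tendsto (fun ε => F (ε • y) / ε ^ k) (𝓝[>] 0) (𝓝 (F₀ y))) :
    Tendsto (fun ε => (∫ x in flatPatch h ε, F x * w x) / ε ^ (n + k)) (𝓝[>] 0)
      (𝓝 (∫ y in Metric.closedBall 0 1, F₀ y)) := by
  have h1 := H.tendsto_setIntegral (G := fun ε y => F (ε • y) / ε ^ k * w (ε • y)) (G₀ := F₀)
    (M := M * 2) (fun ε => ((hF.comp (by fun_prop)).div_const _).mul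
      (H.measurable_density.comp (by fun_prop))) (by
      filter_upwards [hb, H.density_bounded] with ε h1 h2 y hy
      rw [abs_mul]
      exact mul_le_mul (h1 y hy) (h2 y hy) (abs_nonneg _) ((abs_nonneg _).trans (h1 y hy)))
    (fun y => by simpa using (hl y).mul (H.tendsto_density y))
  refine h1.congr' ?_
  filter_upwards [eventually_pos] with ε hε
  rw [setIntegral_flatPatch H.measurable_height hε, pow_add, mul_div_mul_left _ _ (by positivity),
    ← integral_div]
  refine integral_congr_ae (Eventually.of_forall fun y => ?_)
  simp only; ring

theorem tendsto_volume :
    Tendsto (fun ε => (∫ x in flatPatch h ε, w x) / ε ^ n) (𝓝[>] 0) (𝓝 (unitVol n)) := by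
  have := H.tendsto_flatPatch (F := fun _ => 1) (F₀ := fun _ => 1) measurable_const 0 (M := 1)
    (Eventually.of_forall fun ε y _ => by simp) (fun y => by simp)
  simpa [unitVol] using this

theorem tendsto_height_moment (hn : 1 ≤ n) :
    Tendsto (fun ε => (∫ x in flatPatch h ε, h x * w x) / ε ^ (n + 2)) (𝓝[>] 0)
      (𝓝 ((∑ i, κ i) * (unitVol n / (n + 2)) / 2)) := by
  obtain ⟨C, -, hC⟩ := H.height_bounded
  have := H.tendsto_flatPatch H.measurable_height 2 hC
    (fun y => H.tendsto_height (tendsto_const_nhds (x := y)))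
  rwa [integral_div, ball_moment_diagForm hn] at this

theorem tendsto_height_sq_moment (hn : 1 ≤ n) :
    Tendsto (fun ε => (∫ x in flatPatch h ε, h x ^ 2 * w x) / ε ^ (n + 4)) (𝓝[>] 0)
      (𝓝 (((∑ i, κ i) ^ 2 + 2 * ∑ i, κ i ^ 2) * (unitVol n / ((n + 2) * (n + 4))) / 4)) := by
  obtain ⟨C, -, hC⟩ := H.height_bounded
  have e : ∀ (ε : ℝ) (y : Euc n), h (ε • y) ^ 2 / ε ^ 4 = (h (ε • y) / ε ^ 2) ^ 2 := fun ε y => by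
    rw [div_pow, ← pow_mul]
  have := H.tendsto_flatPatch (F := fun x => h x ^ 2) (F₀ := fun x => diagForm κ x ^ 2 / 4)
    (H.measurable_height.pow_const 2) 4 (M := C ^ 2)
    (by
      filter_upwards [hC] with ε hε y hy
      rw [e, abs_pow]
      exact pow_le_pow_left₀ (abs_nonneg _) (hε y hy) 2)
    (fun y => by
      have h1 := (H.tendsto_height (tendsto_const_nhds (x := y))).pow 2
      simp only [e]
      convert h1 using 2; ring)
  rwa [integral_div, ball_moment_diagForm_sq hn] at this

theorem tendsto_coord_height_moment (μ : Fin n) :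
    Tendsto (fun ε => (∫ x in flatPatch h ε, x μ * h x * w x) / ε ^ (n + 3)) (𝓝[>] 0) (𝓝 0) := by
  obtain ⟨C, -, hC⟩ := H.height_bounded
  have e : ∀ (ε : ℝ), 0 < ε → ∀ (y : Euc n),
      (ε • y) μ * h (ε • y) / ε ^ 3 = y μ * (h (ε • y) / ε ^ 2) := fun ε hε y => by
    rw [PiLp.smul_apply, smul_eq_mul]; field_simp
  have h1 := H.tendsto_flatPatch (F := fun x => x μ * h x) (F₀ := fun x => x μ * (diagForm κ x / 2))
    ((by fun_prop : Measurable fun x : Euc n => x μ).mul H.measurable_height) 3 (M := 1 * C)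
    (by
      filter_upwards [hC, eventually_pos] with ε hε h0 y hy
      rw [e ε h0, abs_mul]
      refine mul_le_mul ?_ (hε y hy) (abs_nonneg _) zero_le_one
      have h2 := PiLp.norm_apply_le y μ
      rw [Real.norm_eq_abs] at h2
      exact h2.trans (by simpa using hy))
    (fun y => by
      refine ((H.tendsto_height (tendsto_const_nhds (x := y))).const_mul (y μ)).congr' ?_
      filter_upwards [eventually_pos] with ε hε
      exact (e ε hε y).symm)
  rwa [ball_odd_moment] at h1
  intro x
  have := diagForm_smul κ (-1) x
  rw [neg_one_smul] at this
  rw [this, PiLp.neg_apply]; ring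

/-- By oddness the first moments have no term of order `ε ^ (n + 1)`. -/
theorem tendsto_coord_moment (hn : 1 ≤ n) (μ : Fin n) :
    Tendsto (fun ε => (∫ x in flatPatch h ε, x μ * w x) / ε ^ (n + 2)) (𝓝[>] 0) (𝓝 0) := by
  have h1 := H.tendsto_setIntegral_density hn (g := fun x => x μ) (by fun_prop)
  have h2 := tendsto_id_nhdsGT.mul h1
  rw [zero_mul] at h2
  refine h2.congr' ?_
  filter_upwards [eventually_pos] with ε hε
  rw [ball_odd_moment (fun x => by simp), sub_zero, setIntegral_flatPatch H.measurable_height hε,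
    pow_add, mul_div_mul_left _ _ (by positivity), ← mul_div_assoc, ← integral_const_mul]
  congr 1
  refine integral_congr_ae (Eventually.of_forall fun y => ?_)
  simp only [PiLp.smul_apply, smul_eq_mul]; ring

/-- The tangential second moments to second order. -/
theorem tendsto_coord_coord_moment (hn : 1 ≤ n) (μ ν : Fin n) :
    Tendsto (fun ε => ((∫ x in flatPatch h ε, x μ * x ν * w x)
        - if μ = ν then unitVol n / (n + 2) * ε ^ (n + 2) else 0) / ε ^ (n + 4)) (𝓝[>] 0)
      (𝓝 (if μ = ν then (2 * ∑ i, κ i ^ 2 - (∑ i, κ i) ^ 2 - 4 * (∑ i, κ i) * κ μ)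
        * (unitVol n / (8 * ((n + 2) * (n + 4)))) else 0)) := by
  have h1 := H.tendsto_setIntegral_density hn (g := fun x => x μ * x ν) (by fun_prop)
  rw [ball_moment_four hn, sphere_moment_six hn, ball_moment_two hn] at h1
  have e : (if μ = ν then (2 * ∑ i, κ i ^ 2 - (∑ i, κ i) ^ 2 - 4 * (∑ i, κ i) * κ μ)
        * (unitVol n / (8 * ((n + 2) * (n + 4)))) else 0) =
      (if μ = ν then (∑ i, κ i ^ 2 + 2 * κ μ ^ 2) * (unitVol n / ((n + 2) * (n + 4))) else 0) / 2
      - (if μ = ν then ((∑ i, κ i) ^ 2 + 2 * ∑ i, κ i ^ 2 + 4 * κ μ * (∑ i, κ i + 2 * κ μ))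
        * (unitVol n / ((n + 2) * (n + 4))) else 0) / 8 := by
    split_ifs <;> field_simp <;> ring
  rw [e]
  refine h1.congr' ?_
  filter_upwards [eventually_pos] with ε hε
  rw [setIntegral_flatPatch H.measurable_height hε]
  have e2 : ∫ y in scaledPatch h ε, (ε • y) μ * (ε • y) ν * w (ε • y)
      = ε ^ 2 * ∫ y in scaledPatch h ε, y μ * y ν * w (ε • y) := by
    rw [← integral_const_mul]
    refine integral_congr_ae (Eventually.of_forall fun y => ?_)
    simp only [PiLp.smul_apply, smul_eq_mul]; ring
  rw [e2]
  split_ifs <;> field_simp <;> ring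

end IsGraphData

end PatchMoments

/-! ### The covariance matrix -/

section Covariance

theorem eigenvalues_cast {E : Type*} [NormedAddCommGroup E] [InnerProductSpace ℝ E]
    [FiniteDimensional ℝ E] {T : E →ₗ[ℝ] E} (hT : T.IsSymmetric) {m k : ℕ}
    (hm : Module.finrank ℝ E = m) (hk : Module.finrank ℝ E = k) (hkm : k = m) (i : Fin k) :
    hT.eigenvalues hm (Fin.cast hkm i) = hT.eigenvalues hk i := by
  subst hkm; rfl

/-- Covariance eigenvalues as those of a symmetric operator. -/
theorem covarianceEigenvalue_eq {d : ℕ} (σ : Measure (Euc d)) (D : Set (Euc d)) (k : Fin d) :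
    covarianceEigenvalue σ D k = (Matrix.isSymmetric_toEuclideanLin_iff.mpr
      (covarianceMatrix_isHermitian σ D)).eigenvalues finrank_euclideanSpace_fin k := by
  rw [covarianceEigenvalue, Matrix.IsHermitian.eigenvalues₀]
  exact eigenvalues_cast _ _ _ _ k

theorem integral_centered_mul_centered {α : Type*} [MeasurableSpace α] {μ : Measure α}
    [IsFiniteMeasure μ] (hμ : μ.real univ ≠ 0) {f g : α → ℝ} (hf : Integrable f μ)
    (hg : Integrable g μ) (hfg : Integrable (fun x => f x * g x) μ) :
    ∫ x, (f x - (∫ y, f y ∂μ) / μ.real univ) * (g x - (∫ y, g y ∂μ) / μ.real univ) ∂μ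
      = (∫ x, f x * g x ∂μ) - (∫ x, f x ∂μ) * (∫ x, g x ∂μ) / μ.real univ := by
  set A := (∫ y, f y ∂μ) / μ.real univ with hA
  set B := (∫ y, g y ∂μ) / μ.real univ with hB
  have e : ∀ x, (f x - A) * (g x - B) = (f x * g x - B * f x) - (A * g x - A * B) := fun x => by
    ring
  simp only [e]
  have i1 : Integrable (fun x => f x * g x - B * f x) μ := hfg.sub (hf.const_mul B)
  have i2 : Integrable (fun x => A * g x - A * B) μ := (hg.const_mul A).sub (integrable_const _)
  rw [integral_sub i1 i2,
    integral_sub hfg (hf.const_mul B), integral_sub (hg.const_mul A) (integrable_const _),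
    integral_const_mul, integral_const_mul, integral_const, smul_eq_mul, hA, hB]
  field_simp
  ring

variable {d : ℕ} {σ : Measure (Euc d)} {D : Set (Euc d)} {p : Euc d} {ε : ℝ}

theorem integrable_of_subset_closedBall {F : Type*} [NormedAddCommGroup F]
    [SecondCountableTopology F] [MeasurableSpace F] [BorelSpace F]
    (hD : D ⊆ Metric.closedBall p ε) (hσ : σ D < ⊤) {f : Euc d → F}
    (hf : Continuous f) : IntegrableOn f D σ := by
  obtain ⟨C, hC⟩ := (isCompact_closedBall p ε).exists_bound_of_continuousOn hf.continuousOn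
  refine Measure.integrableOn_of_bounded hσ.ne hf.aestronglyMeasurable (M := C) ?_
  have : ∀ᵐ X ∂σ.restrict D, X ∈ Metric.closedBall p ε := by
    rw [ae_iff]
    change σ.restrict D (Metric.closedBall p ε)ᶜ = 0
    rw [Measure.restrict_apply measurableSet_closedBall.compl]
    convert measure_empty (μ := σ)
    rw [← disjoint_iff_inter_eq_empty]
    exact disjoint_compl_left_iff_subset.2 hD
  filter_upwards [this] with X hX using hC X hX

/-- The covariance form in terms of the moments around any base point `p`. -/
theorem inner_covarianceMatrix (hD : D ⊆ Metric.closedBall p ε) (h0 : 0 < σ D) (hσ : σ D < ⊤)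
    (u v : Euc d) :
    ⟪u, Matrix.toEuclideanLin (covarianceMatrix σ D) v⟫_ℝ
      = (∫ X in D, ⟪u, X - p⟫_ℝ * ⟪v, X - p⟫_ℝ ∂σ)
        - (∫ X in D, ⟪u, X - p⟫_ℝ ∂σ) * (∫ X in D, ⟪v, X - p⟫_ℝ ∂σ) / σ.real D := by
  have : IsFiniteMeasure (σ.restrict D) := ⟨by simpa using hσ⟩
  have hm : (σ.restrict D).real univ = σ.real D := by simp [Measure.real]
  have hm0 : σ.real D ≠ 0 := (ENNReal.toReal_pos h0.ne' hσ.ne).ne'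
  -- the linear functions centered at the barycenter are those at `p` minus their averages
  have hs : ∀ u X, ⟪u, X - barycenter σ D⟫_ℝ
      = ⟪u, X - p⟫_ℝ - (∫ X in D, ⟪u, X - p⟫_ℝ ∂σ) / σ.real D := fun u X => by
    have h1 : ∫ X in D, ⟪u, X - p⟫_ℝ ∂σ = ⟪u, ∫ X in D, (X - p) ∂σ⟫_ℝ :=
      integral_inner (integrable_of_subset_closedBall hD hσ (by fun_prop)) u
    rw [h1, integral_sub (f := fun X => X) (integrable_of_subset_closedBall hD hσ continuous_id)
      (integrable_const _), integral_const, hm, barycenter]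
    simp only [inner_sub_right, real_inner_smul_right]
    field_simp
    ring
  have hint : ∀ {f : Euc d → ℝ}, Continuous f → IntegrableOn f D σ := fun hf =>
    integrable_of_subset_closedBall hD hσ hf
  have e1 : ⟪u, Matrix.toEuclideanLin (covarianceMatrix σ D) v⟫_ℝ
      = ∫ X in D, ⟪u, X - barycenter σ D⟫_ℝ * ⟪v, X - barycenter σ D⟫_ℝ ∂σ := by
    have e2 : ∀ X, ⟪u, X - barycenter σ D⟫_ℝ * ⟪v, X - barycenter σ D⟫_ℝ
        = ∑ i, ∑ j, u i * v j * ((X i - barycenter σ D i) * (X j - barycenter σ D j)) :=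
      fun X => by
        simp only [PiLp.inner_apply, Finset.sum_mul_sum]
        refine Finset.sum_congr rfl fun i _ => Finset.sum_congr rfl fun j _ => ?_
        simp
        ring
    simp only [e2]
    rw [integral_finsetSum _ fun i _ => hint (by fun_prop), PiLp.inner_apply]
    refine Finset.sum_congr rfl fun i _ => ?_
    rw [integral_finsetSum _ fun i _ => hint (by fun_prop)]
    rw [Matrix.ofLp_toLpLin, Matrix.toLin'_apply, Matrix.mulVec, dotProduct]
    simp only [integral_const_mul]
    simp only [covarianceMatrix, Matrix.of_apply, RCLike.inner_apply, conj_trivial, Finset.sum_mul]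
    refine Finset.sum_congr rfl fun j _ => ?_
    ring
  rw [e1]
  simp only [hs]
  have := integral_centered_mul_centered (μ := σ.restrict D) (by rwa [hm])
    (hint (f := fun X => ⟪u, X - p⟫_ℝ) (by fun_prop))
    (hint (f := fun X => ⟪v, X - p⟫_ℝ) (by fun_prop)) (hint (by fun_prop))
  rwa [hm] at this

end Covariance

section Expansion

variable {n : ℕ} {b : OrthonormalBasis (Fin (n + 1)) ℝ (Euc (n + 1))} {p : Euc (n + 1)}
  {σ : Measure (Euc (n + 1))} {D : ℝ → Set (Euc (n + 1))} {h w : Euc n → ℝ} {κ : Fin n → ℝ}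

/-- `D ε` is the part in the closed `ε`-ball around `p` of a piece of hypersurface that carries the
measure `σ` and is parametrized by the graph of `h` with volume density `w`. -/
structure IsGraphPatch (b : OrthonormalBasis (Fin (n + 1)) ℝ (Euc (n + 1))) (p : Euc (n + 1))
    (σ : Measure (Euc (n + 1))) (D : ℝ → Set (Euc (n + 1))) (h w : Euc n → ℝ) : Prop where
  subset : ∀ ε, D ε ⊆ Metric.closedBall p ε
  integral : ∀ᶠ ε in 𝓝[>] (0 : ℝ), ∀ F : Euc (n + 1) → ℝ, Continuous F →
    ∫ X in D ε, F X ∂σ = ∫ x in flatPatch h ε, F (graphMap b p h x) * w x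

namespace IsGraphPatch

variable (hP : IsGraphPatch b p σ D h w)
include hP

theorem real_eq : ∀ᶠ ε in 𝓝[>] (0 : ℝ), σ.real (D ε) = ∫ x in flatPatch h ε, w x := by
  filter_upwards [hP.integral] with ε hε
  simpa [Measure.real] using hε (fun _ => 1) continuous_const

/-- A positive value of `σ.real` rules out infinite measure, as it would be `0` then. -/
theorem eventually_measure_pos_lt_top (H : IsGraphData κ h w) :
    ∀ᶠ ε in 𝓝[>] (0 : ℝ), 0 < σ (D ε) ∧ σ (D ε) < ⊤ := by
  filter_upwards [hP.real_eq, H.tendsto_volume.eventually_const_lt unitVol_pos, eventually_pos]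
    with ε h1 h2 hε
  rw [← h1] at h2
  have h3 : 0 < σ.real (D ε) := by
    by_contra hc
    exact absurd h2 (not_lt.2 (div_nonpos_of_nonpos_of_nonneg (not_lt.1 hc) (by positivity)))
  exact ENNReal.toReal_pos_iff.1 h3

theorem inner_covarianceMatrix (H : IsGraphData κ h w) :
    ∀ᶠ ε in 𝓝[>] (0 : ℝ), ∀ u v : Euc (n + 1),
      ⟪u, Matrix.toEuclideanLin (covarianceMatrix σ (D ε)) v⟫_ℝ
      = (∫ x in flatPatch h ε, ⟪u, graphMap b p h x - p⟫_ℝ * ⟪v, graphMap b p h x - p⟫_ℝ * w x)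
        - (∫ x in flatPatch h ε, ⟪u, graphMap b p h x - p⟫_ℝ * w x)
          * (∫ x in flatPatch h ε, ⟪v, graphMap b p h x - p⟫_ℝ * w x)
          / ∫ x in flatPatch h ε, w x := by
  filter_upwards [hP.real_eq, hP.eventually_measure_pos_lt_top H, hP.integral]
    with ε h1 h2 h3 u v
  rw [PatchPCA.inner_covarianceMatrix (hP.subset ε) h2.1 h2.2, h1]
  rw [h3 (fun X => ⟪u, X - p⟫_ℝ * ⟪v, X - p⟫_ℝ) (by fun_prop),
    h3 (fun X => ⟪u, X - p⟫_ℝ) (by fun_prop), h3 (fun X => ⟪v, X - p⟫_ℝ) (by fun_prop)]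

/-- The eigenvalues of the covariance matrix to second order. When `H κ` increases along the
frame, the coefficients of `ε ^ (n + 4)` decrease, so the frame lists the tangential eigenvalues
in decreasing order. -/
theorem tendsto_covarianceEigenvalue (H : IsGraphData κ h w) (hn : 1 ≤ n)
    (hmono : Monotone fun μ => (∑ i, κ i) * κ μ) :
    (∀ μ : Fin n, Tendsto (fun ε => (covarianceEigenvalue σ (D ε) μ.castSucc
        - unitVol n / (n + 2) * ε ^ (n + 2)) / ε ^ (n + 4)) (𝓝[>] 0)
      (𝓝 ((2 * ∑ i, κ i ^ 2 - (∑ i, κ i) ^ 2 - 4 * (∑ i, κ i) * κ μ)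
        * (unitVol n / (8 * ((n + 2) * (n + 4))))))) ∧
    Tendsto (fun ε => covarianceEigenvalue σ (D ε) (Fin.last n) / ε ^ (n + 4)) (𝓝[>] 0)
      (𝓝 (((∑ i, κ i) ^ 2 + 2 * ∑ i, κ i ^ 2) * (unitVol n / ((n + 2) * (n + 4))) / 4
        - ((∑ i, κ i) * (unitVol n / (n + 2)) / 2) ^ 2 / unitVol n)) := by
  have hV := unitVol_pos (n := n)
  have h1 : ∀ (μ : Fin n) x, ⟪b μ.castSucc, graphMap b p h x - p⟫_ℝ = x μ := fun μ x => by
    rw [graphMap_sub, inner_add_right, inner_castSucc_hyperIncl, real_inner_smul_right,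
      inner_basis, if_neg (Fin.castSucc_lt_last μ).ne, mul_zero, add_zero]
  have h2 : ∀ x, ⟪b (Fin.last n), graphMap b p h x - p⟫_ℝ = h x := fun x => by
    rw [graphMap_sub, inner_add_right, inner_last_hyperIncl, real_inner_smul_right,
      inner_basis, if_pos rfl, mul_one, zero_add]
  have hent := hP.inner_covarianceMatrix H
  have hvol := H.tendsto_volume
  have hvol0 := hvol.eventually_const_lt hV
  simp only [covarianceEigenvalue_eq]
  refine tendsto_eigenvalues_of_block (fun ε => Matrix.isSymmetric_toEuclideanLin_iff.mpr
      (covarianceMatrix_isHermitian σ (D ε))) finrank_euclideanSpace_fin b (by positivity)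
    ?_ ?_ ?_ ?_
  · intro μ ν hμν
    have := hmono hμν
    simp only at this ⊢
    gcongr ?_ * _
    linarith
  · intro μ ν
    have l := (H.tendsto_coord_coord_moment hn μ ν).sub
      (((H.tendsto_coord_moment hn μ).mul (H.tendsto_coord_moment hn ν)).div hvol hV.ne')
    rw [zero_mul, zero_div, sub_zero] at l
    refine l.congr' ?_
    filter_upwards [hent, hvol0, eventually_pos] with ε e1 e2 hε
    simp only [e1, h1]
    have e3 : (∫ x in flatPatch h ε, w x) ≠ 0 := fun h0 => by simp [h0] at e2
    simp only [Pi.div_apply, pow_add]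
    field_simp
    ring
  · intro μ
    have l := (H.tendsto_coord_height_moment μ).sub ((((H.tendsto_coord_moment hn μ).mul
      (H.tendsto_height_moment hn)).div hvol hV.ne').mul tendsto_id_nhdsGT)
    rw [mul_zero, sub_zero] at l
    refine l.congr' ?_
    filter_upwards [hent, hvol0, eventually_pos] with ε e1 e2 hε
    simp only [e1, h1, h2]
    have e3 : (∫ x in flatPatch h ε, w x) ≠ 0 := fun h0 => by simp [h0] at e2
    simp only [Pi.div_apply, pow_add]
    field_simp
  · have l := (H.tendsto_height_sq_moment hn).sub
      (((H.tendsto_height_moment hn).pow 2).div hvol hV.ne')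
    refine l.congr' ?_
    filter_upwards [hent, hvol0, eventually_pos] with ε e1 e2 hε
    simp only [e1, h2, ← pow_two]
    have e3 : (∫ x in flatPatch h ε, w x) ≠ 0 := fun h0 => by simp [h0] at e2
    simp only [Pi.div_apply, pow_add]
    field_simp

end IsGraphPatch

end Expansion

/-! ### Patches of smooth hypersurfaces -/

section Hypersurface

variable {n : ℕ} {S : Set (Euc (n + 1))} {p : Euc (n + 1)} {N : Euc (n + 1) → Euc (n + 1)}
  {e : Fin n → Euc (n + 1)} {κ : Fin n → ℝ}

/-- The tangent frame completed by the unit normal. -/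
theorem exists_orthonormalBasis_snoc (he : Orthonormal ℝ e) {ν : Euc (n + 1)} (hν : ‖ν‖ = 1)
    (hνe : ∀ μ, ⟪ν, e μ⟫_ℝ = 0) :
    ∃ b : OrthonormalBasis (Fin (n + 1)) ℝ (Euc (n + 1)),
      (∀ μ : Fin n, b μ.castSucc = e μ) ∧ b (Fin.last n) = ν := by
  have ho : Orthonormal ℝ (Fin.snoc e ν : Fin (n + 1) → Euc (n + 1)) := by
    rw [orthonormal_iff_ite]
    have hee := orthonormal_iff_ite.1 he
    intro i j
    induction i using Fin.lastCases with
    | last =>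
      induction j using Fin.lastCases with
      | last => simp [hν]
      | cast j => simp [hνe, (Fin.castSucc_lt_last j).ne']
    | cast i =>
      induction j using Fin.lastCases with
      | last => simp [real_inner_comm, hνe, (Fin.castSucc_lt_last i).ne]
      | cast j => simp [hee]
  have hs : ⊤ ≤ Submodule.span ℝ (range (Fin.snoc e ν : Fin (n + 1) → Euc (n + 1))) := by
    rw [ho.linearIndependent.span_eq_top_of_card_eq_finrank (by simp)]
  refine ⟨OrthonormalBasis.mk ho hs, fun μ => ?_, ?_⟩
  · rw [OrthonormalBasis.coe_mk, Fin.snoc_castSucc]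
  · rw [OrthonormalBasis.coe_mk, Fin.snoc_last]

theorem norm_normal (hp : p ∈ S) (hN : IsUnitNormalNear S p N) : ‖N p‖ = 1 := by
  obtain ⟨W, -, hpW, -, h⟩ := hN
  exact (h p ⟨hp, hpW⟩).1

theorem inner_normal (hp : p ∈ S) (hN : IsUnitNormalNear S p N) {v : Euc (n + 1)}
    (hv : v ∈ tangentVectors S p) : ⟪N p, v⟫_ℝ = 0 := by
  obtain ⟨W, -, hpW, -, h⟩ := hN
  exact (h p ⟨hp, hpW⟩).2 v hv

theorem IsPrincipalFrame.fderiv_eq (he : IsPrincipalFrame S N p e κ) (μ : Fin n) :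
    fderiv ℝ N p (e μ) = -(κ μ • e μ) := by
  rw [← (he.2 μ).2, shapeOperator]; simp

/-- Around a point, a smooth hypersurface is a graph over its tangent hyperplane. The height
function and the volume density are cut off outside a small ball to make them measurable. -/
theorem exists_isGraphPatch (hS : IsSmoothHypersurface S) (hp : p ∈ S)
    (hN : IsUnitNormalNear S p N) (he : IsPrincipalFrame S N p e κ) :
    ∃ (b : OrthonormalBasis (Fin (n + 1)) ℝ (Euc (n + 1))) (h w : Euc n → ℝ),
      IsGraphData κ h w ∧ IsGraphPatch b p (hypersurfaceVolume S) (patch S p) h w := by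
  obtain ⟨b, hbe, hbN⟩ := exists_orthonormalBasis_snoc he.1 (norm_normal hp hN)
    fun μ => inner_normal hp hN (he.2 μ).1
  obtain ⟨W, F, hW, hpW, hF, hF', hSW⟩ := hS p hp
  have hFp : F p = 0 := (hSW ▸ (⟨hp, hpW⟩ : p ∈ S ∩ W) : p ∈ {q ∈ W | F q = 0}).2
  have htan : ∀ x, fderiv ℝ F p (hyperIncl b x) = 0 := fun x => by
    rw [hyperIncl_apply, map_sum]
    refine Finset.sum_eq_zero fun i _ => ?_
    rw [map_smul, hbe, fderiv_eq_zero_of_mem_tangentVectors (hW.mem_nhds hpW)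
      ((hF.contDiffAt (hW.mem_nhds hpW)).differentiableAt (by simp))
      (fun q hq => (hSW ▸ hq : q ∈ {q ∈ W | F q = 0}).2) (he.2 i).1, smul_zero]
  obtain ⟨U, W', h, hU, h0U, hW', hpW', hW'W, hh, h0, him⟩ :=
    exists_graphMap_image_eq b hW hpW hF hFp htan (hF' p hpW)
  have hSW' : graphMap b p h '' U = S ∩ W' := by
    rw [him]
    ext X
    constructor
    · rintro ⟨hX, hX0⟩
      exact ⟨(hSW.symm ▸ (⟨hW'W hX, hX0⟩ : X ∈ {q ∈ W | F q = 0}) : X ∈ S ∩ W).1, hX⟩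
    · rintro ⟨hXS, hX⟩
      exact ⟨hX, (hSW ▸ (⟨hXS, hW'W hX⟩ : X ∈ S ∩ W) : X ∈ {q ∈ W | F q = 0}).2⟩
  obtain ⟨h1, h2⟩ := fderiv_graph_function b hN hbN (κ := κ)
    (fun i => by rw [hbe, he.fderiv_eq]) hU h0U hh h0
    fun x hx => (hSW' ▸ mem_image_of_mem _ hx : graphMap b p h x ∈ S ∩ W').1
  obtain ⟨r, hr, hrU⟩ := Metric.isOpen_iff.1 hU 0 h0U
  obtain ⟨r', hr', hrW⟩ := Metric.isOpen_iff.1 hW' p hpW'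
  set w : Euc n → ℝ := fun x =>
    Real.sqrt (1 + ∑ i, fderiv ℝ h x (EuclideanSpace.single i 1) ^ 2) with hw
  have hwc : ContinuousOn w U := by
    have : ContinuousOn (fderiv ℝ h) U := hh.continuousOn_fderiv_of_isOpen hU (by simp)
    refine Real.continuous_sqrt.comp_continuousOn (continuousOn_const.add ?_)
    exact continuousOn_finsetSum _ fun i _ => (this.clm_apply continuousOn_const).pow 2
  have hd : ∀ᶠ x in 𝓝 0, DifferentiableAt ℝ h x := by
    filter_upwards [hU.mem_nhds h0U] with x hx
    exact (hh.contDiffAt (hU.mem_nhds hx)).differentiableAt (by simp)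
  set B : Set (Euc n) := Metric.ball 0 r with hB
  have hBm : MeasurableSet B := measurableSet_ball
  have hB0 : B ∈ 𝓝 0 := Metric.ball_mem_nhds 0 hr
  have hmeas : ∀ {f : Euc n → ℝ}, ContinuousOn f U → Measurable (B.indicator f) := fun hf => by
    classical
    rw [← piecewise_eq_indicator]
    exact (hf.mono hrU).measurable_piecewise continuousOn_const hBm
  refine ⟨b, B.indicator h, B.indicator w,
    ⟨hmeas hh.continuousOn, hmeas hwc, ?_, ?_⟩, fun ε => inter_subset_right, ?_⟩
  · refine (sub_diagForm_isLittleO hd h0 h1 h2).congr' ?_ EventuallyEq.rfl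
    filter_upwards [hB0] with x hx
    rw [indicator_of_mem hx]
  · refine (sqrt_det_isLittleO h1 h2).congr' ?_ EventuallyEq.rfl
    filter_upwards [hB0] with x hx
    rw [indicator_of_mem hx]
  · filter_upwards [eventually_pos, tendsto_id_nhdsGT.eventually_lt_const hr,
      tendsto_id_nhdsGT.eventually_lt_const hr'] with ε hε hεr hεr' G hG
    rw [setIntegral_patch b hU hh hW' hSW' hε.le
      ((Metric.closedBall_subset_ball hεr').trans hrW) hG]
    -- the cut-off is invisible on patches of radius less than `r`
    have hsmall : ∀ (x : Euc n) (t : ℝ), ‖x‖ ^ 2 + t ^ 2 ≤ ε ^ 2 → x ∈ B := fun x t hx => by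
      rw [hB, mem_ball_zero_iff]
      refine lt_of_le_of_lt (abs_le_of_sq_le_sq' ?_ hε.le).2 hεr
      linarith [sq_nonneg t]
    have hset : {x ∈ U | ‖x‖ ^ 2 + h x ^ 2 ≤ ε ^ 2} = flatPatch (B.indicator h) ε := by
      ext x
      constructor
      · rintro ⟨-, hx⟩
        simpa only [flatPatch, mem_ofPred_eq, indicator_of_mem (hsmall x _ hx)] using hx
      · intro hx
        have hxB := hsmall x _ hx
        exact ⟨hrU hxB, by simpa only [flatPatch, mem_ofPred_eq, indicator_of_mem hxB] using hx⟩
    rw [hset]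
    refine setIntegral_congr_fun (measurableSet_flatPatch (hmeas hh.continuousOn) ε) fun x hx => ?_
    have hxB := hsmall x _ hx
    simp only [graphMap, indicator_of_mem hxB, hw]

theorem ballVolume_eq {ε : ℝ} (hε : 0 ≤ ε) : ballVolume n ε = ε ^ n * unitVol n := by
  rw [ballVolume, unitVol, Measure.real, Measure.addHaar_closedBall' _ _ hε,
    finrank_euclideanSpace_fin, ENNReal.toReal_mul, ENNReal.toReal_ofReal (by positivity)]
  rfl

/-- Limits of the ratios of eigenvalues from their second order expansions. -/
theorem tendsto_ratios {lam₁ lam₂ lam₀ : ℝ → ℝ} {d₁ d₂ c : ℝ}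
    (h₁ : Tendsto (fun ε => (lam₁ ε - unitVol n / (n + 2) * ε ^ (n + 2)) / ε ^ (n + 4))
      (𝓝[>] 0) (𝓝 d₁))
    (h₂ : Tendsto (fun ε => (lam₂ ε - unitVol n / (n + 2) * ε ^ (n + 2)) / ε ^ (n + 4))
      (𝓝[>] 0) (𝓝 d₂))
    (h₀ : Tendsto (fun ε => lam₀ ε / ε ^ (n + 4)) (𝓝[>] 0) (𝓝 c)) :
    (∀ᶠ ε in 𝓝[>] 0, 0 < lam₁ ε) ∧
    Tendsto (fun ε => ballVolume n ε * ((lam₁ ε - lam₂ ε) / (lam₁ ε * lam₂ ε))) (𝓝[>] 0)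
      (𝓝 ((n + 2) ^ 2 / unitVol n * (d₁ - d₂))) ∧
    Tendsto (fun ε => ballVolume n ε * (lam₀ ε / (lam₁ ε * lam₂ ε))) (𝓝[>] 0)
      (𝓝 ((n + 2) ^ 2 / unitVol n * c)) := by
  have hV := unitVol_pos (n := n)
  have ha : 0 < unitVol n / (n + 2) := by positivity
  -- the leading term of the tangential eigenvalues
  have lead : ∀ {lam : ℝ → ℝ} {d : ℝ}, Tendsto (fun ε => (lam ε - unitVol n / (n + 2)
      * ε ^ (n + 2)) / ε ^ (n + 4)) (𝓝[>] 0) (𝓝 d) →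
      Tendsto (fun ε => lam ε / ε ^ (n + 2)) (𝓝[>] 0) (𝓝 (unitVol n / (n + 2))) := by
    intro lam d hl
    have := (hl.mul (tendsto_id_nhdsGT.pow 2)).const_add (unitVol n / (n + 2))
    rw [zero_pow two_ne_zero, mul_zero, add_zero] at this
    refine this.congr' ?_
    filter_upwards [eventually_pos] with ε hε
    simp only [pow_add]
    field_simp
    ring
  have l₁ := lead h₁
  have l₂ := lead h₂
  have p₁ := l₁.eventually_const_lt ha
  have p₂ := l₂.eventually_const_lt ha
  have pos : ∀ {x ε : ℝ}, 0 < ε → 0 < x / ε ^ (n + 2) → 0 < x := fun hε hx => by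
    by_contra hc
    exact absurd hx (not_lt.2 (div_nonpos_of_nonpos_of_nonneg (not_lt.1 hc) (by positivity)))
  have e : ∀ x : ℝ, (n + 2) ^ 2 / unitVol n * x
      = unitVol n * (x / (unitVol n / (n + 2) * (unitVol n / (n + 2)))) := fun x => by
    field_simp
  -- the powers of `ε` cancel: `n + (n + 4) = 2 * (n + 2)`
  have key : ∀ {f : ℝ → ℝ} {x : ℝ}, Tendsto (fun ε => f ε / ε ^ (n + 4)) (𝓝[>] 0) (𝓝 x) →
      Tendsto (fun ε => ballVolume n ε * (f ε / (lam₁ ε * lam₂ ε))) (𝓝[>] 0)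
        (𝓝 ((n + 2) ^ 2 / unitVol n * x)) := by
    intro f x hf
    rw [e]
    refine ((hf.div (l₁.mul l₂) (by positivity)).const_mul (unitVol n)).congr' ?_
    filter_upwards [eventually_pos, p₁, p₂] with ε hε q₁ q₂
    have := pos hε q₁
    have := pos hε q₂
    rw [ballVolume_eq hε.le]
    simp only [Pi.div_apply, pow_add]
    field_simp
  refine ⟨?_, key ((h₁.sub h₂).congr fun ε => by ring), key h₀⟩
  filter_upwards [eventually_pos, p₁] with ε hε q₁ using pos hε q₁

theorem meanCurvature_comp (κ : Fin n → ℝ) (s : Equiv.Perm (Fin n)) :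
    meanCurvature (κ ∘ s) = meanCurvature κ :=
  Equiv.sum_comp s κ

theorem IsPrincipalFrame.comp (he : IsPrincipalFrame S N p e κ) (s : Equiv.Perm (Fin n)) :
    IsPrincipalFrame S N p (e ∘ s) (κ ∘ s) :=
  ⟨he.1.comp s s.injective, fun μ => he.2 (s μ)⟩

theorem IsPrincipalFrame.scalarCurvature_eq (hp : p ∈ S) (hN : IsUnitNormalNear S p N)
    (he : IsPrincipalFrame S N p e κ) :
    scalarCurvature N p e = meanCurvature κ ^ 2 - ∑ μ, κ μ ^ 2 := by
  refine PatchPCA.scalarCurvature_eq ?_ (norm_normal hp hN) he.1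
    (fun μ => inner_normal hp hN (he.2 μ).1) he.fderiv_eq
  obtain ⟨W, hW, hpW, hNW, -⟩ := hN
  exact hNW.contDiffAt (hW.mem_nhds hpW)

end Hypersurface

end PatchPCA

theorem mainTheorem9 (n : ℕ) (hn : 1 ≤ n)
    (S : Set (PatchPCA.Euc (n + 1))) (hS : PatchPCA.IsSmoothHypersurface S)
    (p : PatchPCA.Euc (n + 1)) (hp : p ∈ S)
    (N : PatchPCA.Euc (n + 1) → PatchPCA.Euc (n + 1)) (hN : PatchPCA.IsUnitNormalNear S p N)
    (e : Fin n → PatchPCA.Euc (n + 1)) (κ : Fin n → ℝ)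
    (he : PatchPCA.IsPrincipalFrame S N p e κ) :
    (∀ᶠ ε in 𝓝[>] (0 : ℝ),
      0 < PatchPCA.hypersurfaceVolume S (PatchPCA.patch S p ε) ∧
      PatchPCA.hypersurfaceVolume S (PatchPCA.patch S p ε) < ⊤ ∧
      ∀ i : Fin n, 0 < PatchPCA.patchEigenvalue S p ε i.castSucc) ∧
    ∃ τ : Equiv.Perm (Fin n),
      (∀ μ ν : Fin n, PatchPCA.meanCurvature κ * κ μ < PatchPCA.meanCurvature κ * κ ν →
        τ μ < τ ν) ∧
      ∀ μ ν : Fin n,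
        Tendsto
          (fun ε : ℝ => PatchPCA.ballVolume n ε *
            ((PatchPCA.patchEigenvalue S p ε (τ μ).castSucc
                - PatchPCA.patchEigenvalue S p ε (τ ν).castSucc) /
              (PatchPCA.patchEigenvalue S p ε (τ μ).castSucc
                * PatchPCA.patchEigenvalue S p ε (τ ν).castSucc)))
          (𝓝[>] 0)
          (𝓝 (((n : ℝ) + 2) / (2 * ((n : ℝ) + 4)) * (κ ν - κ μ) * PatchPCA.meanCurvature κ)) ∧
        Tendsto
          (fun ε : ℝ => PatchPCA.ballVolume n ε *
            (PatchPCA.patchEigenvalue S p ε (Fin.last n) /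
              (PatchPCA.patchEigenvalue S p ε (τ μ).castSucc
                * PatchPCA.patchEigenvalue S p ε (τ ν).castSucc)))
          (𝓝[>] 0)
          (𝓝 (((n : ℝ) + 2) / (2 * ((n : ℝ) + 4)) *
            (((n : ℝ) + 1) / ((n : ℝ) + 2) * PatchPCA.meanCurvature κ ^ 2
              - PatchPCA.scalarCurvature N p e))) := by
  -- sort the frame so that the tangential eigenvalues appear in decreasing order
  set H := PatchPCA.meanCurvature κ with hH
  set s : Equiv.Perm (Fin n) := Tuple.sort fun μ => H * κ μ with hs
  have hmono : Monotone fun μ => (∑ i, (κ ∘ s) i) * (κ ∘ s) μ := by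
    have h1 : ∑ i, (κ ∘ s) i = H := PatchPCA.meanCurvature_comp κ s
    rw [h1]
    exact Tuple.monotone_sort fun μ => H * κ μ
  obtain ⟨b, h, w, hG, hP⟩ := PatchPCA.exists_isGraphPatch hS hp hN (he.comp s)
  obtain ⟨hev, hev'⟩ := hP.tendsto_covarianceEigenvalue hG hn hmono
  have h1 : ∑ i, (κ ∘ s) i = H := PatchPCA.meanCurvature_comp κ s
  have h2 : ∑ i, (κ ∘ s) i ^ 2 = ∑ i, κ i ^ 2 := Equiv.sum_comp s fun i => κ i ^ 2
  rw [h1, h2] at hev'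
  simp only [h1, h2] at hev
  have hV := PatchPCA.unitVol_pos (n := n)
  refine ⟨?_, s.symm, fun μ ν hμν => ?_, fun μ ν => ?_⟩
  · have hpos := eventually_all.2 fun i => (PatchPCA.tendsto_ratios (hev i) (hev i) hev').1
    filter_upwards [hP.eventually_measure_pos_lt_top hG, hpos] with ε q1 q2
    exact ⟨q1.1, q1.2, q2⟩
  · by_contra hc
    have := Tuple.monotone_sort (fun μ => H * κ μ) (not_lt.1 hc)
    simp only [Function.comp_apply, ← hs, Equiv.apply_symm_apply] at this
    exact absurd hμν (not_lt.2 this)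
  · obtain ⟨-, l1, l2⟩ := PatchPCA.tendsto_ratios (hev (s.symm μ)) (hev (s.symm ν)) hev'
    simp only [Function.comp_apply, Equiv.apply_symm_apply] at l1
    simp only [PatchPCA.patchEigenvalue]
    refine ⟨?_, ?_⟩
    · convert l1 using 2
      field_simp
      ring
    · convert l2 using 2
      rw [he.scalarCurvature_eq hp hN, ← hH]
      field_simp
      ring
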